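/- Let $A$ be a commutative $\mathbb{C}$-algebra (of functions of $\mathfrak t=(t_1=x,t_2,t_3,\dots)$) with commuting derivations $\partial_{t_n}$, $n\ge 1$, and $\partial=\partial_{t_1}$. Let $\mathfrak D=1+\sum_{i\ge1}w_i\partial^{-i}$ be a dressing operator of the KP hierarchy, $\mathfrak L=\mathfrak D\partial\mathfrak D^{-1}$, $\mathfrak D_{t_n}=-(\mathfrak L^n)_{<0}\mathfrak D$, with wave functions $\psi=\mathfrak D(e^{\eta})$, $\psi^*=(\mathfrak D^{-1})^*(e^{-\eta})$, $\eta=\sum_{i\ge1} t_i\lambda^i$, and invertible tau function $\tau_{\rm KP}$, i.e. $\psi=\frac{\tau_{\rm KP}(t_1-\lambda^{-1},\,t_2-\lambda^{-2}/2,\dots)}{\tau_{\rm KP}(\mathfrak t)}e^{\eta}$. Let $q_1,\dots,q_k,q'$ be eigenfunctions ($f_{t_n}=(\mathfrak L^n)_{\ge0}(f)$) and $r_1,\dots,r_k,r'$ adjoint eigenfunctions ($g_{t_n}=-((\mathfrak L^n)_{\ge 0})^*(g)$), and let $\Omega(f,g)$ be squared eigenfunction potentials (SEPs) of these functions, i.e.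 elements of $A$ with $\Omega(f,g)_x=fg$ and $\Omega(f,g)_{t_n}={\rm Res}_\partial(\partial^{-1}g(\mathfrak L^n)_{\ge0}f\partial^{-1})$. Let $\partial^*_{q_i,r_i}$ be the squared eigenfunction flow. It is the derivation commuting with $\partial$, on differential polynomials in the coefficients of $\mathfrak D$, the (adjoint) eigenfunctions, the SEPs and $\tau_{\rm KP}$, such that $$\partial^*_{q_i,r_i}\mathfrak D=q_i\partial^{-1}r_i\mathfrak D,\quad \partial^*_{q_i,r_i}f=q_i\Omega(f,r_i),\quad \partial^*_{q_i,r_i}g=r_i\Omega(q_i,g),$$ $$\partial^*_{q_i,r_i}\Omega(f,g)=\Omega(q_i,g)\Omega(f,r_i),\quad \partial^*_{q_i,r_i}\tau_{\rm KP}=-\Omega(q_i,r_i)\tau_{\rm KP},$$ acting on $\psi$ and $\psi^*$ through the coefficients of $\mathfrak D$ and on $e^{\pm\eta}$ by zero. Let $\mathfrak N$ be any of $\mathfrak L,\mathfrak D,q',r',\psi,\psi^*,\Omega(q',r'),\tau_{\rm KP}$, and put $e^{\sum_{i=1}^k\partial^*_{q_i,r_i}}\mathfrak N=\sum_{m\ge0}\frac1{m!}\bigl(\sum_{i=1}^k\partial^*_{q_i,r_i}\bigr)^m\mathfrak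 N$. Let $\mathfrak N^{[k]}$ be the result of the chain of binary Darboux transformations $T(q_1,r_1)$, $T(q_2^{[1]},r_2^{[1]})$, …, $T(q_k^{[k-1]},r_k^{[k-1]})$. Here $T(q,r)=T_I(r^{(1)})T_D(q)$, with $r^{(1)}$ the image of $r$ under $T_D(q)$, $T_D(q)=q\partial q^{-1}$ and $T_I(r)=r^{-1}\partial^{-1}r$. Each transformation $T$ of the type $T_D$ or $T_I$ acts on eigenfunctions by $f\mapsto T(f)$ and on adjoint eigenfunctions by $g\mapsto T^{-1*}(g)$, where $\partial^{-1}(fg)$ is read as $\Omega(f,g)$. Moreover $T_D(q)$ acts by $$\mathfrak D\mapsto T_D(q)\,\mathfrak D\,\partial^{-1},\quad \Omega(f,g)\mapsto\Omega(f,g)-q^{-1}f\,\Omega(q,g),\quad \tau_{\rm KP}\mapsto q\,\tau_{\rm KP},$$ and $T_I(r)$ acts by $$\mathfrak D\mapsto T_I(r)\,\mathfrak D\,\partial,\quad \Omega(f,g)\mapsto\Omega(f,g)-r^{-1}g\,\Omega(f,r),\quad \tau_{\rm KP}\mapsto r\,\tau_{\rm KP};$$ $\mathfrak L,\psi,\psi^*$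 are transformed through $\mathfrak D$. In the chain the constants in the SEPs are chosen so that $\Omega(q_i,r_j)$ is replaced from the start by $\Omega(q_i,r_j)-\delta_{ij}$, the other SEPs being kept. Then $\mathfrak N^{[k]}=e^{\sum_{i=1}^k\partial^*_{q_i,r_i}}\mathfrak N$ for every such $\mathfrak N$, in both of the following senses (for operators and wave functions, coefficient by coefficient). 1. With a formal parameter $\varepsilon$. If $q_1,\dots,q_k$ are invertible, then over $A[[\varepsilon]]$ all $k$ steps of the chain for the pairs $(q_i,\varepsilon r_i)$ (so that $\Omega(q_i,\varepsilon r_j)=\varepsilon\Omega(q_i,r_j)$ is replaced by $\varepsilon\Omega(q_i,r_j)-\delta_{ij}$) are defined, and $$\mathfrak N^{[k]}=e^{\varepsilon\sum_{i=1}^k\partial^*_{q_i,r_i}}\mathfrak N .$$ 2. Without the parameter. Let $A$ carry a Hausdorff ring topology. If all $k$ steps of the chain for the pairs $(q_i,r_i)$ are defined, i.e. $q_i^{[i-1]}$ and $\Omega(q_i,r_i)^{[i-1]}$ are invertible for each $i$, then $\mathfrak N^{[k]}$ is the sum of the series $e^{\sum_{i=1}^k\partial^*_{q_i,r_i}}\mathfrak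 N$ whenever this series converges. In both cases the transformed objects again form a solution of the KP hierarchy: $\mathfrak D^{[k]}$ is a dressing operator, the functions $f^{[k]}$ and $g^{[k]}$ are eigenfunctions and adjoint eigenfunctions with SEPs $\Omega(f,g)^{[k]}$, and $\tau_{\rm KP}^{[k]}$ is an invertible tau function of $\mathfrak D^{[k]}$. -/

import Mathlib

noncomputable section

namespace KP

/-! ### Formal pseudo-differential operators

`A` is a commutative `ℂ`-algebra of functions and `δ` the derivation `∂ = ∂ / ∂x` on it. -/

/-- A formal pseudo-differential operator `∑_{i ≤ N} aᵢ ∂ⁱ`, with `aᵢ = coeff i`. -/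
@[ext]
structure PsiDO {A : Type*} [CommRing A] [Algebra ℂ A] (δ : Derivation ℂ A A) where
  coeff : ℤ → A
  bdd : ∃ N : ℤ, ∀ i, N < i → coeff i = 0

namespace PsiDO

variable {A : Type*} [CommRing A] [Algebra ℂ A] {δ : Derivation ℂ A A}

/-- The operator `a ∂ⁿ`. -/
def monomial (n : ℤ) (a : A) : PsiDO δ where
  coeff i := if i = n then a else 0
  bdd := ⟨n, fun i hi => by simp [ne_of_gt hi]⟩

/-- The operator of multiplication by the function `a`. -/
def fn (a : A) : PsiDO δ := monomial 0 a

/-- The operator `∂ⁿ`. -/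
def dpow (n : ℤ) : PsiDO δ := monomial n 1

instance : One (PsiDO δ) := ⟨fn 1⟩

instance : Neg (PsiDO δ) where
  neg P :=
    { coeff := fun i => - P.coeff i
      bdd := by
        obtain ⟨N, hN⟩ := P.bdd
        exact ⟨N, fun i hi => by simp [hN i hi]⟩ }

instance : Sub (PsiDO δ) where
  sub P Q :=
    { coeff := fun i => P.coeff i - Q.coeff i
      bdd := by
        obtain ⟨N, hN⟩ := P.bdd
        obtain ⟨M, hM⟩ := Q.bdd
        exact ⟨max N M, fun i hi => by
          simp [hN i (lt_of_le_of_lt (le_max_left _ _) hi),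
            hM i (lt_of_le_of_lt (le_max_right _ _) hi)]⟩ }

/-- The product determined by `∂ⁱ b = ∑_{l ≥ 0} (i choose l) b⁽ˡ⁾ ∂ⁱ⁻ˡ` for all integers `i`:
the coefficient of `∂ᵐ` in `P Q` is the sum of `(i choose l) aᵢ bⱼ⁽ˡ⁾` over `i + j - l = m`.
Only finitely many terms are nonzero. -/
instance : Mul (PsiDO δ) where
  mul P Q :=
    { coeff := fun m => ∑ᶠ p : ℤ × ℕ,
        Ring.choose p.1 p.2 • (P.coeff p.1 * δ^[p.2] (Q.coeff (m - p.1 + p.2)))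
      bdd := by
        obtain ⟨N, hN⟩ := P.bdd
        obtain ⟨M, hM⟩ := Q.bdd
        refine ⟨N + M, fun m hm => ?_⟩
        have hz : ∀ l : ℕ, δ^[l] (0 : A) = 0 := fun l => by
          induction l with
          | zero => rfl
          | succ l ih => rw [Function.iterate_succ_apply', ih, map_zero]
        have h0 : ∀ p : ℤ × ℕ,
            Ring.choose p.1 p.2 • (P.coeff p.1 * δ^[p.2] (Q.coeff (m - p.1 + p.2))) = 0 := by
          intro p
          by_cases hp : N < p.1
          · rw [hN _ hp]; simp
          · rw [hM (m - p.1 + p.2) (by have := p.2.cast_nonneg (α := ℤ); omega), hz]; simp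
        simp [h0] }

/-- Powers `Pⁿ`. -/
def pow (P : PsiDO δ) : ℕ → PsiDO δ
  | 0 => 1
  | n + 1 => P * pow P n

/-- The inverse of `P = 1 + (terms of negative order)`, that is `∑_m (1 - P)ᵐ`; the coefficient of
`∂ⁿ` only receives contributions from `m ≤ -n`. -/
def inv (P : PsiDO δ) : PsiDO δ where
  coeff n := if n ≤ 0 then ∑ m ∈ Finset.range (n.natAbs + 1), (pow (1 - P) m).coeff n else 0
  bdd := ⟨0, fun i hi => by simp [not_le.mpr hi]⟩

/-- The differential part `P_{≥ 0}`. -/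
def nonnegPart (P : PsiDO δ) : PsiDO δ where
  coeff i := if 0 ≤ i then P.coeff i else 0
  bdd := by
    obtain ⟨N, hN⟩ := P.bdd
    exact ⟨N, fun i hi => by simp [hN i hi]⟩

/-- The integral part `P_{< 0}`. -/
def negPart (P : PsiDO δ) : PsiDO δ where
  coeff i := if i < 0 then P.coeff i else 0
  bdd := by
    obtain ⟨N, hN⟩ := P.bdd
    exact ⟨N, fun i hi => by simp [hN i hi]⟩

/-- The formal adjoint `P* = ∑ᵢ (-∂)ⁱ aᵢ`. -/
def adj (P : PsiDO δ) : PsiDO δ where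
  coeff m := ∑ᶠ l : ℕ,
    (((-1 : ℤˣ) ^ (m + (l : ℤ)) : ℤˣ) : ℤ) • Ring.choose (m + (l : ℤ)) l •
      δ^[l] (P.coeff (m + l))
  bdd := by
    obtain ⟨N, hN⟩ := P.bdd
    refine ⟨N, fun m hm => ?_⟩
    have hz : ∀ l : ℕ, δ^[l] (0 : A) = 0 := fun l => by
      induction l with
      | zero => rfl
      | succ l ih => rw [Function.iterate_succ_apply', ih, map_zero]
    have h0 : ∀ l : ℕ, (((-1 : ℤˣ) ^ (m + (l : ℤ)) : ℤˣ) : ℤ) • Ring.choose (m + (l : ℤ)) l •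
        δ^[l] (P.coeff (m + l)) = 0 := by
      intro l
      rw [hN (m + l) (by have := l.cast_nonneg (α := ℤ); omega), hz]
      simp
    simp only [h0, finsum_zero]

/-- The residue `Res_∂ P`, the coefficient of `∂⁻¹`. -/
def res (P : PsiDO δ) : A := P.coeff (-1)

/-- The function `P(f)`, for a differential operator `P`. -/
def apply (P : PsiDO δ) (f : A) : A := ∑ᶠ i : ℕ, P.coeff i * δ^[i] f

/-- A derivation of `A` acting on the coefficients of an operator. -/
def derivCoeff (d : Derivation ℂ A A) (P : PsiDO δ) : PsiDO δ where
  coeff i := d (P.coeff i)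
  bdd := by
    obtain ⟨N, hN⟩ := P.bdd
    exact ⟨N, fun i hi => by simp [hN i hi]⟩

/-- For `s = 1` or `s = -1` and `η = ∑ᵢ tᵢ λⁱ`, one has `∂ⁿ(e^{sη}) = sⁿ λⁿ e^{sη}`, so that
`P(e^{sη}) = (∑ₙ sⁿ aₙ λⁿ) e^{sη}`; this is the coefficient of `λⁿ` in the first factor. -/
def applyExp (s : ℤˣ) (P : PsiDO δ) (n : ℤ) : A := ((s ^ n : ℤˣ) : ℤ) • P.coeff n

end PsiDO

/-! ### Solutions of the KP hierarchy -/

/-- Dressing operator `D`, eigenfunctions `q`, adjoint eigenfunctions `r`, SEPs `Ω a b = Ω(q_a, r_b)`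
and tau function `τ`. The indices `some i` are for the pairs `(qᵢ, rᵢ)` that generate the Darboux
transformation, the index `none` is for a further eigenfunction `q'` and a further adjoint
eigenfunction `r'`. -/
@[ext]
structure Data {A : Type*} [CommRing A] [Algebra ℂ A] (δ : Derivation ℂ A A) (k : ℕ) where
  D : PsiDO δ
  q : Option (Fin k) → A
  r : Option (Fin k) → A
  Ω : Option (Fin k) → Option (Fin k) → A
  τ : A

/-- The objects to be transformed: the coefficients of the Lax operator and of the dressing operator,
`q'`, `r'`, the coefficients of the wave function and of the adjoint wave function,
`Ω(q', r')`, and `τ`. -/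
inductive Obs
  | lax (n : ℤ)
  | dressing (n : ℤ)
  | eigenfunction
  | adjointEigenfunction
  | wave (n : ℤ)
  | adjointWave (n : ℤ)
  | sep
  | tau

namespace Data

variable {A : Type*} [CommRing A] [Algebra ℂ A] {δ : Derivation ℂ A A} {k : ℕ}

/-- The Lax operator `L = D ∂ D⁻¹`. -/
def L (S : Data δ k) : PsiDO δ := S.D * PsiDO.dpow 1 * S.D.inv

/-- The value of each of the objects; `ψ = D(e^η)` and `ψ* = (D⁻¹)*(e^{-η})`. -/
def val (S : Data δ k) : Obs → A
  | .lax n => S.L.coeff n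
  | .dressing n => S.D.coeff n
  | .eigenfunction => S.q none
  | .adjointEigenfunction => S.r none
  | .wave n => S.D.applyExp 1 n
  | .adjointWave n => S.D.inv.adj.applyExp (-1) n
  | .sep => S.Ω none none
  | .tau => S.τ

end Data

/-- The coefficient of `λ⁻ⁿ` in the Taylor expansion of
`f(t₁ - λ⁻¹, t₂ - λ⁻² / 2, t₃ - λ⁻³ / 3, …) = exp(-∑_{m ≥ 1} (λ⁻ᵐ / m) ∂_{t_m}) f`, where
`d m = ∂_{t_{m+1}}`, computed by comparing coefficients in the logarithmic derivative of the
exponential with respect to `λ⁻¹`. -/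
def miwaShift {A : Type*} [CommRing A] [Algebra ℂ A] (d : ℕ → Derivation ℂ A A) (f : A) : ℕ → A
  | 0 => f
  | n + 1 => -(((n : ℂ) + 1)⁻¹ • ∑ m : Fin (n + 1), d m (miwaShift d f (n - m)))
decreasing_by omega

/-- `S` is a solution of the KP hierarchy with times `t₁ = x, t₂, t₃, …`, where `d n = ∂_{t_{n+1}}`,
together with eigenfunctions, adjoint eigenfunctions, their SEPs, and a tau function. -/
structure IsSolution {A : Type*} [CommRing A] [Algebra ℂ A] {k : ℕ} (d : ℕ → Derivation ℂ A A)
    (S : Data (d 0) k) : Prop where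
  coeff_zero : S.D.coeff 0 = 1
  coeff_pos : ∀ i, 0 < i → S.D.coeff i = 0
  dressing : ∀ n, S.D.derivCoeff (d n) = -((S.L.pow (n + 1)).negPart * S.D)
  eigenfunction : ∀ a n, d n (S.q a) = (S.L.pow (n + 1)).nonnegPart.apply (S.q a)
  adjointEigenfunction : ∀ b n, d n (S.r b) = -(S.L.pow (n + 1)).nonnegPart.adj.apply (S.r b)
  sep_x : ∀ a b, d 0 (S.Ω a b) = S.q a * S.r b
  sep : ∀ a b n, d n (S.Ω a b) =
    (PsiDO.dpow (-1) * PsiDO.fn (S.r b) * (S.L.pow (n + 1)).nonnegPart * PsiDO.fn (S.q a) *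
      PsiDO.dpow (-1)).res
  isUnit_tau : IsUnit S.τ
  /-- `ψ(t, λ) = (τ(t₁ - λ⁻¹, t₂ - λ⁻² / 2, …) / τ(t)) e^{η(t, λ)}` -/
  tau : ∀ n : ℕ, S.D.applyExp 1 (-n) * S.τ = miwaShift d S.τ n

/-! ### Binary Darboux transformations -/

namespace Data

variable {A : Type*} [CommRing A] [Algebra ℂ A] {δ : Derivation ℂ A A} {k : ℕ}

/-- The differential-type Darboux transformation `T_D(q_a) = q_a ∂ q_a⁻¹`: operators `D` go to
`T D ∂⁻¹`, eigenfunctions to `T(q_b)`, adjoint eigenfunctions to `T⁻¹*(r_b)`, with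
`∂⁻¹(q_a r_b) = Ω(q_a, r_b)`. -/
def darbouxD (S : Data δ k) (a : Option (Fin k)) : Data δ k where
  D := PsiDO.fn (S.q a) * PsiDO.dpow 1 * PsiDO.fn (Ring.inverse (S.q a)) * S.D * PsiDO.dpow (-1)
  q b := S.q a * δ (Ring.inverse (S.q a) * S.q b)
  r b := -(Ring.inverse (S.q a) * S.Ω a b)
  Ω b c := S.Ω b c - Ring.inverse (S.q a) * S.q b * S.Ω a c
  τ := S.q a * S.τ

/-- The integral-type Darboux transformation `T_I(r_c) = r_c⁻¹ ∂⁻¹ r_c`: operators `D` go to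
`T D ∂`, eigenfunctions to `T(q_b)`, with `∂⁻¹(r_c q_b) = Ω(q_b, r_c)`, and adjoint eigenfunctions
to `T⁻¹*(r_b)`. -/
def darbouxI (S : Data δ k) (c : Option (Fin k)) : Data δ k where
  D := PsiDO.fn (Ring.inverse (S.r c)) * PsiDO.dpow (-1) * PsiDO.fn (S.r c) * S.D * PsiDO.dpow 1
  q b := Ring.inverse (S.r c) * S.Ω b c
  r b := -(S.r c * δ (Ring.inverse (S.r c) * S.r b))
  Ω a b := S.Ω a b - Ring.inverse (S.r c) * S.r b * S.Ω a c
  τ := S.r c * S.τ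

/-- The binary Darboux transformation `T(qᵢ, rᵢ) = T_I(rᵢ⁽¹⁾) T_D(qᵢ)`. -/
def binaryDarboux (S : Data δ k) (i : Fin k) : Data δ k :=
  (S.darbouxD (some i)).darbouxI (some i)

/-- The chain of transformations `T(q₁, r₁)`, `T(q₂⁽¹⁾, r₂⁽¹⁾)`, …: the result of the first `j`
steps. -/
def chain (S : Data δ k) : ℕ → Data δ k
  | 0 => S
  | j + 1 => if h : j < k then (S.chain j).binaryDarboux ⟨j, h⟩ else S.chain j

/-- The `k`-step binary Darboux transformation. -/
def darboux (S : Data δ k) : Data δ k := S.chain k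

/-- Each of the `k` steps is defined: its generating eigenfunction and the SEP of its generating pair
are invertible. -/
def DarbouxDefined (S : Data δ k) : Prop :=
  ∀ i : Fin k, IsUnit ((S.chain i).q (some i)) ∧ IsUnit ((S.chain i).Ω (some i) (some i))

/-- Change of the constants in the SEPs: `Ω(qᵢ, rⱼ)` is replaced by `Ω(qᵢ, rⱼ) - δᵢⱼ`, and the
others are kept. -/
def shift (S : Data δ k) : Data δ k :=
  { S with
    Ω := fun a b =>
      match a, b with
      | some i, some j => S.Ω (some i) (some j) - if i = j then 1 else 0
      | a, b => S.Ω a b }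

end Data

/-! ### Squared eigenfunction flows

The flow `∂*_{qᵢ, rᵢ}` acts on differential polynomials in the coefficients of the dressing operator,
the (adjoint) eigenfunctions, the SEPs and the tau function. It is a derivation of the algebra of
these polynomials, which are then evaluated on the given solution. -/

/-- The variables: the `l`-th `x`-derivatives of the coefficient `w_{n+1}` of `∂⁻ⁿ⁻¹` in `D`, of
`q_a`, of `r_b` and of `τ`, and the SEPs. -/
inductive JetVar (k : ℕ)
  | w (n l : ℕ)
  | q (a : Option (Fin k)) (l : ℕ)
  | r (b : Option (Fin k)) (l : ℕ)
  | Ω (a b : Option (Fin k))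
  | τ (l : ℕ)

/-- Differential polynomials. -/
abbrev JetRing (k : ℕ) := MvPolynomial (JetVar k) ℂ

/-- The total derivative `∂ = ∂ / ∂x` of differential polynomials, with `Ω(q_a, r_b)_x = q_a r_b`. -/
def jetDx (k : ℕ) : Derivation ℂ (JetRing k) (JetRing k) :=
  MvPolynomial.mkDerivation ℂ fun v =>
    match v with
    | .w n l => MvPolynomial.X (.w n (l + 1))
    | .q a l => MvPolynomial.X (.q a (l + 1))
    | .r b l => MvPolynomial.X (.r b (l + 1))
    | .Ω a b => MvPolynomial.X (.q a 0) * MvPolynomial.X (.r b 0)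
    | .τ l => MvPolynomial.X (.τ (l + 1))

/-- The generic data, with `D = 1 + w₁ ∂⁻¹ + w₂ ∂⁻² + ⋯`. -/
def jetData (k : ℕ) : Data (jetDx k) k where
  D :=
    { coeff := fun i =>
        if i = 0 then 1
        else if i < 0 then MvPolynomial.X (.w (i.natAbs - 1) 0)
        else 0
      bdd := ⟨0, fun i hi => by simp [ne_of_gt hi, not_lt.mpr hi.le]⟩ }
  q a := MvPolynomial.X (.q a 0)
  r b := MvPolynomial.X (.r b 0)
  Ω a b := MvPolynomial.X (.Ω a b)
  τ := MvPolynomial.X (.τ 0)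

/-- The squared eigenfunction flow `∂* = ∂*_{qᵢ, rᵢ}`: the derivation that commutes with `∂` and has
`∂* D = qᵢ ∂⁻¹ rᵢ D`, `∂* q_a = qᵢ Ω(q_a, rᵢ)`, `∂* r_b = rᵢ Ω(qᵢ, r_b)`,
`∂* Ω(q_a, r_b) = Ω(qᵢ, r_b) Ω(q_a, rᵢ)`, `∂* τ = -Ω(qᵢ, rᵢ) τ`. -/
def sesFlow (k : ℕ) (i : Fin k) : Derivation ℂ (JetRing k) (JetRing k) :=
  let U := jetData k
  MvPolynomial.mkDerivation ℂ fun v =>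
    match v with
    | .w n l => (jetDx k)^[l]
        ((PsiDO.fn (U.q (some i)) * PsiDO.dpow (-1) * PsiDO.fn (U.r (some i)) * U.D).coeff
          (-(n + 1 : ℤ)))
    | .q a l => (jetDx k)^[l] (U.q (some i) * U.Ω a (some i))
    | .r b l => (jetDx k)^[l] (U.r (some i) * U.Ω (some i) b)
    | .Ω a b => U.Ω (some i) b * U.Ω a (some i)
    | .τ l => (jetDx k)^[l] (-(U.Ω (some i) (some i) * U.τ))

namespace Data

variable {A : Type*} [CommRing A] [Algebra ℂ A] {δ : Derivation ℂ A A} {k : ℕ}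

/-- Evaluation of differential polynomials on the data `S`. -/
def eval (S : Data δ k) : JetRing k →ₐ[ℂ] A :=
  MvPolynomial.aeval fun v =>
    match v with
    | .w n l => δ^[l] (S.D.coeff (-(n + 1 : ℤ)))
    | .q a l => δ^[l] (S.q a)
    | .r b l => δ^[l] (S.r b)
    | .Ω a b => S.Ω a b
    | .τ l => δ^[l] S.τ

/-- The term `(∑ᵢ ∂*_{qᵢ, rᵢ})ᵐ N / m!` of the series of `e^{∑ᵢ ∂*_{qᵢ, rᵢ}} N`. -/
def expTerm (S : Data δ k) (N : Obs) (m : ℕ) : A :=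
  (m.factorial : ℂ)⁻¹ • S.eval ((∑ i : Fin k, sesFlow k i)^[m] ((jetData k).val N))

end Data

/-! ### Formal parameter -/

/-- A derivation of `A` acting on the coefficients of power series in a formal parameter `ε`. -/
def liftDer {A : Type*} [CommRing A] [Algebra ℂ A] (d : Derivation ℂ A A) :
    Derivation ℂ (PowerSeries A) (PowerSeries A) :=
  Derivation.mk'
    { toFun := fun f => PowerSeries.mk fun n => d (PowerSeries.coeff n f)
      map_add' := fun f g => by ext n; simp
      map_smul' := fun c f => by ext n; simp }
    (fun f g => by
      ext n
      simp only [LinearMap.coe_mk, AddHom.coe_mk, PowerSeries.coeff_mk, PowerSeries.coeff_mul,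
        map_sum, Derivation.leibniz, smul_eq_mul, map_add, Finset.sum_add_distrib]
      congr 1
      rw [← Finset.Nat.sum_antidiagonal_swap]
      simp)

/-- The data `S` with each `rᵢ` replaced by `ε rᵢ`, and accordingly `Ω(q_a, rᵢ)` by `ε Ω(q_a, rᵢ)`. -/
def Data.formal {A : Type*} [CommRing A] [Algebra ℂ A] {δ : Derivation ℂ A A} {k : ℕ}
    (S : Data δ k) : Data (liftDer δ) k where
  D :=
    { coeff := fun i => PowerSeries.C (S.D.coeff i)
      bdd := by
        obtain ⟨N, hN⟩ := S.D.bdd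
        exact ⟨N, fun i hi => by simp [hN i hi]⟩ }
  q a := PowerSeries.C (S.q a)
  r b :=
    match b with
    | none => PowerSeries.C (S.r none)
    | some i => PowerSeries.X * PowerSeries.C (S.r (some i))
  Ω a b :=
    match b with
    | none => PowerSeries.C (S.Ω a none)
    | some i => PowerSeries.X * PowerSeries.C (S.Ω a (some i))
  τ := PowerSeries.C S.τ

end KP

end

/-! A binary Darboux step for `(q, r)` with `Ω = Ω(q, r)` collapses to the gauge operator `G = 1 - q
Ω⁻¹ ∂⁻¹ r`: `D` becomes `G D`, `τ` becomes `-Ω τ`, and (adjoint) eigenfunctions and SEPs receive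
rank one corrections such as `f - q Ω⁻¹ Ω(f, r)`. The inverse of `q` cancels
(`binaryDarboux_eq_binaryGauge`), so only inverses of SEPs remain. Nearly every operator computation
rests on `∂⁻¹ a' ∂⁻¹ = a ∂⁻¹ - ∂⁻¹ a` with `Ω' = q r`; in particular it gives `G⁻¹ = 1 + q ∂⁻¹ Ω⁻¹
r`.

Such a step preserves the KP hierarchy (`IsSolution.binaryGauge`). The evolution equations of
eigenfunctions, adjoint eigenfunctions and SEPs are written as residues, in which `(Lⁿ)_{≥0}` may be
replaced by `Lⁿ`, and `Lⁿ` is conjugated by `G`. For the tau function, bilinear identities between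
`D` and `D⁻¹` give `Ω - Ω[z] = z q r[z]`, where `[z]` is the Miwa shift and `z = λ⁻¹`; this says
exactly that `-Ω τ` is a tau function of `G D` (`symb_gauge_mul`).

With the parameter, the SEP inverted at the `j`-th step is `ε Ω - 1` for an unshifted SEP `Ω`, hence
a unit of `A[[ε]]`. By induction on the number of steps, the result of the first `j` steps solves
the differential equation `dZ/dε = ∑_{i<j} ∂*_{qᵢ, rᵢ} Z` with initial value `S` (`IsFlow.flowStep`,
all but the tau equation and the `x`-derivative of the SEPs being one scalar computation,
`deriv_gauge_step`). The Taylor series of a solution in `ε` is the exponential series of the flow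
(`IsFlow.val_eq`).

Without the parameter there is no analytic argument. The objects of the chain are rational functions
of `ε` whose denominators are invertible at `ε = 1`, with values there given by the chain without
parameter (`val_mem_specialization`). If the coefficients of such a function `f = Q / P` have a
convergent sum `s`, multiplication by the polynomial `P` gives `P(1) s = Q(1)`, so `s` is the value
at `ε = 1` (`eq_of_mem_specialization`). -/

noncomputable section

namespace KP

namespace PsiDO

variable {A : Type*} [CommRing A] [Algebra ℂ A] {δ : Derivation ℂ A A}

/-! ### The ring of pseudo-differential operators -/

/-- `P` has order at most `N`. -/
def OrdLE (P : PsiDO δ) (N : ℤ) : Prop := ∀ i, N < i → P.coeff i = 0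

instance : Zero (PsiDO δ) := ⟨⟨fun _ => 0, 0, fun _ _ => rfl⟩⟩

instance : Add (PsiDO δ) where
  add P Q :=
    { coeff := fun i => P.coeff i + Q.coeff i
      bdd := by
        obtain ⟨N, hN⟩ := P.bdd
        obtain ⟨M, hM⟩ := Q.bdd
        exact ⟨max N M, fun i hi => by
          simp [hN i (lt_of_le_of_lt (le_max_left _ _) hi),
            hM i (lt_of_le_of_lt (le_max_right _ _) hi)]⟩ }

@[simp] theorem coeff_zero (i : ℤ) : (0 : PsiDO δ).coeff i = 0 := rfl
@[simp] theorem coeff_add (P Q : PsiDO δ) (i : ℤ) : (P + Q).coeff i = P.coeff i + Q.coeff i := rfl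
@[simp] theorem coeff_neg (P : PsiDO δ) (i : ℤ) : (-P).coeff i = -P.coeff i := rfl
@[simp] theorem coeff_sub (P Q : PsiDO δ) (i : ℤ) : (P - Q).coeff i = P.coeff i - Q.coeff i := rfl

theorem coeff_monomial (n : ℤ) (a : A) (i : ℤ) :
    (monomial n a : PsiDO δ).coeff i = if i = n then a else 0 := rfl
theorem coeff_fn (a : A) (i : ℤ) : (fn a : PsiDO δ).coeff i = if i = 0 then a else 0 := rfl
theorem coeff_dpow (n i : ℤ) : (dpow n : PsiDO δ).coeff i = if i = n then 1 else 0 := rfl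
theorem coeff_one (i : ℤ) : (1 : PsiDO δ).coeff i = if i = 0 then 1 else 0 := rfl

instance : AddCommGroup (PsiDO δ) where
  add_assoc P Q R := by ext i; simp [add_assoc]
  zero_add P := by ext i; simp
  add_zero P := by ext i; simp
  add_comm P Q := by ext i; simp [add_comm]
  neg_add_cancel P := by ext i; simp
  sub_eq_add_neg P Q := by ext i; simp [sub_eq_add_neg]
  nsmul := nsmulRec
  zsmul := zsmulRec

/-- The coefficient of `∂ⁱ` as an additive map. -/
def coeffHom (i : ℤ) : PsiDO δ →+ A where
  toFun P := P.coeff i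
  map_zero' := rfl
  map_add' _ _ := rfl

@[simp] theorem coeff_sum {ι : Type*} (s : Finset ι) (f : ι → PsiDO δ) (i : ℤ) :
    (∑ x ∈ s, f x).coeff i = ∑ x ∈ s, (f x).coeff i := map_sum (coeffHom i) f s

theorem exists_ordLE (P : PsiDO δ) : ∃ N, OrdLE P N := P.bdd

theorem OrdLE.mono {P : PsiDO δ} {N M : ℤ} (h : OrdLE P N) (hNM : N ≤ M) : OrdLE P M :=
  fun i hi => h i (by omega)

theorem OrdLE.add {P Q : PsiDO δ} {N : ℤ} (h : OrdLE P N) (h' : OrdLE Q N) : OrdLE (P + Q) N :=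
  fun i hi => by simp [h i hi, h' i hi]

theorem OrdLE.sub {P Q : PsiDO δ} {N : ℤ} (h : OrdLE P N) (h' : OrdLE Q N) : OrdLE (P - Q) N :=
  fun i hi => by simp [h i hi, h' i hi]

theorem ordLE_monomial (n : ℤ) (a : A) : OrdLE (monomial n a : PsiDO δ) n := fun i hi => by
  rw [coeff_monomial, if_neg hi.ne']

theorem ordLE_fn (a : A) : OrdLE (fn a : PsiDO δ) 0 := ordLE_monomial 0 a
theorem ordLE_dpow (n : ℤ) : OrdLE (dpow n : PsiDO δ) n := ordLE_monomial n 1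
theorem ordLE_one : OrdLE (1 : PsiDO δ) 0 := ordLE_monomial 0 1

/-- A property of operators that is additive, holds for monomials and for all operators of
sufficiently negative order, holds for all operators. -/
theorem induction_low {p : PsiDO δ → Prop} (K : ℤ) (low : ∀ P, OrdLE P K → p P)
    (add : ∀ P Q, p P → p Q → p (P + Q)) (mono : ∀ i a, p (monomial i a)) (P : PsiDO δ) : p P := by
  obtain ⟨N, hN⟩ := P.exists_ordLE
  obtain ⟨n, hn⟩ : ∃ n : ℕ, N ≤ K + n := ⟨(N - K).toNat, by omega⟩
  replace hN := hN.mono hn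
  clear hn
  induction n generalizing P with
  | zero => exact low P (by simpa using hN)
  | succ n ih =>
    have h := add _ _ (mono (K + (n + 1 : ℕ)) (P.coeff (K + (n + 1 : ℕ))))
      (ih (P - monomial (K + (n + 1 : ℕ)) (P.coeff (K + (n + 1 : ℕ)))) ?_)
    · rwa [add_sub_cancel] at h
    · intro i hi
      rw [coeff_sub, coeff_monomial]
      split_ifs with h
      · rw [h, sub_self]
      · rw [hN i (by push_cast at h ⊢; omega), sub_zero]

theorem coeff_mul (P Q : PsiDO δ) (m : ℤ) : (P * Q).coeff m = ∑ᶠ p : ℤ × ℕ,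
    Ring.choose p.1 p.2 • (P.coeff p.1 * δ^[p.2] (Q.coeff (m - p.1 + p.2))) := rfl

theorem OrdLE.mul {P Q : PsiDO δ} {N M : ℤ} (h : OrdLE P N) (h' : OrdLE Q M) :
    OrdLE (P * Q) (N + M) := fun m hm => by
  rw [coeff_mul]
  refine finsum_eq_zero_of_forall_eq_zero fun p => ?_
  by_cases hp : N < p.1
  · simp [h _ hp]
  · rw [h' (m - p.1 + p.2) (by have := p.2.cast_nonneg (α := ℤ); omega), iterate_map_zero]
    simp

theorem finite_support_mul (P Q : PsiDO δ) (m : ℤ) : (Function.support fun p : ℤ × ℕ =>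
    Ring.choose p.1 p.2 • (P.coeff p.1 * δ^[p.2] (Q.coeff (m - p.1 + p.2)))).Finite := by
  obtain ⟨N, hN⟩ := P.exists_ordLE
  obtain ⟨M, hM⟩ := Q.exists_ordLE
  refine ((Finset.Icc (m - M) N) ×ˢ (Finset.range (N + M - m + 1).toNat)).finite_toSet.subset ?_
  intro p hp
  have h1 : p.1 ≤ N := by
    by_contra h
    exact hp (by simp [hN _ (not_le.mp h)])
  have h2 : m - p.1 + p.2 ≤ M := by
    by_contra h
    exact hp (by simp [hM _ (not_le.mp h), iterate_map_zero])
  simp only [Finset.coe_product, Set.mem_prod, Finset.mem_coe, Finset.mem_Icc, Finset.mem_range]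
  omega

protected theorem add_mul (P Q R : PsiDO δ) : (P + Q) * R = P * R + Q * R := by
  ext m
  rw [coeff_add, coeff_mul, coeff_mul, coeff_mul,
    ← finsum_add_distrib (finite_support_mul P R m) (finite_support_mul Q R m)]
  simp only [coeff_add, add_mul, smul_add]

protected theorem mul_add (P Q R : PsiDO δ) : P * (Q + R) = P * Q + P * R := by
  ext m
  rw [coeff_add, coeff_mul, coeff_mul, coeff_mul,
    ← finsum_add_distrib (finite_support_mul P Q m) (finite_support_mul P R m)]
  simp only [coeff_add, iterate_map_add, mul_add, smul_add]

instance : NonUnitalNonAssocRing (PsiDO δ) where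
  left_distrib := PsiDO.mul_add
  right_distrib := PsiDO.add_mul
  zero_mul P := by
    have := PsiDO.add_mul 0 0 P
    rwa [add_zero, left_eq_add] at this
  mul_zero P := by
    have := PsiDO.mul_add P 0 0
    rwa [add_zero, left_eq_add] at this

theorem coeff_monomial_mul (i : ℤ) (a : A) {Q : PsiDO δ} {M : ℤ} (hQ : OrdLE Q M) (m : ℤ) (K : ℕ)
    (hK : M < m - i + K) : (monomial i a * Q).coeff m =
      ∑ l ∈ Finset.range K, Ring.choose i l • (a * δ^[l] (Q.coeff (m - i + l))) := by
  rw [coeff_mul, finsum_curry _ (finite_support_mul _ Q m), finsum_eq_single _ i]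
  · simp only [coeff_monomial, if_true]
    refine finsum_eq_finsetSum_of_support_subset _ fun l hl => ?_
    by_contra h
    simp only [Finset.coe_range, Set.mem_Iio, not_lt] at h
    exact hl (by simp only; rw [hQ _ (by omega), iterate_map_zero]; simp)
  · intro x hx
    simp [coeff_monomial, hx]

theorem coeff_dpow_mul (i : ℤ) {Q : PsiDO δ} {M : ℤ} (hQ : OrdLE Q M) (m : ℤ) (K : ℕ)
    (hK : M < m - i + K) : (dpow i * Q).coeff m =
      ∑ l ∈ Finset.range K, Ring.choose i l • δ^[l] (Q.coeff (m - i + l)) := by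
  rw [dpow, coeff_monomial_mul i 1 hQ m K hK]
  simp

@[simp] theorem coeff_fn_mul (a : A) (Q : PsiDO δ) (m : ℤ) :
    (fn a * Q).coeff m = a * Q.coeff m := by
  obtain ⟨M, hM⟩ := Q.exists_ordLE
  rw [fn, coeff_monomial_mul 0 a hM m ((M - m).toNat + 1) (by push_cast; omega),
    Finset.sum_range_succ']
  simp

theorem monomial_mul (i : ℤ) (a : A) (Q : PsiDO δ) : monomial i a * Q = fn a * (dpow i * Q) := by
  ext m
  obtain ⟨M, hM⟩ := Q.exists_ordLE
  have hK : M < m - i + ((M - m + i).toNat + 1 : ℕ) := by push_cast; omega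
  rw [coeff_fn_mul, coeff_monomial_mul i a hM m _ hK, coeff_dpow_mul i hM m _ hK, Finset.mul_sum]
  simp only [mul_smul_comm]

@[simp] theorem coeff_mul_dpow (P : PsiDO δ) (n m : ℤ) :
    (P * dpow n).coeff m = P.coeff (m - n) := by
  have h1 : ∀ l : ℕ, δ^[l + 1] (1 : A) = 0 := fun l => by
    rw [Function.iterate_succ_apply, Derivation.map_one_eq_zero, iterate_map_zero]
  refine induction_low (p := fun P => (P * dpow n).coeff m = P.coeff (m - n)) (m - n - 1) ?_ ?_ ?_ P
  · intro P hP
    rw [hP _ (by omega), hP.mul (ordLE_dpow n) _ (by omega)]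
  · intro P Q hP hQ
    rw [add_mul, coeff_add, hP, hQ, coeff_add]
  · intro i a
    rw [monomial_mul, coeff_fn_mul, coeff_dpow_mul i (ordLE_dpow n) m ((n - m + i).toNat + 1)
      (by push_cast; omega), Finset.sum_range_succ']
    rw [Finset.sum_eq_zero, coeff_monomial, coeff_dpow]
    · simp only [Nat.cast_zero, add_zero, zero_add, Function.iterate_zero, id,
        Ring.choose_zero_right, one_smul, mul_ite, mul_one, mul_zero]
      congr 1
      exact propext ⟨fun h => by omega, fun h => by omega⟩
    · intro l _
      rw [coeff_dpow]
      split_ifs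
      · rw [h1, smul_zero]
      · rw [iterate_map_zero, smul_zero]

theorem dpow_zero : (dpow 0 : PsiDO δ) = 1 := rfl
theorem fn_one : (fn 1 : PsiDO δ) = 1 := rfl

protected theorem one_mul (P : PsiDO δ) : 1 * P = P := by
  ext m
  rw [← fn_one, coeff_fn_mul, one_mul]

protected theorem mul_one (P : PsiDO δ) : P * 1 = P := by
  ext m
  rw [← dpow_zero, coeff_mul_dpow, sub_zero]

/-- `∂ (∂ⁱ Q) = ∂ⁱ⁺¹ Q`. -/
theorem dpow_one_mul_dpow_mul (i : ℤ) (Q : PsiDO δ) : dpow 1 * (dpow i * Q) = dpow (i + 1) * Q := by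
  ext m
  obtain ⟨M, hM⟩ := Q.exists_ordLE
  obtain ⟨K, hK⟩ : ∃ K : ℕ, M < m - i + K := ⟨(M - m + i).toNat + 1, by push_cast; omega⟩
  have hO := (ordLE_dpow i).mul hM
  rw [coeff_dpow_mul 1 hO m ((i + M - m + 1).toNat + 2) (by push_cast; omega),
    Finset.sum_range_succ', Finset.sum_range_succ', Finset.sum_eq_zero,
    coeff_dpow_mul (i + 1) hM m (K + 1) (by push_cast; omega), Finset.sum_range_succ']
  · have h1 : m - 1 + ((0 + 1 : ℕ) : ℤ) = m := by push_cast; ring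
    simp only [h1, Ring.choose_zero_right, one_smul, Function.iterate_zero, id, zero_add,
      Nat.cast_zero, add_zero, Ring.choose_one_right, Function.iterate_one]
    rw [coeff_dpow_mul i hM m K hK, coeff_dpow_mul i hM (m - 1) (K + 1) (by push_cast; omega),
      Finset.sum_range_succ', map_sum]
    -- Pascal's rule for `(i + 1 choose l + 1)` matches the two expansions. The one of the
    -- coefficient at `m - 1` was taken one term longer than the one at `m`, since differentiation
    -- raises the index `l` by one.
    simp only [Ring.choose_succ_succ, add_smul, Finset.sum_add_distrib]
    rw [← add_assoc]
    simp only [map_zsmul, ← Function.iterate_succ_apply', Ring.choose_zero_right, one_smul,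
      Function.iterate_zero, id, Nat.cast_zero, add_zero, Nat.cast_add, Nat.cast_one]
    have e : m - 1 - i = m - (i + 1) := by ring
    have e2 : ∀ x : ℕ, m - i + (x : ℤ) = m - (i + 1) + (x + 1) := fun x => by ring
    simp only [e, e2]
  · intro l _
    have : Ring.choose (1 : ℤ) (l + 1 + 1) = 0 := by
      rw [← Nat.cast_one, Ring.choose_natCast, Nat.choose_eq_zero_of_lt (by omega), Nat.cast_zero]
    rw [this, zero_smul]

@[simp] theorem coeff_dpow_one_mul (Q : PsiDO δ) (m : ℤ) :
    (dpow 1 * Q).coeff m = Q.coeff (m - 1) + δ (Q.coeff m) := by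
  obtain ⟨M, hM⟩ := Q.exists_ordLE
  rw [coeff_dpow_mul 1 hM m ((M - m + 1).toNat + 2) (by push_cast; omega),
    Finset.sum_range_succ', Finset.sum_range_succ', Finset.sum_eq_zero]
  · simp [add_comm]
  · intro l _
    have : Ring.choose (1 : ℤ) (l + 1 + 1) = 0 := by
      rw [← Nat.cast_one, Ring.choose_natCast, Nat.choose_eq_zero_of_lt (by omega), Nat.cast_zero]
    rw [this, zero_smul]

theorem dpow_one_mul_fn_mul (a : A) (Q : PsiDO δ) :
    dpow 1 * (fn a * Q) = fn a * (dpow 1 * Q) + fn (δ a) * Q := by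
  ext m
  simp
  ring

theorem dpow_mul_dpow_neg_one_mul (Q : PsiDO δ) : dpow 1 * (dpow (-1) * Q) = Q := by
  rw [dpow_one_mul_dpow_mul, neg_add_cancel, dpow_zero, PsiDO.one_mul]

/-- Left multiplication by `∂` is injective. -/
theorem dpow_one_mul_injective : Function.Injective (dpow 1 * · : PsiDO δ → PsiDO δ) := by
  intro P Q h
  simp only at h
  rw [← sub_eq_zero, ← mul_sub] at h
  rw [← sub_eq_zero]
  set R := P - Q
  obtain ⟨N, hN⟩ := R.exists_ordLE
  -- If `R` has order at most `N - n`, the coefficient of `∂ᴺ⁻ⁿ⁺¹` in `∂ R = 0` is the leading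
  -- coefficient of `R`, so the order drops indefinitely.
  have key : ∀ n : ℕ, OrdLE R (N - n) := by
    intro n
    induction n with
    | zero => simpa using hN
    | succ n ih =>
      intro i hi
      push_cast at hi
      have := coeff_dpow_one_mul R (i + 1)
      rw [h, ih (i + 1) (by omega), map_zero, add_zero, add_sub_cancel_right, coeff_zero] at this
      exact this.symm
  ext i
  exact key (N - i + 1).toNat i (by omega)

/-- Only the left factor has to be decomposed. For a function the claim is a statement on
coefficients, for `∂` it is the Leibniz rule, and for `∂⁻¹` it follows by multiplying with `∂`,
which is injective. Hence it holds for every `∂ⁿ` and every monomial, and a fixed coefficient of the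
products does not see the terms of `P` of very low order. -/
protected theorem mul_assoc (P Q R : PsiDO δ) : P * Q * R = P * (Q * R) := by
  have hf : ∀ (a : A) (P Q : PsiDO δ), fn a * P * Q = fn a * (P * Q) := by
    intro a P Q
    ext m
    obtain ⟨M, hM⟩ := Q.exists_ordLE
    rw [coeff_fn_mul]
    refine induction_low (p := fun P => (fn a * P * Q).coeff m = a * (P * Q).coeff m) (m - M - 1)
      ?_ ?_ ?_ P
    · intro P hP
      rw [hP.mul hM _ (by omega), ((ordLE_fn a).mul hP).mul hM _ (by omega), mul_zero]
    · intro P P' h h'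
      rw [mul_add, add_mul, add_mul, coeff_add, coeff_add, h, h', mul_add]
    · intro i b
      have : (fn a * monomial i b : PsiDO δ) = monomial i (a * b) := by
        ext n; simp [coeff_monomial]
      rw [this, monomial_mul, monomial_mul, coeff_fn_mul, coeff_fn_mul, mul_assoc]
  have hd : ∀ (P Q : PsiDO δ), dpow 1 * P * Q = dpow 1 * (P * Q) := by
    intro P Q
    ext m
    obtain ⟨M, hM⟩ := Q.exists_ordLE
    refine induction_low (p := fun P => (dpow 1 * P * Q).coeff m = (dpow 1 * (P * Q)).coeff m)
      (m - M - 2) ?_ ?_ ?_ P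
    · intro P hP
      rw [((ordLE_dpow 1).mul hP).mul hM _ (by omega), (ordLE_dpow 1).mul (hP.mul hM) _ (by omega)]
    · intro P P' h h'
      rw [mul_add, add_mul, add_mul, mul_add, coeff_add, coeff_add, h, h']
    · intro i b
      have : (dpow 1 * monomial i b : PsiDO δ) = monomial (i + 1) b + monomial i (δ b) := by
        ext n
        have : n - 1 = i ↔ n = i + 1 := by omega
        simp [coeff_monomial, this, apply_ite δ]
      rw [this, add_mul, monomial_mul, monomial_mul, monomial_mul, dpow_one_mul_fn_mul,
        dpow_one_mul_dpow_mul]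
  have hd' : ∀ (P Q : PsiDO δ), dpow (-1) * P * Q = dpow (-1) * (P * Q) := by
    intro P Q
    apply dpow_one_mul_injective
    simp only
    rw [← hd, dpow_mul_dpow_neg_one_mul, dpow_mul_dpow_neg_one_mul]
  have hn : ∀ (n : ℤ) (P Q : PsiDO δ), dpow n * P * Q = dpow n * (P * Q) := by
    intro n
    induction n with
    | zero => intro P Q; rw [dpow_zero, PsiDO.one_mul, PsiDO.one_mul]
    | succ n ih =>
      intro P Q
      rw [← dpow_one_mul_dpow_mul, ← dpow_one_mul_dpow_mul, hd, ih]
    | pred n ih =>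
      intro P Q
      apply dpow_one_mul_injective
      simp only
      rw [← hd, dpow_one_mul_dpow_mul, dpow_one_mul_dpow_mul, sub_add_cancel, ih]
  ext m
  obtain ⟨N, hN⟩ := Q.exists_ordLE
  obtain ⟨M, hM⟩ := R.exists_ordLE
  refine induction_low (p := fun P => (P * Q * R).coeff m = (P * (Q * R)).coeff m)
    (m - N - M - 1) ?_ ?_ ?_ P
  · intro P hP
    rw [(hP.mul hN).mul hM _ (by omega), hP.mul (hN.mul hM) _ (by omega)]
  · intro P P' h h'
    rw [add_mul, add_mul, add_mul, coeff_add, coeff_add, h, h']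
  · intro i b
    rw [monomial_mul, monomial_mul, hf, hn]

instance : Ring (PsiDO δ) where
  __ := (inferInstance : NonUnitalNonAssocRing (PsiDO δ))
  mul_assoc := PsiDO.mul_assoc
  one_mul := PsiDO.one_mul
  mul_one := PsiDO.mul_one
  zsmul := zsmulRec

theorem pow_eq (P : PsiDO δ) (n : ℕ) : P.pow n = P ^ n := by
  induction n with
  | zero => rw [pow_zero]; rfl
  | succ n ih => rw [pow_succ', ← ih]; rfl

theorem fn_mul_fn (a b : A) : (fn a * fn b : PsiDO δ) = fn (a * b) := by
  ext m; simp [coeff_fn]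

theorem fn_add (a b : A) : (fn (a + b) : PsiDO δ) = fn a + fn b := by
  ext m; simp only [coeff_fn, coeff_add]; split_ifs <;> simp

theorem fn_neg (a : A) : (fn (-a) : PsiDO δ) = -fn a := by
  ext m; simp only [coeff_fn, coeff_neg]; split_ifs <;> simp

theorem fn_sub (a b : A) : (fn (a - b) : PsiDO δ) = fn a - fn b := by
  ext m; simp only [coeff_fn, coeff_sub]; split_ifs <;> simp

theorem fn_zero : (fn 0 : PsiDO δ) = 0 := by
  ext m; simp [coeff_fn]

theorem dpow_mul_dpow (i j : ℤ) : (dpow i * dpow j : PsiDO δ) = dpow (i + j) := by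
  ext m
  rw [coeff_mul_dpow, coeff_dpow, coeff_dpow]
  congr 1
  exact propext ⟨fun h => by omega, fun h => by omega⟩

/-- `∂ a = a ∂ + a'`. -/
theorem dpow_one_mul_fn (a : A) : (dpow 1 * fn a : PsiDO δ) = fn a * dpow 1 + fn (δ a) := by
  simpa [PsiDO.mul_one] using dpow_one_mul_fn_mul (δ := δ) a 1

/-- `∂⁻¹ a' ∂⁻¹ = a ∂⁻¹ - ∂⁻¹ a`. -/
theorem dpow_neg_one_mul_fn_mul_dpow_neg_one (a : A) :
    (dpow (-1) * fn (δ a) * dpow (-1) : PsiDO δ) = fn a * dpow (-1) - dpow (-1) * fn a := by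
  have h : (fn (δ a) : PsiDO δ) = dpow 1 * fn a - fn a * dpow 1 := by
    rw [dpow_one_mul_fn]; abel
  have e1 : (dpow (-1) * dpow 1 : PsiDO δ) = 1 := by rw [dpow_mul_dpow]; rfl
  have e2 : (dpow 1 * dpow (-1) : PsiDO δ) = 1 := by rw [dpow_mul_dpow]; rfl
  rw [h, mul_sub, sub_mul, ← mul_assoc, e1, one_mul, mul_assoc, mul_assoc (fn a), e2, mul_one]

end PsiDO

end KP

end

noncomputable section

namespace KP

namespace PsiDO

variable {A : Type*} [CommRing A] [Algebra ℂ A] {δ : Derivation ℂ A A}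

/-! ### Residues, differential operators and adjoints -/

theorem res_add (P Q : PsiDO δ) : (P + Q).res = P.res + Q.res := rfl
theorem res_sub (P Q : PsiDO δ) : (P - Q).res = P.res - Q.res := rfl
theorem res_fn_mul (a : A) (P : PsiDO δ) : (fn a * P).res = a * P.res := coeff_fn_mul a P (-1)

theorem OrdLE.res_eq_zero {P : PsiDO δ} (h : OrdLE P (-2)) : P.res = 0 := h _ (by norm_num)

theorem coeff_dpow_mul_fn (i : ℤ) (a : A) (l : ℕ) :
    (dpow i * fn a : PsiDO δ).coeff (i - l) = Ring.choose i l • δ^[l] a := by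
  rw [coeff_dpow_mul i (ordLE_fn a) _ (l + 1) (by push_cast; omega), Finset.sum_range_succ,
    Finset.sum_eq_zero]
  · simp [coeff_fn]
  · intro x hx
    rw [Finset.mem_range] at hx
    rw [coeff_fn, if_neg (by omega), iterate_map_zero, smul_zero]

/-- Only the term of order `-1` contributes: for `i ≥ 0` the operator `∂ⁱ a` is differential, and
for `i < -1` its order is too small. -/
theorem res_mul_fn (P : PsiDO δ) (a : A) : (P * fn a).res = P.res * a := by
  refine induction_low (p := fun P => (P * fn a).res = P.res * a) (-2) ?_ ?_ ?_ P
  · intro P hP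
    rw [hP.res_eq_zero, OrdLE.res_eq_zero (by simpa using hP.mul (ordLE_fn a)), zero_mul]
  · intro P Q hP hQ
    rw [add_mul, res_add, hP, hQ, res_add, add_mul]
  · intro i b
    rw [monomial_mul, res_fn_mul, res, res, coeff_monomial]
    rcases lt_trichotomy i (-1) with h | h | h
    · rw [(ordLE_dpow i).mul (ordLE_fn a) _ (by omega), if_neg (by omega), mul_zero, zero_mul]
    · subst h
      simpa [Ring.choose_zero_right, -Ring.choose_zero_right'] using
        congrArg (b * ·) (coeff_dpow_mul_fn (δ := δ) (-1) a 0)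
    · obtain ⟨n, rfl⟩ := Int.eq_ofNat_of_zero_le (by omega : 0 ≤ i)
      have := coeff_dpow_mul_fn (δ := δ) n a (n + 1)
      rw [Ring.choose_natCast, Nat.choose_succ_self, Nat.cast_zero, zero_smul] at this
      rw [if_neg (by omega), zero_mul, show (-1 : ℤ) = n - (n + 1 : ℕ) by push_cast; ring, this,
        mul_zero]

theorem res_mul_dpow_neg_one (P : PsiDO δ) : (P * dpow (-1)).res = P.coeff 0 := by
  rw [res, coeff_mul_dpow]; rfl

theorem finite_support_apply (P : PsiDO δ) (f : A) :
    (Function.support fun i : ℕ => P.coeff i * δ^[i] f).Finite := by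
  obtain ⟨N, hN⟩ := P.exists_ordLE
  refine (Finset.range (N.toNat + 1)).finite_toSet.subset fun i hi => ?_
  by_contra h
  simp only [Finset.coe_range, Set.mem_Iio, not_lt] at h
  exact hi (by simp only; rw [hN _ (by omega), zero_mul])

/-- The constant term of `∂ⁿ f` is the `n`-th derivative of `f`, and terms of negative order have no
constant term. This leads to the residue form of the evolution equations. -/
theorem apply_eq_coeff (P : PsiDO δ) (f : A) : P.apply f = (P * fn f).coeff 0 := by
  refine induction_low (p := fun P => P.apply f = (P * fn f).coeff 0) (-1) ?_ ?_ ?_ P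
  · intro P hP
    rw [hP.mul (ordLE_fn f) _ (by norm_num), apply]
    exact finsum_eq_zero_of_forall_eq_zero fun i => by rw [hP _ (by omega), zero_mul]
  · intro P Q hP hQ
    rw [add_mul, coeff_add, ← hP, ← hQ]
    simp only [apply, coeff_add, add_mul]
    exact finsum_add_distrib (finite_support_apply P f) (finite_support_apply Q f)
  · intro i b
    rw [monomial_mul, coeff_fn_mul, apply]
    rcases lt_or_ge i 0 with h | h
    · rw [(ordLE_dpow i).mul (ordLE_fn f) _ (by omega), mul_zero]
      exact finsum_eq_zero_of_forall_eq_zero fun j => by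
        rw [coeff_monomial, if_neg (by omega), zero_mul]
    · obtain ⟨n, rfl⟩ := Int.eq_ofNat_of_zero_le h
      rw [finsum_eq_single _ n]
      · have := coeff_dpow_mul_fn (δ := δ) n f n
        rw [Ring.choose_natCast, Nat.choose_self, Nat.cast_one, one_smul, sub_self] at this
        rw [this, coeff_monomial, if_pos rfl]
      · intro x hx
        rw [coeff_monomial, if_neg (by exact_mod_cast hx), zero_mul]

/-- `P(f) = Res_∂ (P f ∂⁻¹)`. -/
theorem apply_eq_res (P : PsiDO δ) (f : A) : P.apply f = (P * fn f * dpow (-1)).res := by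
  rw [res_mul_dpow_neg_one, apply_eq_coeff]

theorem ordLE_sub_sum_monomial {P : PsiDO δ} {N : ℤ} (hP : OrdLE P N) (K : ℕ) :
    OrdLE (P - ∑ l ∈ Finset.range K, monomial (N - l) (P.coeff (N - l))) (N - K) := by
  induction K with
  | zero => simpa using hP
  | succ K ih =>
    intro i hi
    rw [Finset.sum_range_succ, ← sub_sub, coeff_sub, coeff_monomial]
    push_cast at hi
    split_ifs with h
    · rw [h, coeff_sub, coeff_sum, Finset.sum_eq_zero, sub_zero, sub_self]
      intro l hl
      rw [Finset.mem_range] at hl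
      rw [coeff_monomial, if_neg (by omega)]
    · rw [ih i (by omega), sub_zero]

/-- The residue of a product as a pairing of the left symbol of `P` with the residues of `∂ʲ W`. -/
theorem res_mul_eq_sum {P W : PsiDO δ} {N M : ℤ} (hP : OrdLE P N) (hW : OrdLE W M) (K : ℕ)
    (hK : N + M < K - 1) : (P * W).res =
      ∑ l ∈ Finset.range K, P.coeff (N - l) * (dpow (N - l) * W).res := by
  have h := (ordLE_sub_sum_monomial hP K).mul hW (-1) (by omega)
  rw [sub_mul, coeff_sub, sub_eq_zero] at h
  rw [res, h, Finset.sum_mul, coeff_sum]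
  simp only [monomial_mul, coeff_fn_mul]
  rfl

/-- The reflection `(-1-i choose l) = (-1)ˡ (i+l choose l)` converts the binomial coefficients of
the adjoint into those of the product `∂⁻¹⁻ⁱ W`. Adjoints can thereby be handled entirely through
residues. -/
theorem coeff_adj (W : PsiDO δ) (i : ℤ) :
    W.adj.coeff i = (((-1 : ℤˣ) ^ i : ℤˣ) : ℤ) • (dpow (-1 - i) * W).res := by
  obtain ⟨M, hM⟩ := W.exists_ordLE
  have hK : M < -1 - (-1 - i) + ((M - i).toNat + 1 : ℕ) := by push_cast; omega
  rw [res, coeff_dpow_mul _ hM _ _ hK, adj]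
  simp only
  rw [finsum_eq_finsetSum_of_support_subset (s := Finset.range ((M - i).toNat + 1)),
    Finset.smul_sum]
  · refine Finset.sum_congr rfl fun l _ => ?_
    have e1 : (-1 - i : ℤ) = -(i + 1) := by ring
    have e2 : (i + 1 + l - 1 : ℤ) = i + l := by ring
    rw [e1, Ring.choose_neg, e2, smul_assoc, zpow_add, Units.val_mul, mul_smul]
    congr 1
    have e3 : -1 - -(i + 1) + (l : ℤ) = i + l := by ring
    rw [e3]
    rfl
  · intro l hl
    by_contra h
    simp only [Finset.coe_range, Set.mem_Iio, not_lt] at h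
    exact hl (by simp only; rw [hM _ (by omega), iterate_map_zero]; simp)

/-- `P*(r) = Res_∂ (∂⁻¹ r P)`. -/
theorem adj_apply_eq_res (P : PsiDO δ) (r : A) :
    P.adj.apply r = (dpow (-1) * fn r * P).res := by
  obtain ⟨M, hM⟩ := P.exists_ordLE
  have h0 : OrdLE (dpow (-1) * fn r : PsiDO δ) (-1) := by
    simpa using (ordLE_dpow (-1)).mul (ordLE_fn r)
  rw [res_mul_eq_sum h0 hM (M.toNat + 1) (by push_cast; omega), apply,
    finsum_eq_finsetSum_of_support_subset (s := Finset.range (M.toNat + 1))]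
  · refine Finset.sum_congr rfl fun l _ => ?_
    -- Since `(-1 choose l) = (-1)ˡ`, the expansion of `∂⁻¹ r` carries the same signs as
    -- `coeff_adj`.
    have e : Ring.choose (-1 : ℤ) l = (((-1 : ℤˣ) ^ (l : ℤ) : ℤˣ) : ℤ) := by
      rw [Ring.choose_neg, add_sub_cancel_left, Ring.choose_natCast, Nat.choose_self]
      simp [Int.negOnePow, Units.smul_def]
    rw [coeff_dpow_mul_fn, coeff_adj, e, smul_mul_assoc, smul_mul_assoc, mul_comm]
  · intro l hl
    by_contra h
    simp only [Finset.coe_range, Set.mem_Iio, not_lt] at h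
    refine hl ?_
    simp only
    rw [coeff_adj, res, (ordLE_dpow _).mul hM _ (by omega), smul_zero, zero_mul]

/-- `P` is a differential operator. -/
def IsDiff (P : PsiDO δ) : Prop := ∀ i < 0, P.coeff i = 0

theorem IsDiff.add {P Q : PsiDO δ} (h : IsDiff P) (h' : IsDiff Q) : IsDiff (P + Q) :=
  fun i hi => by simp [h i hi, h' i hi]

theorem IsDiff.sub {P Q : PsiDO δ} (h : IsDiff P) (h' : IsDiff Q) : IsDiff (P - Q) :=
  fun i hi => by simp [h i hi, h' i hi]

theorem IsDiff.neg {P : PsiDO δ} (h : IsDiff P) : IsDiff (-P) := fun i hi => by simp [h i hi]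

theorem IsDiff.sum {ι : Type*} {s : Finset ι} {f : ι → PsiDO δ} (h : ∀ x ∈ s, IsDiff (f x)) :
    IsDiff (∑ x ∈ s, f x) := fun i hi => by
  rw [coeff_sum]
  exact Finset.sum_eq_zero fun x hx => h x hx i hi

theorem isDiff_fn (a : A) : IsDiff (fn a : PsiDO δ) := fun i hi => by
  rw [coeff_fn, if_neg hi.ne]

theorem isDiff_one : IsDiff (1 : PsiDO δ) := isDiff_fn 1

theorem isDiff_zero : IsDiff (0 : PsiDO δ) := fun _ _ => rfl

theorem IsDiff.res_eq_zero {P : PsiDO δ} (h : IsDiff P) : P.res = 0 := h _ (by norm_num)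

theorem IsDiff.dpow_one_mul {P : PsiDO δ} (h : IsDiff P) : IsDiff (dpow 1 * P) := fun i hi => by
  rw [coeff_dpow_one_mul, h _ hi, h _ (by omega), map_zero, add_zero]

theorem IsDiff.fn_mul {P : PsiDO δ} (h : IsDiff P) (a : A) : IsDiff (fn a * P) := fun i hi => by
  rw [coeff_fn_mul, h _ hi, mul_zero]

theorem IsDiff.eq_sum {P : PsiDO δ} (h : IsDiff P) :
    ∃ n : ℕ, P = ∑ l ∈ Finset.range n, fn (P.coeff l) * dpow l := by
  obtain ⟨N, hN⟩ := P.exists_ordLE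
  refine ⟨N.toNat + 1, ?_⟩
  ext i
  rw [coeff_sum]
  simp only [coeff_fn_mul, coeff_dpow]
  by_cases hi : 0 ≤ i ∧ i ≤ N
  · obtain ⟨j, rfl⟩ := Int.eq_ofNat_of_zero_le hi.1
    rw [Finset.sum_eq_single_of_mem j (Finset.mem_range.mpr (by omega))]
    · simp
    · intro l _ hl
      rw [if_neg (by exact_mod_cast hl.symm), mul_zero]
  · rw [Finset.sum_eq_zero]
    · rcases not_and_or.mp hi with h' | h'
      · exact h _ (not_le.mp h')
      · exact hN _ (not_le.mp h')
    · intro l _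
      split_ifs with h'
      · rw [mul_one, ← h']
        exact hN _ (by omega)
      · rw [mul_zero]

theorem IsDiff.mul {P Q : PsiDO δ} (hP : IsDiff P) (hQ : IsDiff Q) : IsDiff (P * Q) := by
  obtain ⟨n, hn⟩ := hP.eq_sum
  rw [hn, Finset.sum_mul]
  refine IsDiff.sum fun l _ => ?_
  rw [mul_assoc]
  refine IsDiff.fn_mul ?_ _
  clear * - hQ
  induction l with
  | zero => rwa [Nat.cast_zero, dpow_zero, one_mul]
  | succ l ih =>
    rw [Nat.cast_succ, ← dpow_one_mul_dpow_mul]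
    exact ih.dpow_one_mul

theorem coeff_nonnegPart (P : PsiDO δ) (i : ℤ) :
    P.nonnegPart.coeff i = if 0 ≤ i then P.coeff i else 0 := rfl
theorem coeff_negPart (P : PsiDO δ) (i : ℤ) :
    P.negPart.coeff i = if i < 0 then P.coeff i else 0 := rfl

theorem isDiff_nonnegPart (P : PsiDO δ) : IsDiff P.nonnegPart := fun i hi => by
  rw [coeff_nonnegPart, if_neg (not_le.mpr hi)]

theorem ordLE_negPart (P : PsiDO δ) : OrdLE P.negPart (-1) := fun i hi => by
  rw [coeff_negPart, if_neg (by omega)]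

theorem nonnegPart_add_negPart (P : PsiDO δ) : P.nonnegPart + P.negPart = P := by
  ext i
  rw [coeff_add, coeff_nonnegPart, coeff_negPart]
  by_cases h : 0 ≤ i
  · simp [h, not_lt.mpr h]
  · simp [h, not_le.mp h]

theorem negPart_eq {P Q R : PsiDO δ} (hP : P = Q + R) (hQ : IsDiff Q) (hR : OrdLE R (-1)) :
    P.negPart = R := by
  ext i
  rw [coeff_negPart, hP]
  split_ifs with h
  · rw [coeff_add, hQ i h, zero_add]
  · rw [hR i (by omega)]

/-- For a differential operator `P`, the difference `P ∂⁻¹ - Res(P ∂⁻¹) ∂⁻¹` is differential. -/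
theorem IsDiff.mul_dpow_neg_one {P : PsiDO δ} (h : IsDiff P) :
    IsDiff (P * dpow (-1) - fn (P * dpow (-1)).res * dpow (-1)) := fun i hi => by
  rw [coeff_sub, coeff_fn_mul, coeff_mul_dpow, coeff_dpow, res, coeff_mul_dpow]
  split_ifs with h'
  · rw [h', mul_one, sub_self]
  · rw [h _ (by omega), mul_zero, sub_zero]

/-- For a differential operator `P`, the difference `∂⁻¹ P - ∂⁻¹ Res(∂⁻¹ P)` is differential. -/
theorem IsDiff.dpow_neg_one_mul {P : PsiDO δ} (h : IsDiff P) :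
    IsDiff (dpow (-1) * P - dpow (-1) * fn (dpow (-1) * P).res) := by
  set c := (dpow (-1) * P).res with hc
  set E := dpow (-1) * P - dpow (-1) * fn c with hE
  have h1 : dpow 1 * E = P - fn c := by
    rw [hE, mul_sub, dpow_mul_dpow_neg_one_mul, dpow_mul_dpow_neg_one_mul]
  have hres : E.res = 0 := by
    rw [hE, res_sub, res_mul_fn, ← hc, res, coeff_dpow, if_pos rfl, one_mul, sub_self]
  -- As `∂ E = P - c` is differential, each negative coefficient of `E` determines the next lower
  -- one as minus its derivative. The coefficient of `∂⁻¹` vanishes by the choice of `c`, hence so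
  -- do all below it.
  have h2 : ∀ i < 0, E.coeff (i - 1) + δ (E.coeff i) = 0 := fun i hi => by
    rw [← coeff_dpow_one_mul, h1]
    exact h.sub (isDiff_fn c) i hi
  have h3 : ∀ n : ℕ, E.coeff (-1 - n) = 0 := by
    intro n
    induction n with
    | zero => simpa [res] using hres
    | succ n ih =>
      have := h2 (-1 - n) (by omega)
      rw [ih, map_zero, add_zero] at this
      rw [← this]
      congr 1
      push_cast
      ring
  intro i hi
  have := h3 (-1 - i).toNat
  rwa [show -1 - ((-1 - i).toNat : ℤ) = i by omega] at this

/-! ### Derivations, inverses, and change of coefficients -/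

theorem coeff_derivCoeff (t : Derivation ℂ A A) (P : PsiDO δ) (i : ℤ) :
    (P.derivCoeff t).coeff i = t (P.coeff i) := rfl

theorem derivCoeff_mul {t : Derivation ℂ A A} (ht : ∀ f, t (δ f) = δ (t f)) (P Q : PsiDO δ) :
    (P * Q).derivCoeff t = P.derivCoeff t * Q + P * Q.derivCoeff t := by
  ext m
  rw [coeff_derivCoeff, coeff_add, coeff_mul, coeff_mul, coeff_mul,
    ← finsum_add_distrib (finite_support_mul _ _ _) (finite_support_mul _ _ _)]
  have h := AddMonoidHom.map_finsum (t : A →ₗ[ℂ] A).toAddMonoidHom (finite_support_mul P Q m)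
  refine h.trans (finsum_congr fun p => ?_)
  have hc : t (δ^[p.2] (Q.coeff (m - p.1 + p.2))) = δ^[p.2] (t (Q.coeff (m - p.1 + p.2))) :=
    Function.Commute.iterate_right (fun f => ht f) p.2 _
  simp only [LinearMap.toAddMonoidHom_coe, Derivation.coeFn_coe, map_zsmul, Derivation.leibniz,
    smul_eq_mul, coeff_derivCoeff, hc]
  rw [← smul_add, add_comm, mul_comm (t _)]

theorem derivCoeff_sub (t : Derivation ℂ A A) (P Q : PsiDO δ) :
    (P - Q).derivCoeff t = P.derivCoeff t - Q.derivCoeff t := by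
  ext; simp [coeff_derivCoeff]

theorem derivCoeff_fn (t : Derivation ℂ A A) (a : A) :
    (fn a : PsiDO δ).derivCoeff t = fn (t a) := by
  ext; simp only [coeff_derivCoeff, coeff_fn]; split_ifs <;> simp

theorem derivCoeff_dpow (t : Derivation ℂ A A) (n : ℤ) :
    (dpow n : PsiDO δ).derivCoeff t = 0 := by
  ext; simp only [coeff_derivCoeff, coeff_dpow]; split_ifs <;> simp

theorem derivCoeff_one (t : Derivation ℂ A A) : (1 : PsiDO δ).derivCoeff t = 0 :=
  derivCoeff_dpow t 0

theorem IsDiff.derivCoeff {P : PsiDO δ} (h : IsDiff P) (t : Derivation ℂ A A) :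
    IsDiff (P.derivCoeff t) := fun i hi => by rw [coeff_derivCoeff, h i hi, map_zero]

theorem res_derivCoeff (t : Derivation ℂ A A) (P : PsiDO δ) : (P.derivCoeff t).res = t P.res := rfl

/-- `P = 1 + (terms of negative order)`. -/
def IsMonic (P : PsiDO δ) : Prop := OrdLE (1 - P) (-1)

theorem isMonic_iff {P : PsiDO δ} :
    IsMonic P ↔ P.coeff 0 = 1 ∧ ∀ i, 0 < i → P.coeff i = 0 := by
  constructor
  · refine fun h => ⟨?_, fun i hi => ?_⟩
    · have := h 0 (by norm_num)
      rw [coeff_sub, coeff_one, if_pos rfl, sub_eq_zero] at this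
      exact this.symm
    · simpa [coeff_one, hi.ne'] using h i (by omega)
  · rintro ⟨h0, h⟩ i hi
    rcases (show 0 ≤ i by omega).eq_or_lt with rfl | hi'
    · simp [h0, coeff_one]
    · simp [h i hi', coeff_one, hi'.ne']

theorem IsMonic.ordLE {P : PsiDO δ} (h : IsMonic P) : OrdLE P 0 := (isMonic_iff.mp h).2

theorem IsMonic.ordLE_one_sub_pow {P : PsiDO δ} (h : IsMonic P) (m : ℕ) :
    OrdLE ((1 - P) ^ m) (-m) := by
  induction m with
  | zero => simpa using ordLE_one
  | succ m ih =>
    rw [pow_succ]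
    exact (ih.mul h).mono (by push_cast; omega)

/-- The Neumann series in `inv` is cut at a place depending on the coefficient. Since `(1 - P)ᵐ` has
order at most `-m`, the cut is immaterial, and a uniform cut at `K` is correct down to order `-K`;
this gives access to the geometric sum identity. -/
theorem IsMonic.ordLE_inv_sub_sum {P : PsiDO δ} (h : IsMonic P) (K : ℕ) :
    OrdLE (P.inv - ∑ m ∈ Finset.range K, (1 - P) ^ m) (-K) := by
  intro n hn
  rw [coeff_sub, coeff_sum, inv]
  simp only [pow_eq]
  split_ifs with h0
  · rcases le_total K (n.natAbs + 1) with hK | hK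
    · obtain ⟨j, hj⟩ := Nat.exists_eq_add_of_le hK
      rw [hj, Finset.sum_range_add, add_sub_cancel_left]
      exact Finset.sum_eq_zero fun m _ => h.ordLE_one_sub_pow _ _ (by omega)
    · obtain ⟨j, hj⟩ := Nat.exists_eq_add_of_le hK
      rw [hj, Finset.sum_range_add _ (n.natAbs + 1), sub_add_cancel_left, neg_eq_zero]
      exact Finset.sum_eq_zero fun m _ => h.ordLE_one_sub_pow _ _ (by omega)
  · rw [Finset.sum_eq_zero, sub_zero]
    exact fun m _ => h.ordLE_one_sub_pow m n (by omega)

theorem eq_of_forall_ordLE {P Q : PsiDO δ} (h : ∀ K : ℕ, OrdLE (P - Q) (-K)) : P = Q := by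
  ext i
  have := h (i.natAbs + 1) i (by omega)
  rwa [coeff_sub, sub_eq_zero] at this

theorem IsMonic.mul_inv {P : PsiDO δ} (h : IsMonic P) : P * P.inv = 1 := by
  refine eq_of_forall_ordLE fun K => ?_
  have h1 := h.ordLE.mul (h.ordLE_inv_sub_sum K)
  have h2 : P * ∑ m ∈ Finset.range K, (1 - P) ^ m = 1 - (1 - P) ^ K := by
    simpa using mul_neg_geom_sum (1 - P) K
  rw [mul_sub, h2, zero_add] at h1
  have := h1.sub (h.ordLE_one_sub_pow K)
  rwa [show P * P.inv - (1 - (1 - P) ^ K) - (1 - P) ^ K = P * P.inv - 1 by abel] at this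

theorem IsMonic.inv_mul {P : PsiDO δ} (h : IsMonic P) : P.inv * P = 1 := by
  refine eq_of_forall_ordLE fun K => ?_
  have h1 := (h.ordLE_inv_sub_sum K).mul h.ordLE
  have h2 : (∑ m ∈ Finset.range K, (1 - P) ^ m) * P = 1 - (1 - P) ^ K := by
    simpa using geom_sum_mul_neg (1 - P) K
  rw [sub_mul, h2, add_zero] at h1
  have := h1.sub (h.ordLE_one_sub_pow K)
  rwa [show P.inv * P - (1 - (1 - P) ^ K) - (1 - P) ^ K = P.inv * P - 1 by abel] at this

theorem ordLE_inv (P : PsiDO δ) : OrdLE P.inv 0 := by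
  intro i hi
  rw [inv]
  simp [not_le.mpr hi]

theorem IsMonic.inv_eq {P Q : PsiDO δ} (h : IsMonic P) (hQ : P * Q = 1) : P.inv = Q :=
  left_inv_eq_right_inv h.inv_mul hQ

theorem IsMonic.derivCoeff_inv {P : PsiDO δ} (h : IsMonic P) {t : Derivation ℂ A A}
    (ht : ∀ f, t (δ f) = δ (t f)) :
    P.inv.derivCoeff t = -(P.inv * P.derivCoeff t * P.inv) := by
  have h1 := congrArg (PsiDO.derivCoeff t) h.mul_inv
  rw [derivCoeff_mul ht, derivCoeff_one] at h1
  have h2 := congrArg (P.inv * ·) h1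
  simp only [mul_add, ← mul_assoc, h.inv_mul, one_mul, mul_zero] at h2
  rw [eq_neg_iff_add_eq_zero, add_comm, h2]

/-! ### Functoriality of pseudo-differential operators in the coefficient ring -/

section map

variable {A' : Type*} [CommRing A'] [Algebra ℂ A'] {δ' : Derivation ℂ A' A'}

/-- The operator with coefficients `φ aᵢ`. -/
def map (φ : A →+* A') (P : PsiDO δ) : PsiDO δ' where
  coeff i := φ (P.coeff i)
  bdd := by
    obtain ⟨N, hN⟩ := P.bdd
    exact ⟨N, fun i hi => by simp [hN i hi]⟩

variable {φ : A →+* A'}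

theorem coeff_map (P : PsiDO δ) (i : ℤ) : (P.map φ : PsiDO δ').coeff i = φ (P.coeff i) := rfl

theorem map_iterate (hφ : ∀ a, φ (δ a) = δ' (φ a)) (l : ℕ) (a : A) :
    φ (δ^[l] a) = δ'^[l] (φ a) :=
  Function.Semiconj.iterate_right (fun a => hφ a) l a

theorem map_mul (hφ : ∀ a, φ (δ a) = δ' (φ a)) (P Q : PsiDO δ) :
    (P * Q).map φ = (P.map φ * Q.map φ : PsiDO δ') := by
  ext m
  rw [coeff_map, coeff_mul, coeff_mul]
  refine (AddMonoidHom.map_finsum φ.toAddMonoidHom (finite_support_mul P Q m)).trans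
    (finsum_congr fun p => ?_)
  simp only [RingHom.toAddMonoidHom_eq_coe, AddMonoidHom.coe_coe, map_zsmul, _root_.map_mul,
    coeff_map, map_iterate hφ]

theorem map_sub (P Q : PsiDO δ) : (P - Q).map φ = (P.map φ - Q.map φ : PsiDO δ') := by
  ext; simp [coeff_map]
theorem map_neg (P : PsiDO δ) : (-P).map φ = (-P.map φ : PsiDO δ') := by
  ext; simp [coeff_map]
theorem map_fn (a : A) : (fn a : PsiDO δ).map φ = (fn (φ a) : PsiDO δ') := by
  ext; simp [coeff_map, coeff_fn, apply_ite φ]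
theorem map_dpow (n : ℤ) : (dpow n : PsiDO δ).map φ = (dpow n : PsiDO δ') := by
  ext; simp [coeff_map, coeff_dpow, apply_ite φ]
theorem map_one : (1 : PsiDO δ).map φ = (1 : PsiDO δ') := map_dpow 0

theorem map_pow (hφ : ∀ a, φ (δ a) = δ' (φ a)) (P : PsiDO δ) (n : ℕ) :
    (P ^ n).map φ = ((P.map φ) ^ n : PsiDO δ') := by
  induction n with
  | zero => rw [pow_zero, pow_zero, map_one]
  | succ n ih => rw [pow_succ, pow_succ, map_mul hφ, ih]

theorem map_res (P : PsiDO δ) : (P.map φ : PsiDO δ').res = φ P.res := rfl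

theorem map_nonnegPart (P : PsiDO δ) :
    P.nonnegPart.map φ = ((P.map φ).nonnegPart : PsiDO δ') := by
  ext; simp [coeff_map, coeff_nonnegPart, apply_ite φ]

theorem map_negPart (P : PsiDO δ) : P.negPart.map φ = ((P.map φ).negPart : PsiDO δ') := by
  ext; simp [coeff_map, coeff_negPart, apply_ite φ]

theorem map_inv (hφ : ∀ a, φ (δ a) = δ' (φ a)) (P : PsiDO δ) :
    P.inv.map φ = ((P.map φ).inv : PsiDO δ') := by
  ext n
  simp only [coeff_map, inv, pow_eq, apply_ite φ, _root_.map_zero, map_sum]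
  simp only [← coeff_map (δ' := δ'), map_pow hφ, map_sub, map_one]

theorem map_adj (hφ : ∀ a, φ (δ a) = δ' (φ a)) (P : PsiDO δ) :
    P.adj.map φ = ((P.map φ).adj : PsiDO δ') := by
  ext n
  rw [coeff_map, coeff_adj, coeff_adj, map_zsmul, ← map_res (δ' := δ'), map_mul hφ, map_dpow]

theorem map_apply (hφ : ∀ a, φ (δ a) = δ' (φ a)) (P : PsiDO δ) (f : A) :
    φ (P.apply f) = (P.map φ : PsiDO δ').apply (φ f) := by
  rw [apply_eq_coeff, apply_eq_coeff, ← map_fn (δ := δ), ← map_mul hφ, coeff_map]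

theorem IsMonic.map {P : PsiDO δ} (h : IsMonic P) : IsMonic (P.map φ : PsiDO δ') := by
  rw [isMonic_iff] at h ⊢
  exact ⟨by rw [coeff_map, h.1, _root_.map_one], fun i hi => by
    rw [coeff_map, h.2 i hi, _root_.map_zero]⟩

end map

end PsiDO

end KP

end

noncomputable section

namespace KP

namespace PsiDO

variable {A : Type*} [CommRing A] [Algebra ℂ A] {δ : Derivation ℂ A A}

/-! ### The gauge operator of a binary Darboux transformation -/

/-- The operator `1 - q ω ∂⁻¹ r`, where `ω` is meant to be `Ω(q, r)⁻¹`. -/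
def gauge (q r ω : A) : PsiDO δ := 1 - fn (q * ω) * dpow (-1) * fn r

/-- The operator `1 + q ∂⁻¹ ω r`, the inverse of `gauge q r ω`. -/
def gaugeInv (q r ω : A) : PsiDO δ := 1 + fn q * dpow (-1) * fn (ω * r)

theorem deriv_inverse {Ω ω : A} (hω : Ω * ω = 1) (t : Derivation ℂ A A) :
    t ω = -(ω * ω * t Ω) := by
  have h := congrArg t hω
  rw [Derivation.leibniz, Derivation.map_one_eq_zero, smul_eq_mul, smul_eq_mul] at h
  linear_combination ω * h - t ω * hω

variable {q r Ω ω : A} (hω : Ω * ω = 1) (hΩ : δ Ω = q * r)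
include hω hΩ

/-- In the product, the quadratic term contains `∂⁻¹ r q ∂⁻¹ = ∂⁻¹ Ω' ∂⁻¹ = Ω ∂⁻¹ - ∂⁻¹ Ω`, and so
it cancels the two linear terms. -/
theorem gauge_mul_gaugeInv : (gauge q r ω * gaugeInv q r ω : PsiDO δ) = 1 := by
  have h := dpow_neg_one_mul_fn_mul_dpow_neg_one (δ := δ) Ω
  have e1 : (fn r * fn q : PsiDO δ) = fn (δ Ω) := by rw [fn_mul_fn, hΩ, mul_comm]
  have e2 : (fn (q * ω) * fn Ω : PsiDO δ) = fn q := by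
    rw [fn_mul_fn]; congr 1; linear_combination q * hω
  have e3 : (fn Ω * fn (ω * r) : PsiDO δ) = fn r := by
    rw [fn_mul_fn]; congr 1; linear_combination r * hω
  calc (gauge q r ω * gaugeInv q r ω : PsiDO δ)
      = 1 - fn (q * ω) * dpow (-1) * fn r + fn q * dpow (-1) * fn (ω * r)
        - fn (q * ω) * (dpow (-1) * (fn r * fn q) * dpow (-1)) * fn (ω * r) := by
        rw [gauge, gaugeInv]; noncomm_ring
    _ = 1 - fn (q * ω) * dpow (-1) * fn r + fn q * dpow (-1) * fn (ω * r)
        - (fn (q * ω) * fn Ω * dpow (-1) * fn (ω * r)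
          - fn (q * ω) * dpow (-1) * (fn Ω * fn (ω * r))) := by
        rw [e1, h]; noncomm_ring
    _ = 1 := by rw [e2, e3]; abel

/-- The same cancellation in the other order, now with `ω r q ω = -ω'`. -/
theorem gaugeInv_mul_gauge : (gaugeInv q r ω * gauge q r ω : PsiDO δ) = 1 := by
  have h := dpow_neg_one_mul_fn_mul_dpow_neg_one (δ := δ) ω
  have e1 : (fn (ω * r) * fn (q * ω) : PsiDO δ) = -fn (δ ω) := by
    rw [fn_mul_fn, ← fn_neg, deriv_inverse hω, hΩ]; congr 1; ring
  calc (gaugeInv q r ω * gauge q r ω : PsiDO δ)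
      = 1 - fn (q * ω) * dpow (-1) * fn r + fn q * dpow (-1) * fn (ω * r)
        - fn q * (dpow (-1) * (fn (ω * r) * fn (q * ω)) * dpow (-1)) * fn r := by
        rw [gauge, gaugeInv]; noncomm_ring
    _ = 1 - fn (q * ω) * dpow (-1) * fn r + fn q * dpow (-1) * fn (ω * r)
        + fn q * (dpow (-1) * fn (δ ω) * dpow (-1)) * fn r := by
        rw [e1]; noncomm_ring
    _ = 1 := by
        rw [h, ← fn_mul_fn q ω, ← fn_mul_fn ω r]; noncomm_ring

/-- `∂⁻¹ g' (1 - q ω ∂⁻¹ r) = ∂⁻¹ g - Ω(q, g) ω ∂⁻¹ r` for `g' = g - r ω Ω(q, g)`. -/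
theorem dpow_neg_one_mul_fn_mul_gauge {g w : A} (hw : δ w = q * g) :
    (dpow (-1) * fn (g - r * ω * w) * gauge q r ω : PsiDO δ) =
      dpow (-1) * fn g - fn (w * ω) * dpow (-1) * fn r := by
  have h := dpow_neg_one_mul_fn_mul_dpow_neg_one (δ := δ) (w * ω)
  have e1 : (fn (g - r * ω * w) * fn (q * ω) : PsiDO δ) = fn (δ (w * ω)) := by
    rw [fn_mul_fn, Derivation.leibniz, deriv_inverse hω, hΩ, hw, smul_eq_mul, smul_eq_mul]
    congr 1; ring
  have e2 : (fn g : PsiDO δ) = fn (g - r * ω * w) + fn (w * ω) * fn r := by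
    rw [fn_mul_fn, ← fn_add]; congr 1; ring
  calc (dpow (-1) * fn (g - r * ω * w) * gauge q r ω : PsiDO δ)
      = dpow (-1) * fn (g - r * ω * w)
        - dpow (-1) * (fn (g - r * ω * w) * fn (q * ω)) * dpow (-1) * fn r := by
        rw [gauge]; noncomm_ring
    _ = dpow (-1) * (fn (g - r * ω * w) + fn (w * ω) * fn r)
        - fn (w * ω) * dpow (-1) * fn r := by rw [e1, h]; noncomm_ring
    _ = _ := by rw [← e2]

/-- `(1 - q ω ∂⁻¹ r)⁻¹ f' ∂⁻¹ = f ∂⁻¹ - q ∂⁻¹ ω Ω(f, r)` for `f' = f - q ω Ω(f, r)`. -/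
theorem gaugeInv_mul_fn_mul_dpow_neg_one {f w : A} (hw : δ w = f * r) :
    (gaugeInv q r ω * fn (f - q * ω * w) * dpow (-1) : PsiDO δ) =
      fn f * dpow (-1) - fn q * dpow (-1) * fn (w * ω) := by
  have h := dpow_neg_one_mul_fn_mul_dpow_neg_one (δ := δ) (w * ω)
  have e1 : (fn (ω * r) * fn (f - q * ω * w) : PsiDO δ) = fn (δ (w * ω)) := by
    rw [fn_mul_fn, Derivation.leibniz, deriv_inverse hω, hΩ, hw, smul_eq_mul, smul_eq_mul]
    congr 1; ring
  have e2 : (fn f : PsiDO δ) = fn (f - q * ω * w) + fn q * fn (w * ω) := by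
    rw [fn_mul_fn, ← fn_add]; congr 1; ring
  calc (gaugeInv q r ω * fn (f - q * ω * w) * dpow (-1) : PsiDO δ)
      = fn (f - q * ω * w) * dpow (-1)
        + fn q * (dpow (-1) * (fn (ω * r) * fn (f - q * ω * w)) * dpow (-1)) := by
        rw [gaugeInv]; noncomm_ring
    _ = (fn (f - q * ω * w) + fn q * fn (w * ω)) * dpow (-1)
        - fn q * dpow (-1) * fn (w * ω) := by rw [e1, h]; noncomm_ring
    _ = _ := by rw [← e2]

variable {t : Derivation ℂ A A}

/-- Transformed eigenfunctions satisfy the transformed evolution equation. -/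
theorem gauge_eigenfunction {M : PsiDO δ} {f w : A} (hw : δ w = f * r)
    (hq : t q = (M * fn q * dpow (-1)).res) (hf : t f = (M * fn f * dpow (-1)).res)
    (hΩt : t Ω = (dpow (-1) * fn r * M * fn q * dpow (-1)).res)
    (hwt : t w = (dpow (-1) * fn r * M * fn f * dpow (-1)).res) :
    t (f - q * ω * w) =
      (gauge q r ω * M * gaugeInv q r ω * fn (f - q * ω * w) * dpow (-1)).res := by
  -- By the intertwining relation for `G⁻¹` the sandwich splits into terms of the form function
  -- times operator times function, whose residues are the given derivatives of `q`, `f`, `Ω` and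
  -- `w`. What remains is the quotient rule.
  have e : (gauge q r ω * M * gaugeInv q r ω * fn (f - q * ω * w) * dpow (-1) : PsiDO δ) =
      M * fn f * dpow (-1) - M * fn q * dpow (-1) * fn (w * ω)
      - fn (q * ω) * (dpow (-1) * fn r * M * fn f * dpow (-1))
      + fn (q * ω) * (dpow (-1) * fn r * M * fn q * dpow (-1)) * fn (w * ω) := by
    calc _ = gauge q r ω * M * (gaugeInv q r ω * fn (f - q * ω * w) * dpow (-1)) := by noncomm_ring
      _ = _ := by rw [gaugeInv_mul_fn_mul_dpow_neg_one hω hΩ hw, gauge]; noncomm_ring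
  rw [e, res_add, res_sub, res_sub, res_mul_fn, res_mul_fn, res_fn_mul, res_fn_mul, ← hq, ← hf,
    ← hΩt, ← hwt]
  simp only [_root_.map_sub, Derivation.leibniz, smul_eq_mul, deriv_inverse hω]
  ring

/-- Transformed adjoint eigenfunctions satisfy the transformed evolution equation. -/
theorem gauge_adjointEigenfunction {M : PsiDO δ} {g w : A} (hw : δ w = q * g)
    (hr : t r = -(dpow (-1) * fn r * M).res) (hg : t g = -(dpow (-1) * fn g * M).res)
    (hΩt : t Ω = (dpow (-1) * fn r * M * fn q * dpow (-1)).res)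
    (hwt : t w = (dpow (-1) * fn g * M * fn q * dpow (-1)).res) :
    t (g - r * ω * w) =
      -(dpow (-1) * fn (g - r * ω * w) * (gauge q r ω * M * gaugeInv q r ω)).res := by
  have e : (dpow (-1) * fn (g - r * ω * w) * (gauge q r ω * M * gaugeInv q r ω) : PsiDO δ) =
      dpow (-1) * fn g * M - fn (w * ω) * (dpow (-1) * fn r * M)
      + (dpow (-1) * fn g * M * fn q * dpow (-1)) * fn (ω * r)
      - fn (w * ω) * (dpow (-1) * fn r * M * fn q * dpow (-1)) * fn (ω * r) := by
    calc _ = (dpow (-1) * fn (g - r * ω * w) * gauge q r ω) * M * gaugeInv q r ω := by noncomm_ring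
      _ = _ := by rw [dpow_neg_one_mul_fn_mul_gauge hω hΩ hw, gaugeInv]; noncomm_ring
  have hr' : (dpow (-1) * fn r * M).res = -t r := by rw [hr, neg_neg]
  have hg' : (dpow (-1) * fn g * M).res = -t g := by rw [hg, neg_neg]
  rw [e, res_sub, res_add, res_sub, res_mul_fn, res_mul_fn, res_fn_mul, res_fn_mul, ← hΩt, ← hwt,
    hr', hg']
  simp only [_root_.map_sub, Derivation.leibniz, smul_eq_mul, deriv_inverse hω]
  ring

/-- Transformed SEPs satisfy the transformed evolution equation. -/
theorem gauge_sep {M : PsiDO δ} {f g wf wg W : A} (hwf : δ wf = f * r) (hwg : δ wg = q * g)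
    (hΩt : t Ω = (dpow (-1) * fn r * M * fn q * dpow (-1)).res)
    (hft : t wf = (dpow (-1) * fn r * M * fn f * dpow (-1)).res)
    (hgt : t wg = (dpow (-1) * fn g * M * fn q * dpow (-1)).res)
    (hW : t W = (dpow (-1) * fn g * M * fn f * dpow (-1)).res) :
    t (W - wf * ω * wg) =
      (dpow (-1) * fn (g - r * ω * wg) * (gauge q r ω * M * gaugeInv q r ω) *
        fn (f - q * ω * wf) * dpow (-1)).res := by
  have e : (dpow (-1) * fn (g - r * ω * wg) * (gauge q r ω * M * gaugeInv q r ω) *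
        fn (f - q * ω * wf) * dpow (-1) : PsiDO δ) =
      dpow (-1) * fn g * M * fn f * dpow (-1)
      - dpow (-1) * fn g * M * fn q * dpow (-1) * fn (wf * ω)
      - fn (wg * ω) * (dpow (-1) * fn r * M * fn f * dpow (-1))
      + fn (wg * ω) * (dpow (-1) * fn r * M * fn q * dpow (-1)) * fn (wf * ω) := by
    calc _ = (dpow (-1) * fn (g - r * ω * wg) * gauge q r ω) * M *
          (gaugeInv q r ω * fn (f - q * ω * wf) * dpow (-1)) := by noncomm_ring
      _ = _ := by
        rw [dpow_neg_one_mul_fn_mul_gauge hω hΩ hwg, gaugeInv_mul_fn_mul_dpow_neg_one hω hΩ hwf]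
        noncomm_ring
  rw [e, res_add, res_sub, res_sub, res_mul_fn, res_mul_fn, res_fn_mul, res_fn_mul, ← hW, ← hgt,
    ← hft, ← hΩt]
  simp only [_root_.map_sub, Derivation.leibniz, smul_eq_mul, deriv_inverse hω]
  ring

/-- The evolution of the gauge operator. -/
theorem derivCoeff_gauge (ht : ∀ f, t (δ f) = δ (t f)) {B : PsiDO δ} (hB : IsDiff B)
    (hq : t q = (B * fn q * dpow (-1)).res) (hr : t r = -(dpow (-1) * fn r * B).res)
    (hΩt : t Ω = (dpow (-1) * fn r * B * fn q * dpow (-1)).res) :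
    (gauge q r ω).derivCoeff t =
      -((gauge q r ω * B * gaugeInv q r ω).negPart * gauge q r ω) := by
  have hI : OrdLE (dpow (-1) : PsiDO δ) (-1) := ordLE_dpow _
  have hmul : ∀ {P : PsiDO δ} (a b : A), OrdLE P (-1) → OrdLE (fn a * P * fn b) (-1) :=
    fun a b h => by simpa using ((ordLE_fn a).mul h).mul (ordLE_fn b)
  -- Each nonlocal factor is split into a differential operator and an explicit remainder: `B q ∂⁻¹
  -- = U + (∂_t q) ∂⁻¹`, `∂⁻¹ r B = E - ∂⁻¹ (∂_t r)`, `E q ∂⁻¹ = V + (∂_t Ω) ∂⁻¹`. The evolution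
  -- equations of `q`, `r` and `Ω` identify the residues.
  have hU := (hB.mul (isDiff_fn q)).mul_dpow_neg_one
  rw [← hq] at hU
  set U := B * fn q * dpow (-1) - fn (t q) * dpow (-1) with hUdef
  have hE := ((isDiff_fn r).mul hB).dpow_neg_one_mul
  have hr' : (dpow (-1) * fn r * B).res = -t r := by rw [hr, neg_neg]
  rw [← mul_assoc, hr', fn_neg, mul_neg,
    sub_neg_eq_add] at hE
  set E := dpow (-1) * fn r * B + dpow (-1) * fn (t r) with hEdef
  have hEq : (E * fn q * dpow (-1)).res = t Ω := by
    rw [hEdef, add_mul, add_mul, res_add, ← hΩt, add_eq_left]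
    exact OrdLE.res_eq_zero (by simpa using (hI.mul (ordLE_fn (t r))).mul (ordLE_fn q) |>.mul hI)
  have hV := (hE.mul (isDiff_fn q)).mul_dpow_neg_one
  rw [hEq] at hV
  set V := E * fn q * dpow (-1) - fn (t Ω) * dpow (-1) with hVdef
  have hGt : (gauge q r ω : PsiDO δ).derivCoeff t =
      -(fn (t (q * ω)) * dpow (-1) * fn r + fn (q * ω) * dpow (-1) * fn (t r)) := by
    rw [gauge, derivCoeff_sub, derivCoeff_one, derivCoeff_mul ht, derivCoeff_mul ht,
      derivCoeff_fn, derivCoeff_fn, derivCoeff_dpow, mul_zero, add_zero, zero_sub]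
  -- Multiplying the claim on the right by `G⁻¹` turns it into a formula for the negative part of `G
  -- B G⁻¹`. It is read off from an explicit decomposition of `G B G⁻¹` into a differential operator
  -- and an operator of order at most `-1`.
  have hKey : (gauge q r ω * B * gaugeInv q r ω).negPart =
      -((gauge q r ω).derivCoeff t * gaugeInv q r ω) := by
    have e1 : (fn r * fn q : PsiDO δ) = fn (δ Ω) := by rw [fn_mul_fn, hΩ, mul_comm]
    have e2 : (fn (t (q * ω)) * fn Ω : PsiDO δ) = fn (t q) - fn (q * ω) * fn (t Ω) := by
      rw [fn_mul_fn, fn_mul_fn, ← fn_sub, Derivation.leibniz, deriv_inverse hω, smul_eq_mul,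
        smul_eq_mul]
      congr 1; linear_combination (-q * ω * t Ω + t q) * hω
    have e3 : (fn Ω * fn (ω * r) : PsiDO δ) = fn r := by
      rw [fn_mul_fn]; congr 1; linear_combination r * hω
    have h := dpow_neg_one_mul_fn_mul_dpow_neg_one (δ := δ) Ω
    have hval : -((gauge q r ω : PsiDO δ).derivCoeff t * gaugeInv q r ω) =
        fn (q * ω) * dpow (-1) * fn (t r) +
        (fn (t q) - fn (q * ω) * fn (t Ω)) * dpow (-1) * fn (ω * r) +
        fn (q * ω) * (dpow (-1) * fn (t r) * fn q * dpow (-1)) * fn (ω * r) := by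
      calc _ = fn (t (q * ω)) * dpow (-1) * fn r + fn (q * ω) * dpow (-1) * fn (t r)
            + fn (t (q * ω)) * (dpow (-1) * (fn r * fn q) * dpow (-1)) * fn (ω * r)
            + fn (q * ω) * (dpow (-1) * fn (t r) * fn q * dpow (-1)) * fn (ω * r) := by
            rw [hGt, gaugeInv]; noncomm_ring
        _ = fn (t (q * ω)) * dpow (-1) * fn r + fn (q * ω) * dpow (-1) * fn (t r)
            + (fn (t (q * ω)) * fn Ω * dpow (-1) * fn (ω * r)
              - fn (t (q * ω)) * dpow (-1) * (fn Ω * fn (ω * r)))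
            + fn (q * ω) * (dpow (-1) * fn (t r) * fn q * dpow (-1)) * fn (ω * r) := by
            rw [e1, h]; noncomm_ring
        _ = _ := by rw [e2, e3]; noncomm_ring
    rw [hval]
    refine negPart_eq (Q := B + U * fn (ω * r) - fn (q * ω) * E - fn (q * ω) * V * fn (ω * r))
      ?_ ?_ ?_
    · rw [hUdef, hVdef, hEdef, gauge, gaugeInv]
      noncomm_ring
    · exact ((hB.add (hU.mul (isDiff_fn _))).sub ((isDiff_fn _).mul hE)).sub
        (((isDiff_fn _).mul hV).mul (isDiff_fn _))
    · refine OrdLE.add (OrdLE.add (hmul _ _ hI) ?_) (hmul _ _ ?_)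
      · rw [fn_mul_fn, ← fn_sub]
        exact hmul _ _ hI
      · refine OrdLE.mono (N := -2) ?_ (by norm_num)
        simpa using (hI.mul (ordLE_fn (t r))).mul (ordLE_fn q) |>.mul hI
  rw [hKey, neg_mul, neg_neg, mul_assoc, gaugeInv_mul_gauge hω hΩ, mul_one]

end PsiDO

end KP

end

noncomputable section

namespace KP

variable {A : Type*} [CommRing A] [Algebra ℂ A]

/-! ### Miwa shifts -/

theorem miwaShift_zero (d : ℕ → Derivation ℂ A A) (f : A) : miwaShift d f 0 = f := by
  rw [miwaShift]

theorem smul_miwaShift_succ (d : ℕ → Derivation ℂ A A) (f : A) (n : ℕ) :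
    ((n : ℂ) + 1) • miwaShift d f (n + 1) =
      -∑ m ∈ Finset.range (n + 1), d m (miwaShift d f (n - m)) := by
  have h : (n : ℂ) + 1 ≠ 0 := by exact_mod_cast n.succ_ne_zero
  rw [miwaShift, smul_neg, smul_smul, mul_inv_cancel₀ h, one_smul,
    Finset.sum_range fun m => d m (miwaShift d f (n - m))]

/-- The recursion determines its solution from the initial term because `n + 1` is invertible. Miwa
shifts are identified below by checking this recursion. -/
theorem eq_miwaShift {d : ℕ → Derivation ℂ A A} {f : A} {y : ℕ → A} (h0 : y 0 = f)
    (h : ∀ n : ℕ, ((n : ℂ) + 1) • y (n + 1) = -∑ m ∈ Finset.range (n + 1), d m (y (n - m)))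
    (n : ℕ) : y n = miwaShift d f n := by
  induction n using Nat.strong_induction_on with
  | _ n ih =>
    rcases n with _ | n
    · rw [h0, miwaShift_zero]
    · have hn : (n : ℂ) + 1 ≠ 0 := by exact_mod_cast n.succ_ne_zero
      have e : ((n : ℂ) + 1) • y (n + 1) = ((n : ℂ) + 1) • miwaShift d f (n + 1) := by
        rw [h, smul_miwaShift_succ]
        refine congrArg _ (Finset.sum_congr rfl fun m _ => ?_)
        rw [ih (n - m) (by omega)]
      simpa [smul_smul, inv_mul_cancel₀ hn] using congrArg (((n : ℂ) + 1)⁻¹ • ·) e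

theorem map_miwaShift {A' : Type*} [CommRing A'] [Algebra ℂ A'] {d : ℕ → Derivation ℂ A A}
    {d' : ℕ → Derivation ℂ A' A'} (φ : A →ₐ[ℂ] A') (hφ : ∀ m a, φ (d m a) = d' m (φ a)) (f : A)
    (n : ℕ) : φ (miwaShift d f n) = miwaShift d' (φ f) n :=
  eq_miwaShift (y := fun n => φ (miwaShift d f n)) (by simp only [miwaShift_zero])
    (fun n => by simp only [← map_smul, smul_miwaShift_succ, map_neg, map_sum, hφ]) n

theorem miwaShift_of_forall_eq_zero {d : ℕ → Derivation ℂ A A} {c : A} (hc : ∀ m, d m c = 0)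
    (n : ℕ) : miwaShift d c (n + 1) = 0 := by
  refine (eq_miwaShift (y := fun n => if n = 0 then c else 0) rfl (fun n => ?_) (n + 1)).symm.trans
    (if_neg n.succ_ne_zero)
  rw [if_neg n.succ_ne_zero, smul_zero, zero_eq_neg]
  refine Finset.sum_eq_zero fun m _ => ?_
  split_ifs
  · exact hc m
  · exact map_zero _

theorem miwaShift_neg (d : ℕ → Derivation ℂ A A) (f : A) (n : ℕ) :
    miwaShift d (-f) n = -miwaShift d f n := by
  refine (eq_miwaShift (y := fun n => -miwaShift d f n) (by simp only [miwaShift_zero])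
    (fun n => ?_) n).symm
  simp only [smul_neg, smul_miwaShift_succ, map_neg, Finset.sum_neg_distrib]

/-- The Miwa shift of `f` as a power series in `λ⁻¹`. -/
def miwaSeries (d : ℕ → Derivation ℂ A A) (f : A) : PowerSeries A := PowerSeries.mk (miwaShift d f)

/-- `∂_z + ∑_{m ≤ N} zᵐ d m`; the Miwa shift is annihilated by it up to order `N`. -/
def miwaDer (d : ℕ → Derivation ℂ A A) (N : ℕ) : Derivation ℂ (PowerSeries A) (PowerSeries A) :=
  (PowerSeries.derivative A).restrictScalars ℂ +
    ∑ m ∈ Finset.range (N + 1), (PowerSeries.X ^ m : PowerSeries A) • liftDer (d m)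

theorem coeff_liftDer (d : Derivation ℂ A A) (f : PowerSeries A) (n : ℕ) :
    PowerSeries.coeff n (liftDer d f) = d (PowerSeries.coeff n f) := by
  simp [liftDer]

theorem coeff_miwaDer (d : ℕ → Derivation ℂ A A) {n N : ℕ} (hn : n ≤ N) (F : PowerSeries A) :
    PowerSeries.coeff n (miwaDer d N F) = ((n : ℂ) + 1) • PowerSeries.coeff (n + 1) F +
      ∑ m ∈ Finset.range (n + 1), d m (PowerSeries.coeff (n - m) F) := by
  have h : (miwaDer d N F) = PowerSeries.derivative A F +
      ∑ m ∈ Finset.range (N + 1), (PowerSeries.X ^ m : PowerSeries A) * liftDer (d m) F := by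
    rw [miwaDer, Derivation.add_apply]
    congr 1
    induction Finset.range (N + 1) using Finset.induction_on with
    | empty => simp
    | insert a s ha ih =>
      rw [Finset.sum_insert ha, Finset.sum_insert ha, Derivation.add_apply, ih]
      rfl
  rw [h, _root_.map_add, map_sum]
  congr 1
  · rw [PowerSeries.coeff_derivative, Algebra.smul_def, mul_comm]
    simp
  · obtain ⟨j, rfl⟩ := Nat.exists_eq_add_of_le hn
    rw [show n + j + 1 = (n + 1) + j by ring, Finset.sum_range_add, add_eq_left.mpr]
    · refine Finset.sum_congr rfl fun m hm => ?_
      rw [PowerSeries.coeff_X_pow_mul', if_pos (by simpa [Nat.lt_succ_iff] using hm), coeff_liftDer]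
    · refine Finset.sum_eq_zero fun m _ => ?_
      rw [PowerSeries.coeff_X_pow_mul', if_neg (by omega)]

/-- The shift is the exponential of a derivation. Formally, a derivation annihilating both factors
modulo high powers annihilates their product, and uniqueness in the recursion applies. The
truncation `N` keeps the sum of derivations finite without affecting coefficients up to `N`. -/
theorem miwaSeries_mul (d : ℕ → Derivation ℂ A A) (f g : A) :
    miwaSeries d (f * g) = miwaSeries d f * miwaSeries d g := by
  have key : ∀ f : A, ∀ n N : ℕ, n ≤ N →
      PowerSeries.coeff n (miwaDer d N (miwaSeries d f)) = 0 := fun f n N h => by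
    rw [coeff_miwaDer d h]
    simp only [miwaSeries, PowerSeries.coeff_mk, smul_miwaShift_succ, neg_add_cancel]
  ext n
  rw [miwaSeries, PowerSeries.coeff_mk]
  refine (eq_miwaShift (y := fun n => PowerSeries.coeff n (miwaSeries d f * miwaSeries d g))
    ?_ (fun n => ?_) n).symm
  · simp [miwaSeries, miwaShift_zero]
  · rw [← add_eq_zero_iff_eq_neg, ← coeff_miwaDer d le_rfl, Derivation.leibniz, _root_.map_add,
      smul_eq_mul, smul_eq_mul, PowerSeries.coeff_mul, PowerSeries.coeff_mul,
      Finset.sum_eq_zero, Finset.sum_eq_zero, add_zero]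
    · intro p hp
      rw [key f p.2 n (by have := Finset.HasAntidiagonal.mem_antidiagonal.mp hp; omega), mul_zero]
    · intro p hp
      rw [key g p.2 n (by have := Finset.HasAntidiagonal.mem_antidiagonal.mp hp; omega), mul_zero]

namespace PsiDO

variable {d : ℕ → Derivation ℂ A A}

/-! ### Bilinear identities -/

/-- The operator `P / (n + 1)`. -/
def divNat {δ : Derivation ℂ A A} (n : ℕ) (P : PsiDO δ) : PsiDO δ where
  coeff i := ((n : ℂ) + 1)⁻¹ • P.coeff i
  bdd := by
    obtain ⟨N, hN⟩ := P.bdd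
    exact ⟨N, fun i hi => by simp [hN i hi]⟩

theorem nsmul_divNat {δ : Derivation ℂ A A} (n : ℕ) (P : PsiDO δ) : (n + 1) • divNat n P = P := by
  ext i
  have h : (n : ℂ) + 1 ≠ 0 := by exact_mod_cast n.succ_ne_zero
  have h2 : ((n + 1) • divNat n P).coeff i = (n + 1) • (((n : ℂ) + 1)⁻¹ • P.coeff i) :=
    map_nsmul (coeffHom i) (n + 1) (divNat n P)
  rw [h2, ← Nat.cast_smul_eq_nsmul ℂ (n + 1), smul_smul, Nat.cast_succ, mul_inv_cancel₀ h, one_smul]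

theorem nsmul_res {δ : Derivation ℂ A A} (n : ℕ) (P : PsiDO δ) :
    (n • P).res = n • P.res := map_nsmul (coeffHom (-1)) n P

theorem neg_sum_res {δ : Derivation ℂ A A} {ι : Type*} (s : Finset ι) (f : ι → PsiDO δ) :
    (-∑ x ∈ s, f x).res = -∑ x ∈ s, (f x).res := by
  rw [res, coeff_neg, coeff_sum]; rfl

/-- The sequence with `W₀ = W` and `(n + 1) Wₙ₊₁ = -∑_{m ≤ n} (∂_{t_{m+1}} Wₙ₋ₘ - B m Wₙ₋ₘ)`. -/
def shiftSeq (d : ℕ → Derivation ℂ A A) (B : ℕ → PsiDO (d 0)) (W : PsiDO (d 0)) :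
    ℕ → PsiDO (d 0)
  | 0 => W
  | n + 1 => divNat n (-∑ m : Fin (n + 1),
      ((shiftSeq d B W (n - m)).derivCoeff (d m) - B m * shiftSeq d B W (n - m)))
decreasing_by all_goals omega

theorem shiftSeq_zero (B : ℕ → PsiDO (d 0)) (W : PsiDO (d 0)) : shiftSeq d B W 0 = W := by
  rw [shiftSeq]

theorem nsmul_shiftSeq_succ (B : ℕ → PsiDO (d 0)) (W : PsiDO (d 0)) (n : ℕ) :
    (n + 1) • shiftSeq d B W (n + 1) = -∑ m ∈ Finset.range (n + 1),
      ((shiftSeq d B W (n - m)).derivCoeff (d m) - B m * shiftSeq d B W (n - m)) := by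
  rw [shiftSeq, nsmul_divNat, Finset.sum_range fun m =>
    (shiftSeq d B W (n - m)).derivCoeff (d m) - B m * shiftSeq d B W (n - m)]

theorem IsDiff.divNat {δ : Derivation ℂ A A} {P : PsiDO δ} (h : IsDiff P) (n : ℕ) :
    IsDiff (divNat n P) := fun i hi => by
  rw [PsiDO.divNat]; simp only; rw [h i hi, smul_zero]

variable (hd : ∀ m n f, d m (d n f) = d n (d m f))
include hd

/-- The residues of `∂ʲ Wₙ` in terms of Miwa shifts of the residues of `∂ʲ W`. -/
theorem res_dpow_mul_shiftSeq {Wt : ℕ → PsiDO (d 0)}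
    (hW : ∀ n : ℕ, (n + 1) • Wt (n + 1) = -∑ m ∈ Finset.range (n + 1),
      ((Wt (n - m)).derivCoeff (d m) - dpow (m + 1) * Wt (n - m))) (j : ℤ) (n : ℕ) :
    (dpow j * Wt n).res = ∑ l ∈ Finset.range (n + 1),
      miwaShift d (dpow (j + n - l) * Wt 0).res l := by
  have hrec : ∀ (j : ℤ) (n : ℕ), ((n : ℂ) + 1) • (dpow j * Wt (n + 1)).res =
      -∑ m ∈ Finset.range (n + 1), (d m (dpow j * Wt (n - m)).res -
        (dpow (j + 1 + m) * Wt (n - m)).res) := by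
    intro j n
    have h1 : ((n : ℂ) + 1) • (dpow j * Wt (n + 1)).res =
        (dpow j * ((n + 1) • Wt (n + 1))).res := by
      rw [mul_smul_comm, nsmul_res, ← Nat.cast_smul_eq_nsmul ℂ (n + 1), Nat.cast_succ]
    rw [h1, hW, mul_neg, Finset.mul_sum, neg_sum_res]
    refine congrArg _ (Finset.sum_congr rfl fun m _ => ?_)
    rw [mul_sub, res_sub, ← mul_assoc, dpow_mul_dpow, ← res_derivCoeff,
      derivCoeff_mul (fun f => hd m 0 f), derivCoeff_dpow, zero_mul, zero_add]
    congr 4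
    ring
  -- In generating functions, `exp(∑ zᵐ ∂ᵐ / m) = (1 - z ∂)⁻¹`. Hence `(1 - z ∂) W(z)` is the pure
  -- Miwa shift of `W₀`; this is that statement for residues, and iterating it yields the sum in the
  -- lemma.
  have hY : ∀ (j : ℤ) (n : ℕ), (dpow j * Wt (n + 1)).res - (dpow (j + 1) * Wt n).res =
      miwaShift d (dpow j * Wt 0).res (n + 1) := by
    intro j n
    refine eq_miwaShift (d := d) (f := (dpow j * Wt 0).res)
      (y := fun n => Nat.casesOn n (dpow j * Wt 0).res
        fun n => (dpow j * Wt (n + 1)).res - (dpow (j + 1) * Wt n).res) rfl (fun n => ?_) (n + 1)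
    simp only
    rw [smul_sub, hrec]
    have hs : ∑ m ∈ Finset.range (n + 1),
        d m (Nat.casesOn (n - m) (dpow j * Wt 0).res
          fun n => (dpow j * Wt (n + 1)).res - (dpow (j + 1) * Wt n).res) =
        ∑ m ∈ Finset.range (n + 1), d m (dpow j * Wt (n - m)).res -
          ∑ m ∈ Finset.range n, d m (dpow (j + 1) * Wt (n - 1 - m)).res := by
      rw [Finset.sum_range_succ, Finset.sum_range_succ, Nat.sub_self, add_sub_right_comm,
        ← Finset.sum_sub_distrib]
      refine congrArg₂ _ (Finset.sum_congr rfl fun m hm => ?_) rfl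
      rw [Finset.mem_range] at hm
      obtain ⟨e, rfl⟩ := Nat.exists_eq_add_of_lt hm
      rw [show m + e + 1 - m = e + 1 by omega, show m + e + 1 - 1 - m = e by omega,
        _root_.map_sub]
    rw [hs, Finset.sum_sub_distrib]
    rcases n with _ | n
    · simp
    · have h2 := hrec (j + 1) n
      rw [Finset.sum_sub_distrib] at h2
      rw [Finset.sum_range_succ' (fun m : ℕ => ((dpow (j + 1 + m) : PsiDO (d 0)) * Wt (n + 1 - m)).res)]
      have e3 : ∀ m : ℕ, j + 1 + ((m + 1 : ℕ) : ℤ) = j + 1 + 1 + m := fun m => by push_cast; ring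
      simp only [e3, Nat.add_sub_add_right, Nat.cast_zero, add_zero, Nat.sub_zero,
        Nat.add_sub_cancel]
      push_cast
      rw [add_smul (_ + 1 : ℂ), h2, one_smul]
      abel
  induction n generalizing j with
  | zero => simp [miwaShift_zero]
  | succ n ih =>
    rw [Finset.sum_range_succ, sub_eq_iff_eq_add.mp (hY j n), add_comm, ih]
    refine congrArg₂ _ (Finset.sum_congr rfl fun m hm => ?_) ?_
    · congr 4
      push_cast
      ring
    · congr 4
      ring

end PsiDO

end KP

end

/-! ### Bilinear identities for the dressing operator and the tau function of the transform -/

noncomputable section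

namespace KP

variable {A : Type*} [CommRing A] [Algebra ℂ A]

theorem miwaShift_zero_right (d : ℕ → Derivation ℂ A A) (n : ℕ) : miwaShift d 0 n = 0 := by
  rcases n with _ | n
  · exact miwaShift_zero d 0
  · exact miwaShift_of_forall_eq_zero (fun m => map_zero (d m)) n

namespace PsiDO

variable {d : ℕ → Derivation ℂ A A}

theorem res_dpow_neg_one_mul {δ : Derivation ℂ A A} {W : PsiDO δ} (hW : OrdLE W 0) :
    (dpow (-1) * W).res = W.coeff 0 := by
  rw [res, coeff_dpow_mul (-1) hW (-1) 1 (by norm_num)]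
  simp

/-- The symbol of an operator of order at most `0`, as a power series in `λ⁻¹`. -/
def symb {δ : Derivation ℂ A A} (P : PsiDO δ) : PowerSeries A :=
  PowerSeries.mk fun n => P.coeff (-n)

/-- The Miwa shift of the symbol of the adjoint of `W`, at `λ = 1 / z`. -/
def adjSeries (d : ℕ → Derivation ℂ A A) (W : PsiDO (d 0)) : PowerSeries A :=
  PowerSeries.mk fun s => ∑ l ∈ Finset.range (s + 1),
    miwaShift d (dpow ((s : ℤ) - l - 1) * W).res l

theorem coeff_zero_symb_mul_adjSeries (P : PsiDO (d 0)) {W : PsiDO (d 0)} (hW : OrdLE W 0) :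
    PowerSeries.coeff 0 (symb P * adjSeries d W) = P.coeff 0 * W.coeff 0 := by
  rw [PowerSeries.coeff_mul, Finset.HasAntidiagonal.antidiagonal_zero, Finset.sum_singleton, symb, adjSeries,
    PowerSeries.coeff_mk, PowerSeries.coeff_mk, zero_add, Finset.sum_range_one, miwaShift_zero]
  simp [res_dpow_neg_one_mul hW]

variable (hd : ∀ m n f, d m (d n f) = d n (d m f))
include hd

/-- A form of Sato's bilinear identity: a residue of a product of operators is a coefficient of a
product of symbols. Expanding `Res (P Wₙ)` along the left symbol of `P` and inserting
`res_dpow_mul_shiftSeq` gives the coefficients of the two series, except that the summand `l = n +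
1` of `adjSeries`, built from `Res (∂⁻¹ W₀)`, is missing next to `P₀`. The last term compensates for
it. All other additional summands vanish because `W₀` has order at most `0`. -/
theorem coeff_succ_symb_mul_adjSeries {P : PsiDO (d 0)} {Wt : ℕ → PsiDO (d 0)}
    (hP : OrdLE P 0) (hW0 : OrdLE (Wt 0) 0)
    (hW : ∀ n : ℕ, (n + 1) • Wt (n + 1) = -∑ m ∈ Finset.range (n + 1),
      ((Wt (n - m)).derivCoeff (d m) - dpow (m + 1) * Wt (n - m))) (n : ℕ) :
    PowerSeries.coeff (n + 1) (symb P * adjSeries d (Wt 0)) =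
      (P * Wt n).res + P.coeff 0 * miwaShift d ((Wt 0).coeff 0) (n + 1) := by
  have hzero : ∀ (j : ℤ) (l : ℕ), j < -1 → miwaShift d (dpow j * Wt 0).res l = 0 := by
    intro j l hj
    rw [OrdLE.res_eq_zero (((ordLE_dpow j).mul hW0).mono (by omega)), miwaShift_zero_right]
  obtain ⟨M, hM⟩ := (Wt n).exists_ordLE
  rw [res_mul_eq_sum hP hM ((n + 2) + (M + 1).toNat) (by push_cast; omega), Finset.sum_range_add,
    Finset.sum_eq_zero (s := Finset.range (M + 1).toNat), add_zero, PowerSeries.coeff_mul,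
    Finset.Nat.sum_antidiagonal_eq_sum_range_succ
      (fun i j => PowerSeries.coeff i (symb P) * PowerSeries.coeff j (adjSeries d (Wt 0))),
    Finset.sum_range_succ', Finset.sum_range_succ' _ (n + 1), add_assoc]
  · congr 1
    · refine Finset.sum_congr rfl fun k hk => ?_
      rw [Finset.mem_range] at hk
      obtain ⟨e, rfl⟩ := Nat.exists_eq_add_of_le (Nat.lt_succ_iff.mp hk)
      rw [symb, adjSeries, PowerSeries.coeff_mk, PowerSeries.coeff_mk, res_dpow_mul_shiftSeq hd hW,
        show k + e + 1 - (k + 1) = e by omega, show k + e + 1 = (e + 1) + k by ring,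
        Finset.sum_range_add _ (e + 1), Finset.sum_eq_zero (s := Finset.range k), add_zero,
        zero_sub]
      · congr 1
        refine Finset.sum_congr rfl fun l _ => ?_
        congr 4
        push_cast
        ring
      · intro x _
        exact hzero _ _ (by push_cast; omega)
    · rw [symb, adjSeries, PowerSeries.coeff_mk, PowerSeries.coeff_mk, res_dpow_mul_shiftSeq hd hW,
        Nat.sub_zero, Finset.sum_range_succ, mul_add, Nat.cast_zero, sub_zero, neg_zero]
      congr 1
      · congr 1
        refine Finset.sum_congr rfl fun l _ => ?_
        congr 4
        push_cast
        ring
      · rw [← res_dpow_neg_one_mul hW0]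
        congr 5
        ring
  · intro x _
    rw [res_dpow_mul_shiftSeq hd hW, Finset.sum_eq_zero, mul_zero]
    intro l _
    exact hzero _ _ (by push_cast; omega)

section dressing

variable {D : PsiDO (d 0)} {B : ℕ → PsiDO (d 0)} (hD : IsMonic D) (hB : ∀ m, IsDiff (B m))
  (hdr : ∀ m : ℕ, D.inv.derivCoeff (d m) - dpow (m + 1) * D.inv = -(D.inv * B m))

include hdr in
/-- If `Cₙ` evolves with the operators `B m`, then `D⁻¹ Cₙ` evolves with the powers of `∂`. -/
theorem nsmul_inv_mul_shiftSeq (W : PsiDO (d 0)) (n : ℕ) :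
    (n + 1) • (D.inv * shiftSeq d B W (n + 1)) = -∑ m ∈ Finset.range (n + 1),
      ((D.inv * shiftSeq d B W (n - m)).derivCoeff (d m) - dpow (m + 1) *
        (D.inv * shiftSeq d B W (n - m))) := by
  rw [← mul_smul_comm, nsmul_shiftSeq_succ, mul_neg, Finset.mul_sum]
  refine congrArg _ (Finset.sum_congr rfl fun m _ => ?_)
  rw [derivCoeff_mul (fun f => hd m 0 f), sub_eq_iff_eq_add.mp (hdr m)]
  noncomm_ring

omit hd in
include hB in
theorem isDiff_shiftSeq {W : PsiDO (d 0)} (hW : IsDiff W) (n : ℕ) : IsDiff (shiftSeq d B W n) := by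
  induction n using Nat.strong_induction_on with
  | _ n ih =>
    rcases n with _ | n
    · rwa [shiftSeq_zero]
    · rw [shiftSeq]
      refine IsDiff.divNat (IsDiff.neg (IsDiff.sum fun m _ => ?_)) n
      exact ((ih (n - m) (by omega)).derivCoeff _).sub ((hB m).mul (ih (n - m) (by omega)))

include hD hB hdr

/-- This is `ψ(t, λ) ψ*(t - [λ⁻¹], λ) = 1` without the exponential factors. The sequence started at
`1` consists of differential operators `Cₙ`, so `Res (D D⁻¹ Cₙ) = 0`. -/
theorem symb_mul_adjSeries_inv : symb D * adjSeries d D.inv = 1 := by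
  have hC : ∀ n, IsDiff (shiftSeq d B 1 n) := isDiff_shiftSeq hB isDiff_one
  have h0 : D.inv.coeff 0 = 1 := by
    have h2 := (hD.mul (ordLE_inv D)) 0 (by norm_num)
    rw [sub_mul, one_mul, hD.mul_inv, coeff_sub, coeff_one, if_pos rfl, sub_eq_zero] at h2
    exact h2
  have hW0 : D.inv = D.inv * shiftSeq d B 1 0 := by rw [shiftSeq_zero, mul_one]
  have hO : OrdLE (D.inv * shiftSeq d B 1 0) 0 := by rw [← hW0]; exact ordLE_inv D
  ext n
  rw [hW0]
  rcases n with _ | n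
  · rw [coeff_zero_symb_mul_adjSeries D hO, ← hW0, h0, (isMonic_iff.mp hD).1]
    simp
  · rw [coeff_succ_symb_mul_adjSeries hd hD.ordLE hO
      (Wt := fun n => D.inv * shiftSeq d B 1 n) (nsmul_inv_mul_shiftSeq hd hdr 1), ← hW0, h0,
      miwaShift_of_forall_eq_zero (fun m => (d m).map_one_eq_zero), mul_zero, add_zero,
      ← mul_assoc, hD.mul_inv, one_mul, (hC n).res_eq_zero, PowerSeries.coeff_one,
      if_neg n.succ_ne_zero]

/-- Combined with the preceding identity it says that the potential of `r ψ` is `λ⁻¹ r(t - [λ⁻¹])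
ψ`. The residues of `∂⁻¹ r Cₙ` obey the recursion of the Miwa shift of `r`: since `∂⁻¹ r B + ∂⁻¹
r_t` is differential, its product with `Cₙ` has no residue, and the terms with `B` become
derivatives of `r`. -/
theorem symb_adjointEigenfunction {r : A}
    (hr : ∀ n, d n r = -(dpow (-1) * fn r * B n).res) :
    symb (dpow (-1) * fn r * D) * adjSeries d D.inv = PowerSeries.X * miwaSeries d r := by
  have hC : ∀ n, IsDiff (shiftSeq d B 1 n) := isDiff_shiftSeq hB isDiff_one
  have hW0 : D.inv = D.inv * shiftSeq d B 1 0 := by rw [shiftSeq_zero, mul_one]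
  have hO : OrdLE (D.inv * shiftSeq d B 1 0) 0 := by rw [← hW0]; exact ordLE_inv D
  have hP : OrdLE (dpow (-1) * fn r * D) (-1) := by
    simpa using ((ordLE_dpow (-1)).mul (ordLE_fn r)).mul hD.ordLE
  have hP0 : (dpow (-1) * fn r * D).coeff 0 = 0 := hP 0 (by norm_num)
  ext n
  rw [hW0]
  rcases n with _ | n
  · rw [coeff_zero_symb_mul_adjSeries _ hO, hP0, zero_mul, PowerSeries.coeff_zero_X_mul]
  · rw [coeff_succ_symb_mul_adjSeries hd (hP.mono (by norm_num)) hO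
      (Wt := fun n => D.inv * shiftSeq d B 1 n) (nsmul_inv_mul_shiftSeq hd hdr 1), hP0, zero_mul,
      add_zero, PowerSeries.coeff_succ_X_mul, miwaSeries, PowerSeries.coeff_mk]
    have e : ∀ n, dpow (-1) * fn r * D * (D.inv * shiftSeq d B 1 n) =
        dpow (-1) * fn r * shiftSeq d B 1 n := fun n => by
      rw [mul_assoc _ D, ← mul_assoc D, hD.mul_inv, one_mul]
    rw [e]
    refine eq_miwaShift (y := fun n => (dpow (-1) * fn r * shiftSeq d B 1 n).res) ?_ (fun n => ?_) n
    · rw [shiftSeq_zero, mul_one, res_mul_fn, res, coeff_dpow, if_pos rfl, one_mul]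
    · have h1 : ((n : ℂ) + 1) • (dpow (-1) * fn r * shiftSeq d B 1 (n + 1)).res =
          (dpow (-1) * fn r * ((n + 1) • shiftSeq d B 1 (n + 1))).res := by
        rw [mul_smul_comm, nsmul_res, ← Nat.cast_smul_eq_nsmul ℂ (n + 1), Nat.cast_succ]
      rw [h1, nsmul_shiftSeq_succ, mul_neg, Finset.mul_sum, neg_sum_res]
      refine congrArg _ (Finset.sum_congr rfl fun m _ => ?_)
      have hE := ((isDiff_fn r).mul (hB m)).dpow_neg_one_mul
      have hr' : (dpow (-1) * fn r * B m).res = -d m r := by rw [hr, neg_neg]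
      rw [← mul_assoc, hr', fn_neg, mul_neg, sub_neg_eq_add] at hE
      have hE' := (hE.mul (hC (n - m))).res_eq_zero
      rw [add_mul, res_add] at hE'
      rw [mul_sub, res_sub, ← mul_assoc, ← res_derivCoeff, derivCoeff_mul (fun f => hd m 0 f),
        derivCoeff_mul (fun f => hd m 0 f), derivCoeff_dpow, derivCoeff_fn, zero_mul, zero_add,
        res_add]
      linear_combination -hE'

/-- The same method for the sequence `Hₙ` started at `q ∂⁻¹`. Only `H₀` fails to be differential,
and it produces the terms with unshifted `q` and `Ω`. -/
theorem symb_mul_adjSeries_eigenfunction {q : A}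
    (hq : ∀ n, d n q = (B n * fn q * dpow (-1)).res) :
    symb D * adjSeries d (D.inv * (fn q * dpow (-1))) = PowerSeries.X * PowerSeries.C q ∧
    ∀ {r Ω : A}, d 0 Ω = q * r →
    (∀ n, d n r = -(dpow (-1) * fn r * B n).res) →
    (∀ n, d n Ω = (dpow (-1) * fn r * B n * fn q *
      dpow (-1)).res) →
    symb (dpow (-1) * fn r * D) * adjSeries d (D.inv * (fn q * dpow (-1))) =
      PowerSeries.X * (PowerSeries.C Ω - miwaSeries d Ω) := by
  set H := shiftSeq d B (fn q * dpow (-1)) with hH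
  have hH0 : H 0 = fn q * dpow (-1) := shiftSeq_zero _ _
  -- The only dangerous contribution is that of `H₀`: there `q_t ∂⁻¹` cancels the nondifferential
  -- part of `B q ∂⁻¹`, by the evolution equation of `q`.
  have hHd : ∀ n, IsDiff (H (n + 1)) := by
    intro n
    induction n using Nat.strong_induction_on with
    | _ n ih =>
      rw [hH, shiftSeq]
      refine (IsDiff.sum fun m _ => ?_).neg.divNat n
      rcases (Nat.lt_succ_iff.mp m.2).eq_or_lt with h | h
      · rw [← hH, h, Nat.sub_self, hH0, derivCoeff_mul (fun f => hd n 0 f), derivCoeff_fn,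
          derivCoeff_dpow, mul_zero, add_zero, hq, ← mul_assoc (B n)]
        have := ((hB n).mul (isDiff_fn q)).mul_dpow_neg_one.neg
        rwa [neg_sub] at this
      · obtain ⟨e, he⟩ := Nat.exists_eq_add_of_lt h
        rw [show n - m = e + 1 by omega]
        exact ((ih e (by omega)).derivCoeff _).sub ((hB m).mul (ih e (by omega)))
  have hO' : OrdLE (D.inv * H 0) (-1) := by
    rw [hH0]
    simpa using (ordLE_inv D).mul ((ordLE_fn q).mul (ordLE_dpow (-1)))
  have hO : OrdLE (D.inv * H 0) 0 := hO'.mono (by norm_num)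
  have hc : (D.inv * H 0).coeff 0 = 0 := hO' 0 (by norm_num)
  have hstep := nsmul_inv_mul_shiftSeq hd hdr (fn q * dpow (-1))
  rw [← hH0]
  refine ⟨?_, fun {r Ω} hΩ hr hΩt => ?_⟩
  · ext n
    rcases n with _ | n
    · rw [coeff_zero_symb_mul_adjSeries D hO, hc, mul_zero, PowerSeries.coeff_zero_X_mul]
    · rw [coeff_succ_symb_mul_adjSeries hd hD.ordLE hO (Wt := fun n => D.inv * H n) hstep, hc,
        miwaShift_zero_right, mul_zero, add_zero, PowerSeries.coeff_succ_X_mul, ← mul_assoc,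
        hD.mul_inv, one_mul, PowerSeries.coeff_C]
      rcases n with _ | n
      · rw [hH0, res_fn_mul, res, coeff_dpow, if_pos rfl, if_pos rfl, mul_one]
      · rw [(hHd n).res_eq_zero, if_neg n.succ_ne_zero]
  · have hP : OrdLE (dpow (-1) * fn r * D) (-1) := by
      simpa using ((ordLE_dpow (-1)).mul (ordLE_fn r)).mul hD.ordLE
    have e : ∀ n, dpow (-1) * fn r * D * (D.inv * H n) = dpow (-1) * fn r * H n := fun n => by
      rw [mul_assoc _ D, ← mul_assoc D, hD.mul_inv, one_mul]
    have hI2 : ∀ r : A, (dpow (-1) * fn r * H 0).res = 0 := fun r => by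
      rw [hH0]
      refine OrdLE.res_eq_zero ?_
      simpa using ((ordLE_dpow (-1)).mul (ordLE_fn r)).mul ((ordLE_fn q).mul (ordLE_dpow (-1)))
    -- The sequence starting with `Ω` and continuing with the negated residues satisfies the Miwa
    -- recursion. The contribution of `H₀` is `∂_t Ω` by the SEP equation; the others are as for
    -- adjoint eigenfunctions.
    have hy : ∀ n, -(dpow (-1) * fn r * H (n + 1)).res = miwaShift d Ω (n + 1) := by
      intro n
      refine eq_miwaShift (d := d) (f := Ω) (y := fun n => Nat.casesOn n Ω
        fun n => -(dpow (-1) * fn r * H (n + 1)).res) rfl (fun n => ?_) (n + 1)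
      simp only
      have h1 : ((n : ℂ) + 1) • -(dpow (-1) * fn r * H (n + 1)).res =
          -(dpow (-1) * fn r * ((n + 1) • H (n + 1))).res := by
        rw [mul_smul_comm, nsmul_res, ← Nat.cast_smul_eq_nsmul ℂ (n + 1), Nat.cast_succ, smul_neg]
      rw [h1, nsmul_shiftSeq_succ, mul_neg, Finset.mul_sum, neg_sum_res, ← hH]
      refine congrArg _ ?_
      rw [← Finset.sum_neg_distrib]
      refine Finset.sum_congr rfl fun m hm => ?_
      rcases (Nat.lt_succ_iff.mp (Finset.mem_range.mp hm)).eq_or_lt with rfl | h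
      · rw [Nat.sub_self]
        change _ = d m Ω
        rw [hH0, mul_sub, res_sub, derivCoeff_mul (fun f => hd m 0 f),
          derivCoeff_fn, derivCoeff_dpow, mul_zero, add_zero, hΩt]
        have h2 : OrdLE (dpow (-1) * fn r * (fn (d m q) * dpow (-1)) : PsiDO (d 0)) (-2) := by
          simpa using ((ordLE_dpow (-1)).mul (ordLE_fn r)).mul
            ((ordLE_fn (d m q)).mul (ordLE_dpow (-1)))
        rw [h2.res_eq_zero, zero_sub, neg_neg]
        simp only [mul_assoc]
      · obtain ⟨e, rfl⟩ := Nat.exists_eq_add_of_lt h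
        rw [show m + e + 1 - m = e + 1 by omega]
        change _ = d m (-(dpow (-1) * fn r * H (e + 1)).res)
        have hE := ((isDiff_fn r).mul (hB m)).dpow_neg_one_mul
        have hr' : (dpow (-1) * fn r * B m).res = -d m r := by rw [hr, neg_neg]
        rw [← mul_assoc, hr', fn_neg, mul_neg, sub_neg_eq_add] at hE
        have hE' := (hE.mul (hHd e)).res_eq_zero
        rw [add_mul, res_add] at hE'
        rw [mul_sub, res_sub, ← mul_assoc, _root_.map_neg, ← res_derivCoeff,
          derivCoeff_mul (fun f => hd m 0 f),
          derivCoeff_mul (fun f => hd m 0 f), derivCoeff_dpow, derivCoeff_fn, zero_mul, zero_add,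
          res_add]
        linear_combination hE'
    ext n
    rcases n with _ | n
    · rw [coeff_zero_symb_mul_adjSeries _ hO, hc, mul_zero, PowerSeries.coeff_zero_X_mul]
    · rw [coeff_succ_symb_mul_adjSeries hd (hP.mono (by norm_num)) hO
        (Wt := fun n => D.inv * H n) hstep, hc, miwaShift_zero_right, mul_zero, add_zero, e,
        PowerSeries.coeff_succ_X_mul, _root_.map_sub, PowerSeries.coeff_C, miwaSeries,
        PowerSeries.coeff_mk]
      rcases n with _ | n
      · rw [hI2, miwaShift_zero, if_pos rfl, sub_self]
      · rw [if_neg n.succ_ne_zero, ← hy, zero_sub, neg_neg]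

/-- The tau function of the binary Darboux transform. -/
theorem symb_gauge_mul {q r Ω ω τ : A} (hω : Ω * ω = 1) (hΩ : d 0 Ω = q * r)
    (hq : ∀ n, d n q = (B n * fn q * dpow (-1)).res)
    (hr : ∀ n, d n r = -(dpow (-1) * fn r * B n).res)
    (hΩt : ∀ n, d n Ω = (dpow (-1) * fn r * B n * fn q *
      dpow (-1)).res)
    (hτ : symb D * PowerSeries.C τ = miwaSeries d τ) :
    symb (gauge q r ω * D) * PowerSeries.C (-(Ω * τ)) = miwaSeries d (-(Ω * τ)) := by
  have i1 := symb_mul_adjSeries_inv hd hD hB hdr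
  have i2 := symb_adjointEigenfunction hd hD hB hdr hr
  obtain ⟨i3, h4⟩ := symb_mul_adjSeries_eigenfunction hd hD hB hdr hq
  have i4 := h4 hΩ hr hΩt
  have hs : symb (gauge q r ω * D) =
      symb D - PowerSeries.C (q * ω) * symb (dpow (-1) * fn r * D) := by
    ext n
    simp [symb, gauge, sub_mul, mul_assoc]
  have hneg : miwaSeries d (-(Ω * τ)) = -miwaSeries d (Ω * τ) := by
    ext n
    simp [miwaSeries, miwaShift_neg]
  rw [hneg, miwaSeries_mul, ← hτ, hs]
  set w := symb D
  set φ := symb (dpow (-1) * fn r * D)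
  set K := adjSeries d D.inv
  set K' := adjSeries d (D.inv * (fn q * dpow (-1)))
  set R := miwaSeries d r
  -- Eliminating the adjoint series `K` by means of `w K = 1`, and then `K'`, leaves relations
  -- between unshifted and shifted functions only.
  have j1 : φ = PowerSeries.X * R * w := by
    linear_combination (-φ) * i1 + w * i2
  have j2 : PowerSeries.X * (PowerSeries.C Ω - miwaSeries d Ω) =
      PowerSeries.X * (PowerSeries.X * R * PowerSeries.C q) := by
    rw [← i4, j1]
    linear_combination PowerSeries.X * R * i3
  have j3 := PowerSeries.X_mul_cancel j2
  have hω' : PowerSeries.C Ω * PowerSeries.C ω = 1 := by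
    rw [← _root_.map_mul, hω, _root_.map_one]
  -- Here `j3` is `Ω - Ω[z] = z q r[z]`. Hence the new symbol is `w (1 - ω (Ω - Ω[z])) = w ω Ω[z]`,
  -- and multiplication by `Ω τ` gives `w τ Ω[z] = τ[z] Ω[z]`.
  simp only [_root_.map_neg, _root_.map_mul]
  rw [j1]
  linear_combination (-w * PowerSeries.C τ) * j3 + PowerSeries.C q * PowerSeries.X * R * w *
    PowerSeries.C τ * hω'

end dressing

end PsiDO

end KP

end

/-! ### Binary Darboux transformations as gauge transformations -/

noncomputable section

namespace KP

theorem inverse_eq {R : Type*} [CommRing R] {a b : R} (h : a * b = 1) : Ring.inverse a = b := by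
  have hu : IsUnit a := IsUnit.of_mul_eq_one b h
  exact left_inv_eq_right_inv (Ring.inverse_mul_cancel a hu) h

variable {A : Type*} [CommRing A] [Algebra ℂ A]

namespace PsiDO

variable {δ : Derivation ℂ A A}

theorem res_negPart_mul_fn_mul (P : PsiDO δ) (f : A) :
    (P.negPart * fn f * dpow (-1)).res = 0 :=
  OrdLE.res_eq_zero (by
    simpa using ((ordLE_negPart P).mul (ordLE_fn f)).mul (ordLE_dpow (-1)))

theorem res_mul_negPart (P : PsiDO δ) (g : A) : (dpow (-1) * fn g * P.negPart).res = 0 :=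
  OrdLE.res_eq_zero (by
    simpa using ((ordLE_dpow (-1)).mul (ordLE_fn g)).mul (ordLE_negPart P))

/-- The integral part of `P` contributes an operator of order at most `-2`. Dropping the truncation
in this way is what makes conjugation by the gauge operator applicable, since full powers of `L`
transform by conjugation and truncated ones do not. -/
theorem res_nonnegPart_mul (P : PsiDO δ) (f : A) :
    (P.nonnegPart * fn f * dpow (-1)).res = (P * fn f * dpow (-1)).res := by
  conv_rhs => rw [← nonnegPart_add_negPart P]
  rw [add_mul, add_mul, res_add, res_negPart_mul_fn_mul, add_zero]

theorem res_mul_nonnegPart (P : PsiDO δ) (g : A) :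
    (dpow (-1) * fn g * P.nonnegPart).res = (dpow (-1) * fn g * P).res := by
  conv_rhs => rw [← nonnegPart_add_negPart P]
  rw [mul_add, res_add, res_mul_negPart, add_zero]

theorem res_mul_nonnegPart_mul (P : PsiDO δ) (f g : A) :
    (dpow (-1) * fn g * P.nonnegPart * fn f * dpow (-1)).res =
      (dpow (-1) * fn g * P * fn f * dpow (-1)).res := by
  have h : OrdLE (dpow (-1) * fn g * P.negPart * fn f * dpow (-1)) (-2) := by
    refine OrdLE.mono (N := -3) ?_ (by norm_num)
    simpa using ((((ordLE_dpow (-1)).mul (ordLE_fn g)).mul (ordLE_negPart P)).mul (ordLE_fn f)).mul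
      (ordLE_dpow (-1))
  conv_rhs => rw [← nonnegPart_add_negPart P]
  rw [mul_add, add_mul, add_mul, res_add, h.res_eq_zero, add_zero]

theorem negPart_add (P Q : PsiDO δ) : (P + Q).negPart = P.negPart + Q.negPart := by
  ext i
  simp only [coeff_negPart, coeff_add]
  split_ifs <;> simp

theorem OrdLE.negPart_eq {P : PsiDO δ} (h : OrdLE P (-1)) : P.negPart = P :=
  PsiDO.negPart_eq (zero_add P).symm isDiff_zero h

theorem ordLE_gauge_sub (q r ω : A) :
    OrdLE (fn (q * ω) * dpow (-1) * fn r : PsiDO δ) (-1) := by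
  simpa using ((ordLE_fn (q * ω)).mul (ordLE_dpow (-1))).mul (ordLE_fn r)

theorem ordLE_gauge (q r ω : A) : OrdLE (gauge q r ω : PsiDO δ) 0 :=
  ordLE_one.sub ((ordLE_gauge_sub q r ω).mono (by norm_num))

theorem ordLE_gaugeInv (q r ω : A) : OrdLE (gaugeInv q r ω : PsiDO δ) 0 := by
  refine ordLE_one.add (OrdLE.mono (N := -1) ?_ (by norm_num))
  simpa using ((ordLE_fn q).mul (ordLE_dpow (-1))).mul (ordLE_fn (ω * r))

theorem isMonic_gauge_mul (q r ω : A) {D : PsiDO δ} (hD : IsMonic D) :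
    IsMonic (gauge q r ω * D) := by
  have h1 : OrdLE (fn (q * ω) * dpow (-1) * fn r * D) (-1) := by
    simpa using (ordLE_gauge_sub q r ω).mul hD.ordLE
  have h2 := OrdLE.add hD h1
  rwa [show 1 - D + fn (q * ω) * dpow (-1) * fn r * D = 1 - gauge q r ω * D by
    rw [gauge]; noncomm_ring] at h2

theorem symb_mul_C_eq_iff {D : PsiDO δ} {d : ℕ → Derivation ℂ A A} {τ : A} :
    symb D * PowerSeries.C τ = miwaSeries d τ ↔
      ∀ n : ℕ, D.applyExp 1 (-n) * τ = miwaShift d τ n := by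
  rw [PowerSeries.ext_iff]
  refine forall_congr' fun n => ?_
  simp [symb, miwaSeries, applyExp]

end PsiDO

open PsiDO

namespace Data

variable {δ : Derivation ℂ A A} {k : ℕ}

/-! ### Binary Darboux transformations without inverses of eigenfunctions -/

/-- The binary Darboux transformation in the form that does not involve the inverse of `qᵢ`. -/
def binaryGauge (S : Data δ k) (i : Fin k) : Data δ k :=
  let ω := Ring.inverse (S.Ω (some i) (some i))
  { D := gauge (S.q (some i)) (S.r (some i)) ω * S.D
    q := fun b => S.q b - S.q (some i) * ω * S.Ω b (some i)
    r := fun b => S.r b - S.r (some i) * ω * S.Ω (some i) b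
    Ω := fun a b => S.Ω a b - S.Ω a (some i) * ω * S.Ω (some i) b
    τ := -(S.Ω (some i) (some i) * S.τ) }

/-- Since `r⁽¹⁾ = -q⁻¹ Ω`, the composite is `T_I T_D = q Ω⁻¹ ∂⁻¹ Ω ∂ q⁻¹`. Moving `Ω` past `∂` by `Ω
∂ = ∂ Ω - q r` gives `1 - q Ω⁻¹ ∂⁻¹ r`; the factor `∂⁻¹` of the first step cancels the factor `∂` of
the second, and so do `q` and its inverse in the remaining fields. -/
theorem binaryDarboux_eq_binaryGauge {S : Data δ k} {i : Fin k} (hq : IsUnit (S.q (some i)))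
    (hΩ : IsUnit (S.Ω (some i) (some i))) (hx : ∀ a b, δ (S.Ω a b) = S.q a * S.r b) :
    S.binaryDarboux i = S.binaryGauge i := by
  set p := Ring.inverse (S.q (some i)) with hp
  set ω := Ring.inverse (S.Ω (some i) (some i)) with hω
  have hqp : S.q (some i) * p = 1 := Ring.mul_inverse_cancel _ hq
  have hΩω : S.Ω (some i) (some i) * ω = 1 := Ring.mul_inverse_cancel _ hΩ
  have hr1 : Ring.inverse (-(p * S.Ω (some i) (some i))) = -(S.q (some i) * ω) :=
    inverse_eq (by linear_combination S.q (some i) * p * hΩω + hqp)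
  have hd : ∀ b, -(p * S.Ω (some i) (some i)) * δ (S.q (some i) * ω * (p * S.Ω (some i) b)) =
      -(S.r b - S.r (some i) * ω * S.Ω (some i) b) := by
    intro b
    have e : S.q (some i) * ω * (p * S.Ω (some i) b) = ω * S.Ω (some i) b := by
      linear_combination ω * S.Ω (some i) b * hqp
    rw [e, Derivation.leibniz, deriv_inverse hΩω, hx, hx, smul_eq_mul, smul_eq_mul]
    linear_combination (-S.r b * S.Ω (some i) (some i) * ω + S.r (some i) * S.Ω (some i) b * ω *
      S.Ω (some i) (some i) * ω) * hqp + (-S.r b + S.r (some i) * S.Ω (some i) b * ω) * hΩω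
  ext1
  · simp only [binaryDarboux, darbouxI, darbouxD, binaryGauge, ← hp, ← hω]
    rw [hr1]
    have e1 : (fn (-(p * S.Ω (some i) (some i))) * fn (S.q (some i)) : PsiDO δ) =
        -fn (S.Ω (some i) (some i)) := by
      rw [fn_mul_fn, ← fn_neg]; congr 1; linear_combination -S.Ω (some i) (some i) * hqp
    have e2 : (dpow (-1) * dpow 1 : PsiDO δ) = 1 := by rw [dpow_mul_dpow]; rfl
    have e3 : (fn (S.Ω (some i) (some i)) * dpow 1 : PsiDO δ) =
        dpow 1 * fn (S.Ω (some i) (some i)) - fn (S.q (some i) * S.r (some i)) := by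
      rw [dpow_one_mul_fn, hx]; abel
    have e4 : (fn (S.q (some i) * ω) * fn (S.Ω (some i) (some i)) * fn p : PsiDO δ) = 1 := by
      rw [fn_mul_fn, fn_mul_fn, ← fn_one]; congr 1
      linear_combination S.q (some i) * p * hΩω + hqp
    have e5 : (fn (S.q (some i) * S.r (some i)) * fn p : PsiDO δ) = fn (S.r (some i)) := by
      rw [fn_mul_fn]; congr 1; linear_combination S.r (some i) * hqp
    calc _ = -fn (S.q (some i) * ω) * dpow (-1) *
          (fn (-(p * S.Ω (some i) (some i))) * fn (S.q (some i))) * dpow 1 * fn p * S.D *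
          (dpow (-1) * dpow 1) := by rw [fn_neg (S.q (some i) * ω)]; noncomm_ring
      _ = fn (S.q (some i) * ω) * dpow (-1) * (fn (S.Ω (some i) (some i)) * dpow 1) * fn p *
          S.D := by rw [e1, e2]; noncomm_ring
      _ = fn (S.q (some i) * ω) * (dpow (-1) * dpow 1) * fn (S.Ω (some i) (some i)) * fn p * S.D -
          fn (S.q (some i) * ω) * dpow (-1) * (fn (S.q (some i) * S.r (some i)) * fn p) * S.D := by
          rw [e3]; noncomm_ring
      _ = _ := by
          rw [e2, mul_one, e4, e5, PsiDO.gauge]; noncomm_ring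
  · funext b
    simp only [binaryDarboux, darbouxI, darbouxD, binaryGauge, ← hp, ← hω]
    rw [hr1]
    linear_combination (S.q b * S.Ω (some i) (some i) * ω) * hqp + S.q b * hΩω
  · funext b
    simp only [binaryDarboux, darbouxI, darbouxD, binaryGauge, ← hp, ← hω]
    rw [hr1, neg_mul_neg, hd, neg_neg]
  · funext a b
    simp only [binaryDarboux, darbouxI, darbouxD, binaryGauge, ← hp, ← hω]
    rw [hr1]
    linear_combination (-S.Ω (some i) b * ω * S.Ω a (some i) + S.Ω (some i) b * ω * p * S.q a *
      S.Ω (some i) (some i)) * hqp + p * S.q a * S.Ω (some i) b * hΩω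
  · simp only [binaryDarboux, darbouxI, darbouxD, binaryGauge, ← hp, ← hω]
    linear_combination (-S.Ω (some i) (some i) * S.τ) * hqp

theorem binaryGauge_sep_x {S : Data δ k} {i : Fin k} (hΩ : IsUnit (S.Ω (some i) (some i)))
    (hx : ∀ a b, δ (S.Ω a b) = S.q a * S.r b) (a b : Option (Fin k)) :
    δ ((S.binaryGauge i).Ω a b) = (S.binaryGauge i).q a * (S.binaryGauge i).r b := by
  have hΩω := Ring.mul_inverse_cancel _ hΩ
  simp only [binaryGauge, _root_.map_sub, Derivation.leibniz, smul_eq_mul, deriv_inverse hΩω, hx]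
  ring

end Data

/-! ### Invariance of the KP hierarchy under a binary Darboux transformation -/

namespace IsSolution

variable {k : ℕ} {d : ℕ → Derivation ℂ A A} {S : Data (d 0) k}

theorem isMonic (hS : IsSolution d S) : IsMonic S.D :=
  isMonic_iff.mpr ⟨hS.coeff_zero, hS.coeff_pos⟩

theorem eigenfunction_res (hS : IsSolution d S) (a : Option (Fin k)) (n : ℕ) :
    d n (S.q a) = (S.L ^ (n + 1) * fn (S.q a) * dpow (-1)).res := by
  rw [hS.eigenfunction, apply_eq_res, pow_eq, res_nonnegPart_mul]

theorem adjointEigenfunction_res (hS : IsSolution d S) (b : Option (Fin k)) (n : ℕ) :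
    d n (S.r b) = -(dpow (-1) * fn (S.r b) * S.L ^ (n + 1)).res := by
  rw [hS.adjointEigenfunction, adj_apply_eq_res, pow_eq, res_mul_nonnegPart]

theorem sep_res (hS : IsSolution d S) (a b : Option (Fin k)) (n : ℕ) :
    d n (S.Ω a b) = (dpow (-1) * fn (S.r b) * S.L ^ (n + 1) * fn (S.q a) * dpow (-1)).res := by
  rw [hS.sep, pow_eq, res_mul_nonnegPart_mul]

/-- A binary Darboux transformation maps solutions of the KP hierarchy to solutions. -/
theorem binaryGauge (hd : ∀ m n f, d m (d n f) = d n (d m f)) (hS : IsSolution d S) {i : Fin k}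
    (hΩ : IsUnit (S.Ω (some i) (some i))) : IsSolution d (S.binaryGauge i) := by
  set ω := Ring.inverse (S.Ω (some i) (some i)) with hω
  have hΩω : S.Ω (some i) (some i) * ω = 1 := Ring.mul_inverse_cancel _ hΩ
  set G : PsiDO (d 0) := gauge (S.q (some i)) (S.r (some i)) ω with hG
  set Gi : PsiDO (d 0) := gaugeInv (S.q (some i)) (S.r (some i)) ω with hGi
  have hx := hS.sep_x (some i) (some i)
  have hGG : G * Gi = 1 := gauge_mul_gaugeInv hΩω hx
  have hGG' : Gi * G = 1 := gaugeInv_mul_gauge hΩω hx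
  have hmon : IsMonic (G * S.D) := isMonic_gauge_mul _ _ _ hS.isMonic
  have hinv : (G * S.D).inv = S.D.inv * Gi := hmon.inv_eq (by
    rw [mul_assoc, ← mul_assoc S.D, hS.isMonic.mul_inv, one_mul, hGG])
  -- The Lax operator and its powers are conjugated by `G`, as `(G D)⁻¹ = D⁻¹ G⁻¹`.
  have hL : ∀ n, (S.binaryGauge i).L ^ n = G * S.L ^ n * Gi := by
    have h1 : (S.binaryGauge i).L = G * S.L * Gi := by
      change G * S.D * dpow 1 * (G * S.D).inv = G * (S.D * dpow 1 * S.D.inv) * Gi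
      rw [hinv]
      noncomm_ring
    intro n
    rw [h1]
    induction n with
    | zero => rw [pow_zero, pow_zero, mul_one, hGG]
    | succ n ih =>
      rw [pow_succ, ih, pow_succ, show G * S.L ^ n * Gi * (G * S.L * Gi) =
        G * S.L ^ n * (Gi * G) * S.L * Gi by noncomm_ring, hGG']
      noncomm_ring
  have hrq := fun n => (hS.eigenfunction_res (some i) n).trans
    (res_nonnegPart_mul _ _).symm
  have hrr := fun n => (hS.adjointEigenfunction_res (some i) n).trans
    (congrArg _ (res_mul_nonnegPart _ _).symm)
  have hrΩ := fun n => (hS.sep_res (some i) (some i) n).trans (res_mul_nonnegPart_mul _ _ _).symm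
  obtain ⟨h0, hpos⟩ := isMonic_iff.mp hmon
  refine ⟨h0, hpos, fun n => ?_, fun a n => ?_, fun b n => ?_,
    Data.binaryGauge_sep_x hΩ hS.sep_x, fun a b n => ?_, (hΩ.mul hS.isUnit_tau).neg, ?_⟩
  · rw [pow_eq, hL]
    change (G * S.D).derivCoeff (d n) = -((G * S.L ^ (n + 1) * Gi).negPart * (G * S.D))
    have ht : ∀ f, d n (d 0 f) = d 0 (d n f) := fun f => hd n 0 f
    have h1 := derivCoeff_gauge hΩω hx ht (isDiff_nonnegPart (S.L ^ (n + 1))) (hrq n) (hrr n) (hrΩ n)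
    -- Conjugation by `G` keeps the integral part of `Lⁿ⁺¹` of order at most `-1`, so only the
    -- conjugate of the differential part has to be projected; its projection is known from the
    -- evolution of `G`.
    have h2 : (G * S.L ^ (n + 1) * Gi).negPart =
        (G * (S.L ^ (n + 1)).nonnegPart * Gi).negPart + G * (S.L ^ (n + 1)).negPart * Gi := by
      have hO : OrdLE (G * (S.L ^ (n + 1)).negPart * Gi) (-1) := by
        simpa using ((ordLE_gauge _ _ _).mul (ordLE_negPart _)).mul (ordLE_gaugeInv _ _ _)
      conv_lhs => rw [← nonnegPart_add_negPart (S.L ^ (n + 1)), mul_add, add_mul, negPart_add,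
        hO.negPart_eq]
    rw [derivCoeff_mul ht, h1, hS.dressing, pow_eq, h2, add_mul _ _ (G * S.D),
      show G * (S.L ^ (n + 1)).negPart * Gi * (G * S.D) =
        G * (S.L ^ (n + 1)).negPart * (Gi * G) * S.D by noncomm_ring, hGG']
    noncomm_ring
  · rw [pow_eq, hL, apply_eq_res, res_nonnegPart_mul]
    exact gauge_eigenfunction hΩω hx (hS.sep_x a (some i)) (hS.eigenfunction_res _ _)
      (hS.eigenfunction_res _ _) (hS.sep_res _ _ _) (hS.sep_res _ _ _)
  · rw [pow_eq, hL, adj_apply_eq_res, res_mul_nonnegPart]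
    exact gauge_adjointEigenfunction hΩω hx (hS.sep_x (some i) b) (hS.adjointEigenfunction_res _ _)
      (hS.adjointEigenfunction_res _ _) (hS.sep_res _ _ _) (hS.sep_res _ _ _)
  · rw [pow_eq, hL, res_mul_nonnegPart_mul]
    exact gauge_sep hΩω hx (hS.sep_x a (some i)) (hS.sep_x (some i) b) (hS.sep_res _ _ _)
      (hS.sep_res _ _ _) (hS.sep_res _ _ _) (hS.sep_res _ _ _)
  · have hdress : ∀ m : ℕ, S.D.inv.derivCoeff (d m) - dpow (m + 1) * S.D.inv =
        -(S.D.inv * (S.L ^ (m + 1)).nonnegPart) := by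
      intro m
      have hLD : ∀ n : ℕ, S.D.inv * S.L ^ n = dpow n * S.D.inv := by
        intro n
        induction n with
        | zero => rw [pow_zero, mul_one, Nat.cast_zero, dpow_zero, one_mul]
        | succ n ih =>
          rw [pow_succ, ← mul_assoc, ih, Data.L, Nat.cast_succ, ← dpow_mul_dpow,
            show dpow n * S.D.inv * (S.D * dpow 1 * S.D.inv) =
              dpow n * (S.D.inv * S.D) * dpow 1 * S.D.inv by noncomm_ring, hS.isMonic.inv_mul,
            mul_one]
      rw [hS.isMonic.derivCoeff_inv fun f => hd m 0 f, hS.dressing, pow_eq, ← Nat.cast_succ, ← hLD]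
      have e := congrArg (S.D.inv * ·) (nonnegPart_add_negPart (S.L ^ (m + 1)))
      simp only [mul_add] at e
      rw [← e]
      simp only [mul_neg, neg_mul, neg_neg, mul_assoc, hS.isMonic.mul_inv, mul_one]
      abel
    exact symb_mul_C_eq_iff.mp (symb_gauge_mul hd hS.isMonic
      (fun m => isDiff_nonnegPart (S.L ^ (m + 1))) hdress hΩω hx hrq hrr hrΩ
      (symb_mul_C_eq_iff.mpr hS.tau))

end IsSolution

end KP

end

noncomputable section

namespace KP

open PsiDO

variable {A : Type*} [CommRing A] [Algebra ℂ A] {δ : Derivation ℂ A A} {k : ℕ}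

theorem PsiDO.dpow_neg_one_mul_fn_mul_of_deriv_eq_zero {c : A} (hc : δ c = 0) (a : A) :
    (dpow (-1) * fn (c * a) : PsiDO δ) = fn c * (dpow (-1) * fn a) := by
  have h := dpow_neg_one_mul_fn_mul_dpow_neg_one (δ := δ) c
  rw [hc, fn_zero, mul_zero, zero_mul, eq_comm, sub_eq_zero] at h
  rw [← fn_mul_fn, ← mul_assoc, ← h, mul_assoc]

namespace Data

/-! ### Chains of transformations -/

/-- The chain of binary Darboux transformations, without inverses of eigenfunctions. -/
def gaugeChain (S : Data δ k) : ℕ → Data δ k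
  | 0 => S
  | j + 1 => if h : j < k then (S.gaugeChain j).binaryGauge ⟨j, h⟩ else S.gaugeChain j

theorem gaugeChain_succ (S : Data δ k) (i : Fin k) :
    S.gaugeChain (i + 1) = (S.gaugeChain i).binaryGauge i := by
  rw [gaugeChain, dif_pos i.2]

theorem chain_succ (S : Data δ k) (i : Fin k) :
    S.chain (i + 1) = (S.chain i).binaryDarboux i := by
  rw [chain, dif_pos i.2]

theorem chain_succ_of_le (S : Data δ k) {j : ℕ} (h : k ≤ j) : S.chain (j + 1) = S.chain j := by
  rw [chain, dif_neg (not_lt.mpr h)]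

theorem gaugeChain_succ_of_le (S : Data δ k) {j : ℕ} (h : k ≤ j) :
    S.gaugeChain (j + 1) = S.gaugeChain j := by
  rw [gaugeChain, dif_neg (not_lt.mpr h)]

theorem chain_eq_gaugeChain_succ {S : Data δ k} {i : Fin k} (h : S.chain i = S.gaugeChain i)
    (hx : ∀ a b, δ ((S.gaugeChain i).Ω a b) = (S.gaugeChain i).q a * (S.gaugeChain i).r b)
    (hq : IsUnit ((S.gaugeChain i).q (some i)))
    (hΩ : IsUnit ((S.gaugeChain i).Ω (some i) (some i))) :
    S.chain (i + 1) = S.gaugeChain (i + 1) := by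
  rw [chain_succ, gaugeChain_succ, h, binaryDarboux_eq_binaryGauge hq hΩ hx]

theorem gaugeChain_sep_x {S : Data δ k} (hx : ∀ a b, δ (S.Ω a b) = S.q a * S.r b)
    (hΩ : ∀ i : Fin k, IsUnit ((S.gaugeChain i).Ω (some i) (some i))) (j : ℕ)
    (a b : Option (Fin k)) :
    δ ((S.gaugeChain j).Ω a b) = (S.gaugeChain j).q a * (S.gaugeChain j).r b := by
  induction j generalizing a b with
  | zero => exact hx a b
  | succ j ih =>
    by_cases h : j < k
    · rw [gaugeChain_succ S ⟨j, h⟩]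
      exact binaryGauge_sep_x (hΩ ⟨j, h⟩) ih a b
    · rw [gaugeChain_succ_of_le S (not_lt.mp h)]
      exact ih a b

theorem chain_eq_gaugeChain {S : Data δ k} (hx : ∀ a b, δ (S.Ω a b) = S.q a * S.r b)
    (hΩ : ∀ i : Fin k, IsUnit ((S.gaugeChain i).Ω (some i) (some i)))
    (hq : ∀ i : Fin k, IsUnit ((S.gaugeChain i).q (some i))) (j : ℕ) :
    S.chain j = S.gaugeChain j := by
  induction j with
  | zero => rfl
  | succ j ih =>
    by_cases h : j < k
    · exact chain_eq_gaugeChain_succ (i := ⟨j, h⟩) ih (gaugeChain_sep_x hx hΩ j) (hq ⟨j, h⟩)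
        (hΩ ⟨j, h⟩)
    · rw [chain_succ_of_le S (not_lt.mp h), gaugeChain_succ_of_le S (not_lt.mp h), ih]

/-- Invertibility is known along the original chain only, whereas `Ω_x = q r` is propagated along
the gauge chain; so the equality of the chains and this relation are proved in one induction. -/
theorem DarbouxDefined.chain_eq_gaugeChain {S : Data δ k} (hS : S.DarbouxDefined)
    (hx : ∀ a b, δ (S.Ω a b) = S.q a * S.r b) (j : ℕ) : S.chain j = S.gaugeChain j := by
  suffices h : S.chain j = S.gaugeChain j ∧
      ∀ a b, δ ((S.gaugeChain j).Ω a b) = (S.gaugeChain j).q a * (S.gaugeChain j).r b from h.1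
  induction j with
  | zero => exact ⟨rfl, hx⟩
  | succ j ih =>
    by_cases h : j < k
    · have hu := hS ⟨j, h⟩
      rw [ih.1] at hu
      refine ⟨chain_eq_gaugeChain_succ (i := ⟨j, h⟩) ih.1 ih.2 hu.1 hu.2, ?_⟩
      rw [gaugeChain_succ S ⟨j, h⟩]
      exact binaryGauge_sep_x hu.2 ih.2
    · rw [chain_succ_of_le S (not_lt.mp h), gaugeChain_succ_of_le S (not_lt.mp h)]
      exact ih

/-! ### Functoriality -/

section map

variable {A' : Type*} [CommRing A'] [Algebra ℂ A'] {δ' : Derivation ℂ A' A'}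

/-- Change of coefficients. -/
def map (φ : A →+* A') (S : Data δ k) : Data δ' k where
  D := S.D.map φ
  q a := φ (S.q a)
  r b := φ (S.r b)
  Ω a b := φ (S.Ω a b)
  τ := φ S.τ

variable {φ : A →+* A'}

theorem map_L (hφ : ∀ a, φ (δ a) = δ' (φ a)) (S : Data δ k) :
    (S.map φ : Data δ' k).L = S.L.map φ := by
  rw [L, L, PsiDO.map_mul hφ, PsiDO.map_mul hφ, map_dpow, map_inv hφ]
  rfl

theorem map_val (hφ : ∀ a, φ (δ a) = δ' (φ a)) (S : Data δ k) (N : Obs) :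
    (S.map φ : Data δ' k).val N = φ (S.val N) := by
  cases N with
  | lax n => simp only [val, map_L hφ, coeff_map]
  | wave n => simp only [val, applyExp, map_zsmul]; rfl
  | adjointWave n =>
    simp only [val, applyExp, map_zsmul, ← coeff_map (δ' := δ'), map_adj hφ, map_inv hφ]
    rfl
  | _ => rfl

theorem map_binaryGauge (hφ : ∀ a, φ (δ a) = δ' (φ a)) {S : Data δ k} {i : Fin k}
    (hΩ : IsUnit (S.Ω (some i) (some i))) :
    (S.map φ : Data δ' k).binaryGauge i = (S.binaryGauge i).map φ := by
  have hω : Ring.inverse (φ (S.Ω (some i) (some i))) = φ (Ring.inverse (S.Ω (some i) (some i))) :=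
    inverse_eq (by rw [← _root_.map_mul, Ring.mul_inverse_cancel _ hΩ, _root_.map_one])
  ext1 <;> simp only [binaryGauge, map, hω, _root_.map_sub, _root_.map_mul, _root_.map_neg]
  simp only [PsiDO.gauge, PsiDO.map_mul hφ, PsiDO.map_sub, PsiDO.map_one, map_fn, map_dpow,
    _root_.map_mul]

theorem map_gaugeChain (hφ : ∀ a, φ (δ a) = δ' (φ a)) {S : Data δ k} {j : ℕ}
    (hΩ : ∀ i : Fin k, i < j → IsUnit ((S.gaugeChain i).Ω (some i) (some i))) :
    (S.map φ : Data δ' k).gaugeChain j = (S.gaugeChain j).map φ := by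
  induction j with
  | zero => rfl
  | succ j ih =>
    by_cases h : j < k
    · rw [gaugeChain_succ _ ⟨j, h⟩, gaugeChain_succ _ ⟨j, h⟩]
      simp only
      rw [ih fun i hi => hΩ i (hi.trans j.lt_succ_self), map_binaryGauge hφ (hΩ ⟨j, h⟩ j.lt_succ_self)]
    · rw [gaugeChain_succ_of_le _ (not_lt.mp h), gaugeChain_succ_of_le _ (not_lt.mp h),
        ih fun i hi => hΩ i (hi.trans j.lt_succ_self)]

end map

/-- Multiplication of the adjoint eigenfunctions by constants. -/
def scale (s : Option (Fin k) → A) (S : Data δ k) : Data δ k :=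
  { S with r := fun b => s b * S.r b, Ω := fun a b => s b * S.Ω a b }

/-- The constants subtracted from the SEPs at the start of the chain. -/
def shiftConst (A : Type*) [CommRing A] {k : ℕ} : Option (Fin k) → Option (Fin k) → A
  | some i, some j => if i = j then 1 else 0
  | _, _ => 0

theorem shift_eq (S : Data δ k) :
    S.shift = { S with Ω := fun a b => S.Ω a b - shiftConst A a b } := by
  ext1 <;> try rfl
  funext a b
  rcases a with _ | a <;> rcases b with _ | b <;> simp [shift, shiftConst]

/-- The scaling factors of the adjoint eigenfunctions: `x` for the generating pairs. -/
def scaleConst {A : Type*} [CommRing A] {k : ℕ} (x : A) : Option (Fin k) → A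
  | some _ => x
  | none => 1

/-- Separates the extension of scalars to `A[[ε]]` from the scaling of the `rᵢ` by the constant `ε`;
each operation preserves solutions for its own reason. -/
theorem formal_eq (S : Data δ k) : S.formal =
    (S.map PowerSeries.C : Data (liftDer δ) k).scale (scaleConst PowerSeries.X) := by
  ext1 <;> try rfl
  · funext b
    rcases b with _ | b <;> simp [formal, scale, map, scaleConst]
  · funext a b
    rcases b with _ | b <;> simp [formal, scale, map, scaleConst]

end Data

theorem liftDer_C (d : Derivation ℂ A A) (a : A) :
    liftDer d (PowerSeries.C a) = PowerSeries.C (d a) := by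
  ext n
  rw [coeff_liftDer, PowerSeries.coeff_C, PowerSeries.coeff_C]
  split_ifs <;> simp

theorem liftDer_X (d : Derivation ℂ A A) : liftDer d PowerSeries.X = 0 := by
  ext n
  rw [coeff_liftDer, PowerSeries.coeff_X]
  split_ifs <;> simp

/-! ### Stability of solutions under chains, change of coefficients, scaling and change of constants
-/

namespace IsSolution

variable {d : ℕ → Derivation ℂ A A} {S : Data (d 0) k}

theorem gaugeChain (hd : ∀ m n f, d m (d n f) = d n (d m f)) (hS : IsSolution d S)
    (hΩ : ∀ i : Fin k, IsUnit ((S.gaugeChain i).Ω (some i) (some i))) (j : ℕ) :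
    IsSolution d (S.gaugeChain j) := by
  induction j with
  | zero => exact hS
  | succ j ih =>
    by_cases h : j < k
    · rw [Data.gaugeChain_succ S ⟨j, h⟩]
      exact ih.binaryGauge hd (hΩ ⟨j, h⟩)
    · rw [Data.gaugeChain_succ_of_le S (not_lt.mp h)]
      exact ih

theorem map {A' : Type*} [CommRing A'] [Algebra ℂ A'] {d' : ℕ → Derivation ℂ A' A'}
    (φ : A →ₐ[ℂ] A') (hφ : ∀ n a, φ (d n a) = d' n (φ a)) (hS : IsSolution d S) :
    IsSolution d' (S.map (φ : A →+* A') : Data (d' 0) k) := by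
  have h0 : ∀ a, (φ : A →+* A') (d 0 a) = d' 0 ((φ : A →+* A') a) := hφ 0
  have hL : ∀ n, (S.map (φ : A →+* A') : Data (d' 0) k).L.pow n =
      (S.L.pow n).map (φ : A →+* A') := fun n => by
    rw [pow_eq, pow_eq, map_pow h0, Data.map_L h0]
  have hc : ∀ (n : ℕ) (P : PsiDO (d 0)), ((P.map (φ : A →+* A') : PsiDO (d' 0))).derivCoeff (d' n) =
      (P.derivCoeff (d n)).map (φ : A →+* A') := fun n P => by
    ext i; exact (hφ n _).symm
  refine ⟨?_, fun i hi => ?_, fun n => ?_, fun a n => ?_, fun b n => ?_, fun a b => ?_,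
    fun a b n => ?_, hS.isUnit_tau.map φ, fun n => ?_⟩
  · exact (congrArg φ hS.coeff_zero).trans (_root_.map_one φ)
  · exact (congrArg φ (hS.coeff_pos i hi)).trans (_root_.map_zero φ)
  · rw [hL, ← map_negPart]
    change (S.D.map (φ : A →+* A')).derivCoeff (d' n) = -(_ * S.D.map (φ : A →+* A'))
    rw [hc, hS.dressing, PsiDO.map_neg, PsiDO.map_mul h0]
  · rw [hL, ← map_nonnegPart]
    refine (hφ n _).symm.trans ?_
    rw [hS.eigenfunction]
    exact map_apply h0 _ _
  · rw [hL, ← map_nonnegPart, ← map_adj h0]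
    refine (hφ n _).symm.trans ?_
    rw [hS.adjointEigenfunction, _root_.map_neg]
    exact congrArg _ (map_apply h0 _ _)
  · refine (hφ 0 _).symm.trans ?_
    rw [hS.sep_x, _root_.map_mul]
    rfl
  · rw [hL, ← map_nonnegPart]
    refine (hφ n _).symm.trans ?_
    rw [hS.sep]
    refine (map_res (φ := (φ : A →+* A')) (δ' := d' 0) _).symm.trans ?_
    rw [PsiDO.map_mul h0, PsiDO.map_mul h0, PsiDO.map_mul h0, PsiDO.map_mul h0, map_dpow, map_fn,
      map_fn]
    rfl
  · have h := congrArg φ (hS.tau n)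
    rw [map_miwaShift φ hφ, _root_.map_mul] at h
    refine Eq.trans ?_ h
    refine congrArg (· * φ S.τ) ?_
    simp only [applyExp, map_zsmul]
    rfl

theorem scale {s : Option (Fin k) → A} (hs : ∀ n b, d n (s b) = 0) (hS : IsSolution d S) :
    IsSolution d (S.scale s) := by
  have hfn : ∀ b (x : A), (dpow (-1) * fn (s b * x) : PsiDO (d 0)) =
      fn (s b) * (dpow (-1) * fn x) := fun b x => dpow_neg_one_mul_fn_mul_of_deriv_eq_zero (hs 0 b) x
  refine ⟨hS.coeff_zero, hS.coeff_pos, hS.dressing, hS.eigenfunction, fun b n => ?_,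
    fun a b => ?_, fun a b n => ?_, hS.isUnit_tau, hS.tau⟩
  · rw [adj_apply_eq_res]
    change d n (s b * S.r b) = -(dpow (-1) * fn (s b * S.r b) * (S.L.pow (n + 1)).nonnegPart).res
    rw [hfn, mul_assoc, res_fn_mul, ← adj_apply_eq_res, Derivation.leibniz, hs, smul_zero,
      add_zero, hS.adjointEigenfunction, smul_eq_mul, mul_neg]
  · change d 0 (s b * S.Ω a b) = S.q a * (s b * S.r b)
    rw [Derivation.leibniz, hs, smul_zero, add_zero, hS.sep_x, smul_eq_mul]
    ring
  · change d n (s b * S.Ω a b) = (dpow (-1) * fn (s b * S.r b) * (S.L.pow (n + 1)).nonnegPart *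
      fn (S.q a) * dpow (-1)).res
    rw [hfn, mul_assoc, mul_assoc, mul_assoc, res_fn_mul, Derivation.leibniz, hs, smul_zero,
      add_zero, hS.sep, smul_eq_mul]
    simp only [mul_assoc]

theorem shift (hS : IsSolution d S) : IsSolution d S.shift := by
  have h0 : ∀ (n : ℕ) (a b : Option (Fin k)), d n (Data.shiftConst A a b : A) = 0 := by
    intro n a b
    rcases a with _ | a <;> rcases b with _ | b <;> simp [Data.shiftConst, apply_ite (d n)]
  rw [Data.shift_eq]
  refine ⟨hS.coeff_zero, hS.coeff_pos, hS.dressing, hS.eigenfunction, hS.adjointEigenfunction,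
    fun a b => ?_, fun a b n => ?_, hS.isUnit_tau, hS.tau⟩
  · simp only [_root_.map_sub, h0, sub_zero, hS.sep_x]
  · simp only [_root_.map_sub, h0, sub_zero]
    exact hS.sep a b n

theorem formal (hS : IsSolution d S) : IsSolution (fun n => liftDer (d n)) S.formal := by
  rw [Data.formal_eq]
  refine scale (d := fun n => liftDer (d n)) (fun n b => ?_) ?_
  · rcases b with _ | b
    · exact (liftDer (d n)).map_one_eq_zero
    · exact liftDer_X (d n)
  · exact map (d' := fun n => liftDer (d n))
      { PowerSeries.C with commutes' := fun _ => PowerSeries.algebraMap_apply.symm }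
      (fun n a => (liftDer_C (d n) a).symm) hS

end IsSolution

end KP

end

noncomputable section

namespace KP

open PsiDO

variable {A : Type*} [CommRing A] [Algebra ℂ A] {δ : Derivation ℂ A A} {k : ℕ}

/-! ### Evaluation of differential polynomials -/

theorem deriv_aeval {σ B : Type*} [CommRing B] [Algebra ℂ B]
    (φ : MvPolynomial σ ℂ →ₐ[ℂ] B) (t : Derivation ℂ B B)
    (v : Derivation ℂ (MvPolynomial σ ℂ) (MvPolynomial σ ℂ))
    (h : ∀ i, t (φ (MvPolynomial.X i)) = φ (v (MvPolynomial.X i))) (f : MvPolynomial σ ℂ) :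
    t (φ f) = φ (v f) := by
  induction f using MvPolynomial.induction_on with
  | C a =>
    rw [← MvPolynomial.algebraMap_eq, AlgHom.commutes, Derivation.map_algebraMap,
      Derivation.map_algebraMap, _root_.map_zero]
  | add p q hp hq => simp only [_root_.map_add, hp, hq]
  | mul_X p i hp =>
    simp only [_root_.map_mul, Derivation.leibniz, hp, h, smul_eq_mul, _root_.map_add]

theorem constantCoeff_liftDer (d : Derivation ℂ A A) (f : PowerSeries A) :
    PowerSeries.constantCoeff (liftDer d f) = d (PowerSeries.constantCoeff f) := by
  rw [← PowerSeries.coeff_zero_eq_constantCoeff_apply, coeff_liftDer,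
    PowerSeries.coeff_zero_eq_constantCoeff_apply]

theorem sum_derivation_apply {ι B : Type*} [CommRing B] [Algebra ℂ B] (I : Finset ι)
    (v : ι → Derivation ℂ B B) (f : B) : (∑ i ∈ I, v i) f = ∑ i ∈ I, v i f := by
  classical
  induction I using Finset.induction_on with
  | empty => simp
  | insert a s ha ih => rw [Finset.sum_insert ha, Finset.sum_insert ha, Derivation.add_apply, ih]

namespace Data

theorem eval_jetDx {S : Data δ k} (hx : ∀ a b, δ (S.Ω a b) = S.q a * S.r b) (f : JetRing k) :
    S.eval (jetDx k f) = δ (S.eval f) := by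
  refine (deriv_aeval S.eval δ (jetDx k) (fun v => ?_) f).symm
  rw [jetDx, MvPolynomial.mkDerivation_X]
  cases v <;> simp only [eval, MvPolynomial.aeval_X, _root_.map_mul, hx, Function.iterate_zero, id,
    ← Function.iterate_succ_apply' (f := δ)]

theorem map_eval_jetData {S : Data δ k} (hD : IsMonic S.D) :
    ((jetData k).map (S.eval : JetRing k →+* A) : Data δ k) = S := by
  obtain ⟨h0, hpos⟩ := isMonic_iff.mp hD
  ext i
  · change S.eval ((jetData k).D.coeff i) = S.D.coeff i
    simp only [jetData]
    split_ifs with h h'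
    · rw [_root_.map_one, h, h0]
    · rw [eval, MvPolynomial.aeval_X]
      simp only [Function.iterate_zero, id]
      congr 1
      omega
    · rw [_root_.map_zero, hpos i (by omega)]
  all_goals simp [map, jetData, eval]

/-! ### Flows with respect to the formal parameter -/

/-- The derivation `d / dε`. -/
def epsDer (A : Type*) [CommRing A] [Algebra ℂ A] :
    Derivation ℂ (PowerSeries A) (PowerSeries A) :=
  (PowerSeries.derivative A).restrictScalars ℂ

theorem coeff_epsDer (f : PowerSeries A) (n : ℕ) :
    PowerSeries.coeff n (epsDer A f) = PowerSeries.coeff (n + 1) f * (n + 1) :=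
  PowerSeries.coeff_derivative f n

theorem epsDer_X : epsDer A PowerSeries.X = 1 := PowerSeries.derivative_X

theorem epsDer_C (a : A) : epsDer A (PowerSeries.C a) = 0 := PowerSeries.derivative_C

theorem epsDer_liftDer (d : Derivation ℂ A A) (f : PowerSeries A) :
    epsDer A (liftDer d f) = liftDer d (epsDer A f) := by
  ext n
  rw [coeff_epsDer, coeff_liftDer, coeff_liftDer, coeff_epsDer, Derivation.leibniz]
  have : d ((n : A) + 1) = 0 := by rw [_root_.map_add, Derivation.map_natCast, d.map_one_eq_zero, add_zero]
  rw [this, smul_zero, zero_add, smul_eq_mul, mul_comm]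

/-- `Z` is a solution of `dZ / dε = ∑_{i ∈ I} ∂*_{qᵢ, rᵢ} Z`. -/
structure IsFlow (I : Finset (Fin k)) (Z : Data (liftDer δ) k) : Prop where
  isMonic : IsMonic Z.D
  sep_x : ∀ a b, liftDer δ (Z.Ω a b) = Z.q a * Z.r b
  dressing : ∀ n, epsDer A (Z.D.coeff n) = ∑ i ∈ I, Z.q (some i) *
    (dpow (-1) * fn (Z.r (some i)) * Z.D).coeff n
  eigenfunction : ∀ a, epsDer A (Z.q a) = ∑ i ∈ I, Z.q (some i) * Z.Ω a (some i)
  adjointEigenfunction : ∀ b, epsDer A (Z.r b) = ∑ i ∈ I, Z.Ω (some i) b * Z.r (some i)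
  sep : ∀ a b, epsDer A (Z.Ω a b) = ∑ i ∈ I, Z.Ω (some i) b * Z.Ω a (some i)
  tau : epsDer A Z.τ = -∑ i ∈ I, Z.Ω (some i) (some i) * Z.τ

/-- Both sides are derivations along `Z.eval`, so it suffices to compare them on the jet variables.
There they are the equations of `IsFlow`, differentiated `l` times with respect to `x`, which
commutes with `d/dε`. -/
theorem IsFlow.eval_sesFlow {Z : Data (liftDer δ) k} (hZ : IsFlow Finset.univ Z) (f : JetRing k) :
    epsDer A (Z.eval f) = Z.eval ((∑ i, sesFlow k i) f) := by
  have hx := eval_jetDx hZ.sep_x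
  have hit : ∀ (l : ℕ) (g : JetRing k),
      Z.eval ((jetDx k)^[l] g) = (liftDer δ)^[l] (Z.eval g) := fun l g =>
    Function.Semiconj.iterate_right (fun g => hx g) l g
  have hc : ∀ (l : ℕ) (g : PowerSeries A),
      epsDer A ((liftDer δ)^[l] g) = (liftDer δ)^[l] (epsDer A g) := fun l g =>
    Function.Commute.iterate_right (fun g => epsDer_liftDer δ g) l g
  have hs : ∀ (l : ℕ) (g : Fin k → PowerSeries A),
      (liftDer δ)^[l] (∑ i, g i) = ∑ i, (liftDer δ)^[l] (g i) := fun l g => by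
    induction l generalizing g with
    | zero => rfl
    | succ l ih => simp only [Function.iterate_succ_apply, map_sum, ih]
  have hJ := map_eval_jetData hZ.isMonic
  have hq : ∀ a, Z.eval ((jetData k).q a) = Z.q a := fun a => congrFun (congrArg Data.q hJ) a
  have hr : ∀ a, Z.eval ((jetData k).r a) = Z.r a := fun a => congrFun (congrArg Data.r hJ) a
  have hΩ : ∀ a b, Z.eval ((jetData k).Ω a b) = Z.Ω a b := fun a b =>
    congrFun (congrFun (congrArg Data.Ω hJ) a) b
  have hτ : Z.eval (jetData k).τ = Z.τ := congrArg Data.τ hJ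
  have hD : (jetData k).D.map (Z.eval : JetRing k →+* PowerSeries A) = Z.D := congrArg Data.D hJ
  have hφ : ∀ a, (Z.eval : JetRing k →+* PowerSeries A) (jetDx k a) =
    liftDer δ ((Z.eval : JetRing k →+* PowerSeries A) a) := hx
  refine deriv_aeval Z.eval (epsDer A) (∑ i, sesFlow k i) (fun v => ?_) f
  rw [sum_derivation_apply, map_sum]
  simp only [sesFlow, MvPolynomial.mkDerivation_X]
  cases v with
  | w n l =>
    simp only [hit]
    have h : ∀ i : Fin k, Z.eval ((fn ((jetData k).q (some i)) * dpow (-1) *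
        fn ((jetData k).r (some i)) * (jetData k).D).coeff (-(n + 1 : ℤ))) =
        Z.q (some i) * (dpow (-1) * fn (Z.r (some i)) * Z.D).coeff (-(n + 1 : ℤ)) := fun i => by
      have := coeff_map (φ := (Z.eval : JetRing k →+* PowerSeries A)) (δ' := liftDer δ)
        (fn ((jetData k).q (some i)) * dpow (-1) * fn ((jetData k).r (some i)) * (jetData k).D)
        (-(n + 1 : ℤ))
      refine this.symm.trans ?_
      rw [PsiDO.map_mul hφ, PsiDO.map_mul hφ, PsiDO.map_mul hφ, hD, map_fn, map_fn, map_dpow,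
        mul_assoc, mul_assoc, coeff_fn_mul, mul_assoc]
      exact congrArg₂ (fun x y => x * (dpow (-1) * (fn y * Z.D)).coeff (-(n + 1 : ℤ)))
        (hq _) (hr _)
    simp only [h]
    rw [eval, MvPolynomial.aeval_X]
    simp only [hc, hZ.dressing, hs]
  | q a l =>
    simp only [hit, _root_.map_mul, hq, hΩ]
    rw [eval, MvPolynomial.aeval_X]
    simp only [hc, hZ.eigenfunction, hs]
  | r b l =>
    simp only [hit, _root_.map_mul, hr, hΩ]
    rw [eval, MvPolynomial.aeval_X]
    simp only [hc, hZ.adjointEigenfunction, hs, mul_comm]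
  | Ω a b =>
    simp only [_root_.map_mul, hΩ]
    rw [eval, MvPolynomial.aeval_X]
    exact hZ.sep a b
  | τ l =>
    simp only [hit, _root_.map_mul, _root_.map_neg, hΩ, hτ]
    rw [eval, MvPolynomial.aeval_X]
    simp only [hc, hZ.tau, ← Finset.sum_neg_distrib, hs]

/-- The exponential series of the squared eigenfunction flows is the Taylor series of the solution
of the flow equations. -/
theorem IsFlow.val_eq {S : Data δ k} {Z : Data (liftDer δ) k} (hZ : IsFlow Finset.univ Z)
    (hS : (Z.map (PowerSeries.constantCoeff (R := A)) : Data δ k) = S) (N : Obs) :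
    Z.val N = PowerSeries.mk (S.expTerm N) := by
  have hit : ∀ (l : ℕ) (f : PowerSeries A), PowerSeries.constantCoeff ((liftDer δ)^[l] f) =
      δ^[l] (PowerSeries.constantCoeff f) := fun l f => PsiDO.map_iterate (constantCoeff_liftDer δ) l f
  have h0 : ∀ f : JetRing k, PowerSeries.constantCoeff (Z.eval f) = S.eval f := by
    intro f
    induction f using MvPolynomial.induction_on with
    | C a =>
      rw [← MvPolynomial.algebraMap_eq, AlgHom.commutes, AlgHom.commutes,
        PowerSeries.algebraMap_apply, PowerSeries.constantCoeff_C]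
    | add p q hp hq => simp only [_root_.map_add, hp, hq]
    | mul_X p i hp =>
      rw [_root_.map_mul, _root_.map_mul, _root_.map_mul, hp, ← hS]
      congr 1
      rw [eval, eval, MvPolynomial.aeval_X, MvPolynomial.aeval_X]
      cases i <;> simp only [hit] <;> rfl
  -- The map iterated in `expTerm` is the sum of the flows as functions, not the sum of derivations
  -- coerced to a function.
  have hsum : ∀ g : JetRing k, (∑ i, ⇑(sesFlow k i)) g = (∑ i, sesFlow k i) g := fun g => by
    rw [Finset.sum_apply, sum_derivation_apply]
  -- Comparison of coefficients in `d/dε`: `(m + 1)` times the coefficient of `εᵐ⁺¹` of the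
  -- evaluated `f` is the coefficient of `εᵐ` of the evaluated flow of `f`.
  have key : ∀ (m : ℕ) (f : JetRing k), PowerSeries.coeff m (Z.eval f) =
      (m.factorial : ℂ)⁻¹ • S.eval ((∑ i, sesFlow k i)^[m] f) := by
    intro m
    induction m with
    | zero => intro f; simp [h0]
    | succ m ih =>
      intro f
      have h := ih ((∑ i, sesFlow k i) f)
      rw [← hZ.eval_sesFlow, coeff_epsDer, ← hsum f, ← Function.iterate_succ_apply] at h
      have hm : (m : ℂ) + 1 ≠ 0 := by exact_mod_cast m.succ_ne_zero
      have e : PowerSeries.coeff (m + 1) (Z.eval f) * ((m : A) + 1) =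
          ((m : ℂ) + 1) • PowerSeries.coeff (m + 1) (Z.eval f) := by
        rw [Algebra.smul_def, mul_comm]; simp
      rw [e] at h
      have h' := congrArg (((m : ℂ) + 1)⁻¹ • ·) h
      simp only [smul_smul, inv_mul_cancel₀ hm, one_smul] at h'
      rw [h', Nat.factorial_succ, Nat.cast_mul, mul_inv, Nat.cast_succ]
  ext m
  rw [PowerSeries.coeff_mk, expTerm, ← key]
  congr 1
  conv_lhs => rw [← map_eval_jetData hZ.isMonic]
  exact map_val (fun a => eval_jetDx hZ.sep_x a) _ N

/-- The scalar computation common to the coefficients of `D`, the eigenfunctions, the adjoint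
eigenfunctions and the SEPs; `θ` is `d/dε` and `X` is `ε`. The terms with `i ∈ I` come from the flow
of `x`, `y`, `z`, `W`. The explicit dependence on `ε` gives `y_j z_j ω²`, which is the new term `i =
j`, because `1 - X W_jj ω = -ω`. -/
theorem deriv_gauge_step {B : Type*} [CommRing B] [Algebra ℂ B] (θ : Derivation ℂ B B)
    {ι : Type*} [DecidableEq ι] {I : Finset ι} {j : ι} (hj : j ∉ I) {x X ω : B} {y z : ι → B}
    {W : ι → ι → B} (hX : θ X = 1) (hω : (X * W j j - 1) * ω = 1)
    (hx : θ x = ∑ i ∈ I, y i * z i) (hy : θ (y j) = ∑ i ∈ I, y i * W j i)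
    (hz : θ (z j) = ∑ i ∈ I, W i j * z i) (hW : θ (W j j) = ∑ i ∈ I, W i j * W j i) :
    θ (x - y j * ω * (X * z j)) =
      ∑ i ∈ insert j I, (y i - y j * ω * (X * W i j)) * (z i - X * W j i * ω * z j) := by
  have e : ∑ i ∈ I, (y i - y j * ω * (X * W i j)) * (z i - X * W j i * ω * z j) =
      θ x - y j * ω * X * θ (z j) - X * ω * z j * θ (y j) +
        y j * ω * X * X * ω * z j * θ (W j j) := by
    rw [hx, hy, hz, hW, Finset.mul_sum, Finset.mul_sum, Finset.mul_sum, ← Finset.sum_sub_distrib,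
      ← Finset.sum_sub_distrib, ← Finset.sum_add_distrib]
    exact Finset.sum_congr rfl fun i _ => by ring
  rw [Finset.sum_insert hj, e]
  have hθω := deriv_inverse hω θ
  simp only [_root_.map_sub, Derivation.leibniz, smul_eq_mul, hX, Derivation.map_one_eq_zero, sub_zero,
    mul_one] at hθω ⊢
  rw [hθω]
  linear_combination (-y j * z j * (X * W j j * ω - 1) - y j * z j * ω) * hω +
    y j * z j * ω * hω

end Data

end KP

end

noncomputable section

namespace KP

open PsiDO

variable {A : Type*} [CommRing A] [Algebra ℂ A] {δ : Derivation ℂ A A} {k : ℕ}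

/-! ### The chain with the formal parameter solves the flow equations -/

theorem PsiDO.fn_sum {ι : Type*} (I : Finset ι) (f : ι → A) :
    (fn (∑ i ∈ I, f i) : PsiDO δ) = ∑ i ∈ I, fn (f i) := by
  classical
  induction I using Finset.induction_on with
  | empty => rw [Finset.sum_empty, Finset.sum_empty, fn_zero]
  | insert a s ha ih => rw [Finset.sum_insert ha, Finset.sum_insert ha, fn_add, ih]

namespace Data

/-- One step of the chain for the pair `(q_j, ε r_j)`, expressed in terms of `r_j` and of SEPs
without shifts of constants. -/
def flowStep (Z : Data (liftDer δ) k) (j : Fin k) : Data (liftDer δ) k :=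
  let X : PowerSeries A := PowerSeries.X
  let ω := Ring.inverse (X * Z.Ω (some j) (some j) - 1)
  { D := gauge (Z.q (some j)) (X * Z.r (some j)) ω * Z.D
    q := fun a => Z.q a - Z.q (some j) * ω * (X * Z.Ω a (some j))
    r := fun b => Z.r b - X * Z.r (some j) * ω * Z.Ω (some j) b
    Ω := fun a b => Z.Ω a b - X * Z.Ω a (some j) * ω * Z.Ω (some j) b
    τ := -((X * Z.Ω (some j) (some j) - 1) * Z.τ) }

omit [Algebra ℂ A] in
theorem isUnit_X_mul_sub_one (f : PowerSeries A) : IsUnit (PowerSeries.X * f - 1) := by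
  rw [PowerSeries.isUnit_iff_constantCoeff]
  simp

/-- The operator `∂⁻¹ r_b D` plays the role of the SEP of the wave function with `r_b` and flows
like one. The nonlocal product is resolved by `∂⁻¹ Ω' ∂⁻¹ = Ω ∂⁻¹ - ∂⁻¹ Ω` with `Ω' = qᵢ r_b`. It is
needed to treat the coefficients of `D` on the same footing as the other objects. -/
theorem IsFlow.derivCoeff_dpow_neg_one_mul {I : Finset (Fin k)} {Z : Data (liftDer δ) k}
    (hZ : IsFlow I Z) (b : Option (Fin k)) :
    (dpow (-1) * fn (Z.r b) * Z.D).derivCoeff (epsDer A) =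
      ∑ i ∈ I, fn (Z.Ω (some i) b) * (dpow (-1) * fn (Z.r (some i)) * Z.D) := by
  have hD : Z.D.derivCoeff (epsDer A) =
      ∑ i ∈ I, fn (Z.q (some i)) * (dpow (-1) * fn (Z.r (some i)) * Z.D) := by
    ext n
    simp only [coeff_derivCoeff, hZ.dressing, PsiDO.coeff_sum, coeff_fn_mul]
  have hr : (fn (epsDer A (Z.r b)) : PsiDO (liftDer δ)) =
      ∑ i ∈ I, fn (Z.Ω (some i) b) * fn (Z.r (some i)) := by
    rw [hZ.adjointEigenfunction, fn_sum]
    simp only [fn_mul_fn]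
  have hc := epsDer_liftDer δ
  rw [derivCoeff_mul hc, derivCoeff_mul hc, derivCoeff_dpow, derivCoeff_fn, hD, hr, zero_mul,
    zero_add, Finset.mul_sum, Finset.mul_sum, Finset.sum_mul, ← Finset.sum_add_distrib]
  refine Finset.sum_congr rfl fun i _ => ?_
  have h := dpow_neg_one_mul_fn_mul_dpow_neg_one (δ := liftDer δ) (Z.Ω (some i) b)
  rw [hZ.sep_x, mul_comm, ← fn_mul_fn] at h
  calc _ = dpow (-1) * fn (Z.Ω (some i) b) * fn (Z.r (some i)) * Z.D +
        (dpow (-1) * (fn (Z.r b) * fn (Z.q (some i))) * dpow (-1)) * fn (Z.r (some i)) * Z.D := by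
        noncomm_ring
    _ = _ := by rw [h]; noncomm_ring

/-- A step for the pair `j` adds the `j`-th flow to those already present. The equations for `D`,
`q`, `r` and `Ω` are instances of `deriv_gauge_step`; for `D`, the transformed `∂⁻¹ rᵢ D` is
computed with `dpow_neg_one_mul_fn_mul_gauge`. -/
theorem IsFlow.flowStep {I : Finset (Fin k)} {Z : Data (liftDer δ) k} (hZ : IsFlow I Z)
    {j : Fin k} (hj : j ∉ I) : IsFlow (insert j I) (Z.flowStep j) := by
  set X : PowerSeries A := PowerSeries.X with hXdef
  set ω := Ring.inverse (X * Z.Ω (some j) (some j) - 1) with hωdef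
  have hω : (X * Z.Ω (some j) (some j) - 1) * ω = 1 :=
    Ring.mul_inverse_cancel _ (isUnit_X_mul_sub_one _)
  have hδX : liftDer δ X = 0 := liftDer_X δ
  have hδΩ : liftDer δ (X * Z.Ω (some j) (some j) - 1) = Z.q (some j) * (X * Z.r (some j)) := by
    rw [_root_.map_sub, Derivation.leibniz, hδX, hZ.sep_x, Derivation.map_one_eq_zero]
    simp only [smul_eq_mul]
    ring
  have hX : epsDer A X = 1 := epsDer_X
  have hXV : (dpow (-1) * fn (X * Z.r (some j)) * Z.D : PsiDO (liftDer δ)) =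
      fn X * (dpow (-1) * fn (Z.r (some j)) * Z.D) := by
    rw [dpow_neg_one_mul_fn_mul_of_deriv_eq_zero hδX, mul_assoc]
  have hW : ∀ a b, epsDer A (Z.Ω a b) = ∑ i ∈ I, Z.Ω (some i) b * Z.Ω a (some i) := hZ.sep
  refine ⟨isMonic_gauge_mul _ _ _ hZ.isMonic, fun a b => ?_, fun n => ?_, fun a => ?_, fun b => ?_,
    fun a b => ?_, ?_⟩
  · change liftDer δ (Z.Ω a b - X * Z.Ω a (some j) * ω * Z.Ω (some j) b) =
      (Z.q a - Z.q (some j) * ω * (X * Z.Ω a (some j))) *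
        (Z.r b - X * Z.r (some j) * ω * Z.Ω (some j) b)
    have h := deriv_inverse hω (liftDer δ)
    rw [hδΩ] at h
    simp only [_root_.map_sub, Derivation.leibniz, h, hδX, hZ.sep_x, smul_eq_mul]
    ring
  · have h := deriv_gauge_step (epsDer A) hj (x := Z.D.coeff n) (y := fun i => Z.q (some i))
      (z := fun i => (dpow (-1) * fn (Z.r (some i)) * Z.D).coeff n)
      (W := fun a b => Z.Ω (some a) (some b)) hX hω (hZ.dressing n)
      (hZ.eigenfunction (some j))
      (by
        have := congrArg (fun P => P.coeff n) (hZ.derivCoeff_dpow_neg_one_mul (some j))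
        simpa only [coeff_derivCoeff, PsiDO.coeff_sum, coeff_fn_mul] using this) (hW (some j) (some j))
    have e : (gauge (Z.q (some j)) (X * Z.r (some j)) ω * Z.D).coeff n = Z.D.coeff n -
        Z.q (some j) * ω * (X * (dpow (-1) * fn (Z.r (some j)) * Z.D).coeff n) := by
      rw [PsiDO.gauge, sub_mul, one_mul, mul_assoc, mul_assoc, ← mul_assoc (dpow (-1)), hXV, coeff_sub,
        coeff_fn_mul, coeff_fn_mul]
    change epsDer A ((gauge (Z.q (some j)) (X * Z.r (some j)) ω * Z.D).coeff n) = _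
    rw [e, h]
    refine Finset.sum_congr rfl fun i _ => congrArg₂ (· * ·) rfl ?_
    change _ = (dpow (-1) * fn (Z.r (some i) - X * Z.r (some j) * ω * Z.Ω (some j) (some i)) *
      (gauge (Z.q (some j)) (X * Z.r (some j)) ω * Z.D)).coeff n
    rw [← mul_assoc, dpow_neg_one_mul_fn_mul_gauge hω hδΩ (hZ.sep_x (some j) (some i)), sub_mul,
      coeff_sub, mul_assoc (fn _), mul_assoc (fn _), hXV, coeff_fn_mul, coeff_fn_mul]
    ring
  · have h := deriv_gauge_step (epsDer A) hj (x := Z.q a) (y := fun i => Z.q (some i))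
      (z := fun i => Z.Ω a (some i)) (W := fun a b => Z.Ω (some a) (some b)) hX hω
      (hZ.eigenfunction a) (hZ.eigenfunction (some j)) (hW a (some j)) (hW (some j) (some j))
    change epsDer A (Z.q a - Z.q (some j) * ω * (X * Z.Ω a (some j))) = _
    rw [h]
    refine Finset.sum_congr rfl fun i _ => ?_
    change _ = (Z.q (some i) - Z.q (some j) * ω * (X * Z.Ω (some i) (some j))) *
      (Z.Ω a (some i) - X * Z.Ω a (some j) * ω * Z.Ω (some j) (some i))
    ring
  · have h := deriv_gauge_step (epsDer A) hj (x := Z.r b)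
      (y := fun i => Z.Ω (some i) b) (z := fun i => Z.r (some i))
      (W := fun a b => Z.Ω (some a) (some b)) hX hω (hZ.adjointEigenfunction b)
      (hW (some j) b) (hZ.adjointEigenfunction (some j)) (hW (some j) (some j))
    change epsDer A (Z.r b - X * Z.r (some j) * ω * Z.Ω (some j) b) = _
    rw [show Z.r b - X * Z.r (some j) * ω * Z.Ω (some j) b =
      Z.r b - Z.Ω (some j) b * ω * (X * Z.r (some j)) by ring, h]
    refine Finset.sum_congr rfl fun i _ => ?_
    change _ = (Z.Ω (some i) b - X * Z.Ω (some i) (some j) * ω * Z.Ω (some j) b) *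
      (Z.r (some i) - X * Z.r (some j) * ω * Z.Ω (some j) (some i))
    ring
  · have h := deriv_gauge_step (epsDer A) hj (x := Z.Ω a b)
      (y := fun i => Z.Ω (some i) b) (z := fun i => Z.Ω a (some i))
      (W := fun a b => Z.Ω (some a) (some b)) hX hω (hW a b) (hW (some j) b) (hW a (some j))
      (hW (some j) (some j))
    change epsDer A (Z.Ω a b - X * Z.Ω a (some j) * ω * Z.Ω (some j) b) = _
    rw [show Z.Ω a b - X * Z.Ω a (some j) * ω * Z.Ω (some j) b =
      Z.Ω a b - Z.Ω (some j) b * ω * (X * Z.Ω a (some j)) by ring, h]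
    refine Finset.sum_congr rfl fun i _ => ?_
    change _ = (Z.Ω (some i) b - X * Z.Ω (some i) (some j) * ω * Z.Ω (some j) b) *
      (Z.Ω a (some i) - X * Z.Ω a (some j) * ω * Z.Ω (some j) (some i))
    ring
  · change epsDer A (-((X * Z.Ω (some j) (some j) - 1) * Z.τ)) = -∑ i ∈ insert j I,
      (Z.Ω (some i) (some i) - X * Z.Ω (some i) (some j) * ω * Z.Ω (some j) (some i)) *
        -((X * Z.Ω (some j) (some j) - 1) * Z.τ)
    -- The factor `ε Ω_jj - 1` of the new tau function cancels `ω`, so the corrections add up to the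
    -- derivative of `Ω_jj` along the old flows.
    have e : ∑ i ∈ I, (Z.Ω (some i) (some i) - X * Z.Ω (some i) (some j) * ω *
        Z.Ω (some j) (some i)) * -((X * Z.Ω (some j) (some j) - 1) * Z.τ) =
        -(X * Z.Ω (some j) (some j) - 1) * ∑ i ∈ I, Z.Ω (some i) (some i) * Z.τ +
        X * Z.τ * ∑ i ∈ I, Z.Ω (some i) (some j) * Z.Ω (some j) (some i) := by
      rw [Finset.mul_sum, Finset.mul_sum, ← Finset.sum_add_distrib]
      refine Finset.sum_congr rfl fun i _ => ?_
      linear_combination X * Z.Ω (some i) (some j) * Z.Ω (some j) (some i) * Z.τ * hω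
    rw [Finset.sum_insert hj, e, ← hW]
    have ht := hZ.tau
    rw [eq_comm, neg_eq_iff_eq_neg] at ht
    rw [ht]
    simp only [_root_.map_neg, _root_.map_sub, Derivation.leibniz, hX, smul_eq_mul,
      Derivation.map_one_eq_zero]
    linear_combination (X * Z.Ω (some j) (some j) * Z.Ω (some j) (some j) * Z.τ) * hω

theorem map_constantCoeff_flowStep (Z : Data (liftDer δ) k) (j : Fin k) :
    ((Z.flowStep j).map (PowerSeries.constantCoeff (R := A)) : Data δ k) =
      Z.map (PowerSeries.constantCoeff (R := A)) := by
  ext1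
  · simp only [map, flowStep, PsiDO.map_mul (constantCoeff_liftDer δ), PsiDO.gauge, PsiDO.map_sub,
      PsiDO.map_one, map_fn, _root_.map_mul, PowerSeries.constantCoeff_X, zero_mul, fn_zero,
      mul_zero, sub_zero, one_mul]
  all_goals simp [map, flowStep]

/-- Comparison of the steps of the chain for `(qᵢ, ε rᵢ)` with the solution of the flow equations. -/
structure IsFormalChain (j : ℕ) (T Z : Data (liftDer δ) k) : Prop where
  D_eq : T.D = Z.D
  τ_eq : T.τ = Z.τ
  q_eq : ∀ a, (∀ i : Fin k, a = some i → j ≤ i) → T.q a = Z.q a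
  r_eq : ∀ b, (∀ i : Fin k, b = some i → j ≤ i) → T.r b = scaleConst PowerSeries.X b * Z.r b
  Ω_eq : ∀ a b, (∀ i : Fin k, a = some i → j ≤ i) → (∀ i : Fin k, b = some i → j ≤ i) →
    T.Ω a b = scaleConst PowerSeries.X b * Z.Ω a b - shiftConst (PowerSeries A) a b

theorem IsFormalChain.Ω_self {j : Fin k} {T Z : Data (liftDer δ) k} (h : IsFormalChain j T Z) :
    T.Ω (some j) (some j) = PowerSeries.X * Z.Ω (some j) (some j) - 1 := by
  have hj : ∀ i : Fin k, some j = some i → (j : ℕ) ≤ i := fun i hi => by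
    rw [Option.some_inj.mp hi]
  rw [h.Ω_eq _ _ hj hj]
  simp [scaleConst, shiftConst]

/-- Among the indices still in use, the shift of constants only matters for the entry `(j, j)`,
which becomes `ε Ω_jj - 1`. The index `j` has to be dropped afterwards: the chain sends its own
generator to `q_j - q_j Ω_jj⁻¹ Ω_jj = 0`, whereas the unshifted data keep `-q_j ω`. -/
theorem IsFormalChain.step {j : Fin k} {T Z : Data (liftDer δ) k} (h : IsFormalChain j T Z) :
    IsFormalChain (j + 1) (T.binaryGauge j) (Z.flowStep j) := by
  have hj : ∀ i : Fin k, some j = some i → (j : ℕ) ≤ i := fun i hi => by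
    rw [Option.some_inj.mp hi]
  have hle : ∀ {a : Option (Fin k)}, (∀ i : Fin k, a = some i → (j : ℕ) + 1 ≤ i) →
      ∀ i : Fin k, a = some i → (j : ℕ) ≤ i := fun ha i hi => (Nat.le_succ _).trans (ha i hi)
  have hc : ∀ {a : Option (Fin k)}, (∀ i : Fin k, a = some i → (j : ℕ) + 1 ≤ i) →
      shiftConst (PowerSeries A) a (some j) = 0 ∧ shiftConst (PowerSeries A) (some j) a = 0 := by
    intro a ha
    rcases a with _ | i
    · exact ⟨rfl, rfl⟩
    · have hij : i ≠ j := fun hij => by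
        have := ha i rfl
        rw [hij] at this
        omega
      simp [shiftConst, hij, hij.symm]
  refine ⟨?_, ?_, fun a ha => ?_, fun b hb => ?_, fun a b ha hb => ?_⟩
  · simp only [binaryGauge, flowStep, h.Ω_self, h.D_eq, h.q_eq _ hj, h.r_eq _ hj, scaleConst]
  · simp only [binaryGauge, flowStep, h.Ω_self, h.τ_eq]
  · simp only [binaryGauge, flowStep, h.Ω_self, h.q_eq _ hj, h.q_eq _ (hle ha),
      h.Ω_eq _ _ (hle ha) hj, (hc ha).1, sub_zero, scaleConst]
  · simp only [binaryGauge, flowStep, h.Ω_self, h.r_eq _ hj, h.r_eq _ (hle hb),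
      h.Ω_eq _ _ hj (hle hb), (hc hb).2, sub_zero, scaleConst]
    ring
  · simp only [binaryGauge, flowStep, h.Ω_self, h.Ω_eq _ _ (hle ha) (hle hb),
      h.Ω_eq _ _ (hle ha) hj, h.Ω_eq _ _ hj (hle hb), (hc ha).1, (hc hb).2, sub_zero, scaleConst]
    ring

theorem isFormalChain_zero (S : Data δ k) :
    IsFormalChain 0 S.formal.shift (S.map PowerSeries.C) := by
  rw [shift_eq, formal_eq]
  exact ⟨rfl, rfl, fun _ _ => rfl, fun _ _ => rfl, fun _ _ _ _ => rfl⟩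

theorem isFlow_empty {S : Data δ k} (hD : IsMonic S.D)
    (hx : ∀ a b, δ (S.Ω a b) = S.q a * S.r b) :
    IsFlow ∅ (S.map PowerSeries.C : Data (liftDer δ) k) where
  isMonic := hD.map
  sep_x a b := by simp only [map, liftDer_C, hx, _root_.map_mul]
  dressing _ := epsDer_C _
  eigenfunction _ := epsDer_C _
  adjointEigenfunction _ := epsDer_C _
  sep _ _ := epsDer_C _
  tau := by rw [Finset.sum_empty, neg_zero]; exact epsDer_C _

/-- The initial value at `ε = 0` is unchanged in each step because every correction carries a factor
`ε`, and for `τ` the factor `-(ε Ω - 1)` is `1` there. -/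
theorem exists_isFormalChain {S : Data δ k} (hD : IsMonic S.D)
    (hx : ∀ a b, δ (S.Ω a b) = S.q a * S.r b) {j : ℕ} (hj : j ≤ k) :
    ∃ Z : Data (liftDer δ) k, IsFlow (Finset.univ.filter fun i : Fin k => (i : ℕ) < j) Z ∧
      (Z.map (PowerSeries.constantCoeff (R := A)) : Data δ k) = S ∧
      IsFormalChain j (S.formal.shift.gaugeChain j) Z := by
  induction j with
  | zero =>
    refine ⟨S.map PowerSeries.C, by simpa using isFlow_empty hD hx, ?_, isFormalChain_zero S⟩
    ext <;> simp [map, PsiDO.map]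
  | succ j ih =>
    obtain ⟨Z, hZ, h0, hT⟩ := ih (Nat.le_of_succ_le hj)
    refine ⟨Z.flowStep ⟨j, hj⟩, ?_, (map_constantCoeff_flowStep Z _).trans h0, ?_⟩
    · have e : (Finset.univ.filter fun i : Fin k => (i : ℕ) < j + 1) =
          insert ⟨j, hj⟩ (Finset.univ.filter fun i : Fin k => (i : ℕ) < j) := by
        ext i
        simp only [Finset.mem_filter_univ, Finset.mem_insert, Fin.ext_iff]
        omega
      rw [e]
      exact hZ.flowStep (by simp)
    · rw [gaugeChain_succ _ ⟨j, hj⟩]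
      exact IsFormalChain.step (j := ⟨j, hj⟩) hT

theorem isUnit_formal_sep {S : Data δ k} (hD : IsMonic S.D)
    (hx : ∀ a b, δ (S.Ω a b) = S.q a * S.r b) (i : Fin k) :
    IsUnit ((S.formal.shift.gaugeChain i).Ω (some i) (some i)) := by
  obtain ⟨Z, -, -, hT⟩ := exists_isFormalChain hD hx i.2.le
  rw [hT.Ω_self]
  exact isUnit_X_mul_sub_one _

theorem isUnit_formal_eigenfunction {S : Data δ k} (hD : IsMonic S.D)
    (hx : ∀ a b, δ (S.Ω a b) = S.q a * S.r b) {i : Fin k} (hq : IsUnit (S.q (some i))) :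
    IsUnit ((S.formal.shift.gaugeChain i).q (some i)) := by
  obtain ⟨Z, -, h0, hT⟩ := exists_isFormalChain hD hx i.2.le
  rw [hT.q_eq _ fun j hj => by rw [Option.some_inj.mp hj], PowerSeries.isUnit_iff_constantCoeff]
  rw [← h0] at hq
  exact hq

/-- The objects in question involve only `D`, `τ` and the index `none`, which is never used up and
is neither shifted nor scaled. So the chain agrees with the solution of the flow equations on them.
-/
theorem val_formal_gaugeChain {S : Data δ k} (hD : IsMonic S.D)
    (hx : ∀ a b, δ (S.Ω a b) = S.q a * S.r b) (N : Obs) :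
    (S.formal.shift.gaugeChain k).val N = PowerSeries.mk (S.expTerm N) := by
  obtain ⟨Z, hZ, h0, hT⟩ := exists_isFormalChain hD hx le_rfl
  rw [Finset.filter_true_of_mem fun i _ => i.2] at hZ
  rw [← hZ.val_eq h0]
  have hn : ∀ i : Fin k, none = some i → k ≤ i := fun i hi => nomatch hi
  have hq := hT.q_eq _ hn
  have hr := hT.r_eq _ hn
  have hΩ := hT.Ω_eq _ _ hn hn
  simp only [scaleConst, shiftConst, one_mul, sub_zero] at hq hr hΩ
  cases N <;> simp only [val, L, hT.D_eq, hT.τ_eq, hq, hr, hΩ]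

end Data

end KP

end

noncomputable section

namespace KP

open PsiDO

variable {A : Type*} [CommRing A] [Algebra ℂ A]

/-! ### Specialization of the formal parameter -/

/-- The pairs `(f, a)` such that `P f = Q` and `P(1) a = Q(1)` for polynomials `P`, `Q` with
`P(1)` invertible: `f` is a rational function of `ε` with value `a` at `ε = 1`. -/
def specialization (A : Type*) [CommRing A] [Algebra ℂ A] : Subalgebra ℂ (PowerSeries A × A) where
  carrier := {p | ∃ P Q : Polynomial A, IsUnit (P.eval 1) ∧ (P : PowerSeries A) * p.1 = Q ∧
    P.eval 1 * p.2 = Q.eval 1}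
  mul_mem' := by
    rintro p p' ⟨P, Q, hP, hf, ha⟩ ⟨P', Q', hP', hf', ha'⟩
    refine ⟨P * P', Q * Q', by simpa using hP.mul hP', ?_, ?_⟩
    · rw [Polynomial.coe_mul, Polynomial.coe_mul, ← hf, ← hf', Prod.fst_mul]
      ring
    · rw [Polynomial.eval_mul, Polynomial.eval_mul, ← ha, ← ha', Prod.snd_mul]
      ring
  add_mem' := by
    rintro p p' ⟨P, Q, hP, hf, ha⟩ ⟨P', Q', hP', hf', ha'⟩
    refine ⟨P * P', Q * P' + P * Q', by simpa using hP.mul hP', ?_, ?_⟩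
    · rw [Polynomial.coe_add, Polynomial.coe_mul, Polynomial.coe_mul, Polynomial.coe_mul, ← hf,
        ← hf', Prod.fst_add]
      ring
    · rw [Polynomial.eval_add, Polynomial.eval_mul, Polynomial.eval_mul, Polynomial.eval_mul, ← ha,
        ← ha', Prod.snd_add]
      ring
  algebraMap_mem' c := by
    refine ⟨1, Polynomial.C (algebraMap ℂ A c), by simp, ?_, by simp⟩
    rw [Polynomial.coe_one, one_mul, Polynomial.coe_C]
    exact PowerSeries.algebraMap_apply

theorem exists_polynomial_deriv (δ : Derivation ℂ A A) (P : Polynomial A) :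
    ∃ P' : Polynomial A, (P' : PowerSeries A) = liftDer δ P ∧ P'.eval 1 = δ (P.eval 1) := by
  induction P using Polynomial.induction_on' with
  | add P Q hP hQ =>
    obtain ⟨P', hP, hP1⟩ := hP
    obtain ⟨Q', hQ, hQ1⟩ := hQ
    exact ⟨P' + Q', by rw [Polynomial.coe_add, Polynomial.coe_add, _root_.map_add, hP, hQ],
      by rw [Polynomial.eval_add, Polynomial.eval_add, _root_.map_add, hP1, hQ1]⟩
  | monomial n a =>
    refine ⟨Polynomial.monomial n (δ a), ?_, by simp⟩
    ext m
    rw [coeff_liftDer, Polynomial.coeff_coe, Polynomial.coeff_coe, Polynomial.coeff_monomial,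
      Polynomial.coeff_monomial]
    split_ifs <;> simp

theorem deriv_mem_specialization (δ : Derivation ℂ A A) {p : PowerSeries A × A}
    (hp : p ∈ specialization A) : (liftDer δ p.1, δ p.2) ∈ specialization A := by
  obtain ⟨P, Q, hP, hf, ha⟩ := hp
  obtain ⟨P', hP', hP1⟩ := exists_polynomial_deriv δ P
  obtain ⟨Q', hQ', hQ1⟩ := exists_polynomial_deriv δ Q
  refine ⟨P * P, P * Q' - P' * Q, by simpa using hP.mul hP, ?_, ?_⟩
  · rw [Polynomial.coe_sub, Polynomial.coe_mul, Polynomial.coe_mul, Polynomial.coe_mul, hP', hQ',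
      ← hf, Derivation.leibniz, smul_eq_mul, smul_eq_mul]
    ring
  · rw [Polynomial.eval_sub, Polynomial.eval_mul, Polynomial.eval_mul, Polynomial.eval_mul, hP1,
      hQ1, ← ha, Derivation.leibniz, smul_eq_mul, smul_eq_mul]
    ring

theorem isUnit_of_isUnit_fst_snd {p : specialization A} (h1 : IsUnit p.1.1) (h2 : IsUnit p.1.2) :
    IsUnit p := by
  obtain ⟨P, Q, hP, hf, ha⟩ := p.2
  -- Numerator and denominator exchange roles; `Q(1) = P(1) a` is invertible because the value `a`
  -- is.
  have hm : (Ring.inverse p.1.1, Ring.inverse p.1.2) ∈ specialization A := by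
    refine ⟨Q, P, ?_, ?_, ?_⟩
    · rw [← ha]
      exact hP.mul h2
    · rw [← hf, mul_assoc, Ring.mul_inverse_cancel _ h1, mul_one]
    · rw [← ha, mul_assoc, Ring.mul_inverse_cancel _ h2, mul_one]
  refine IsUnit.of_mul_eq_one ⟨_, hm⟩ (Subtype.ext (Prod.ext ?_ ?_))
  · exact Ring.mul_inverse_cancel _ h1
  · exact Ring.mul_inverse_cancel _ h2

/-- A derivation of `A` acting on rational functions of `ε` and on their values. -/
def specializationDer (δ : Derivation ℂ A A) :
    Derivation ℂ (specialization A) (specialization A) :=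
  Derivation.mk'
    { toFun := fun p => ⟨(liftDer δ p.1.1, δ p.1.2), deriv_mem_specialization δ p.2⟩
      map_add' := fun _ _ => Subtype.ext <| Prod.ext (_root_.map_add (liftDer δ) _ _)
        (_root_.map_add δ _ _)
      map_smul' := fun _ _ => Subtype.ext <| Prod.ext (Derivation.map_smul (liftDer δ) _ _)
        (Derivation.map_smul δ _ _) }
    fun _ _ => Subtype.ext <| Prod.ext ((liftDer δ).leibniz _ _) (δ.leibniz _ _)

/-! ### Convergent sums of coefficients of rational functions -/

section Topology

variable [TopologicalSpace A] [IsTopologicalRing A]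

omit [Algebra ℂ A] in
/-- Multiplication by a polynomial `P` multiplies the sum of the coefficients by `P(1)`. -/
theorem tendsto_sum_coeff_polynomial_mul {f : PowerSeries A} {s : A}
    (h : Filter.Tendsto (fun n => ∑ m ∈ Finset.range n, PowerSeries.coeff m f) Filter.atTop (nhds s))
    (P : Polynomial A) :
    Filter.Tendsto (fun n => ∑ m ∈ Finset.range n, PowerSeries.coeff m ((P : PowerSeries A) * f))
      Filter.atTop (nhds (P.eval 1 * s)) := by
  induction P using Polynomial.induction_on' with
  | add P Q hP hQ =>
    simp only [Polynomial.coe_add, add_mul, _root_.map_add, Finset.sum_add_distrib,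
      Polynomial.eval_add]
    exact hP.add hQ
  | monomial e a =>
    -- Multiplication by `εᵉ` shifts the coefficients by `e`, so the partial sums agree with those
    -- of `f` after a shift of the index.
    rw [← Filter.tendsto_add_atTop_iff_nat e]
    have h' := h.const_mul a
    simp only [Polynomial.eval_monomial, one_pow, mul_one]
    refine h'.congr fun n => ?_
    simp only [Polynomial.coe_monomial, PowerSeries.monomial_eq_C_mul_X_pow, mul_assoc,
      PowerSeries.coeff_C_mul, PowerSeries.coeff_X_pow_mul']
    have h0 : ∑ m ∈ Finset.range e, a * (if e ≤ m then PowerSeries.coeff (m - e) f else 0) = 0 :=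
      Finset.sum_eq_zero fun m hm => by
        rw [if_neg (not_le.mpr (Finset.mem_range.mp hm)), mul_zero]
    rw [add_comm n e, Finset.sum_range_add, h0, zero_add, Finset.mul_sum]
    exact Finset.sum_congr rfl fun m _ => by rw [if_pos (Nat.le_add_right e m), Nat.add_sub_cancel_left]

omit [Algebra ℂ A] in
theorem tendsto_sum_coeff_polynomial (Q : Polynomial A) :
    Filter.Tendsto (fun n => ∑ m ∈ Finset.range n, PowerSeries.coeff m (Q : PowerSeries A))
      Filter.atTop (nhds (Q.eval 1)) := by
  have h1 : Filter.Tendsto (fun n => ∑ m ∈ Finset.range n,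
      PowerSeries.coeff m (1 : PowerSeries A)) Filter.atTop (nhds 1) := by
    rw [← Filter.tendsto_add_atTop_iff_nat 1]
    refine tendsto_const_nhds.congr fun n => ?_
    rw [Finset.sum_range_succ', Finset.sum_eq_zero fun m _ => ?_]
    · simp
    · simp [PowerSeries.coeff_one]
  simpa using tendsto_sum_coeff_polynomial_mul h1 Q

/-- The coefficients of `P f = Q` sum to `P(1) s` by continuity and to `Q(1) = P(1) a` because there
are finitely many; `P(1)` cancels. Neither absolute convergence nor an Abel type theorem is
involved. -/
theorem eq_of_mem_specialization [T2Space A] {f : PowerSeries A} {a s : A}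
    (hp : (f, a) ∈ specialization A)
    (h : Filter.Tendsto (fun n => ∑ m ∈ Finset.range n, PowerSeries.coeff m f)
      Filter.atTop (nhds s)) : a = s := by
  obtain ⟨P, Q, hP, hf, ha⟩ := hp
  have h1 := tendsto_sum_coeff_polynomial_mul h P
  rw [show (P : PowerSeries A) * f = Q from hf] at h1
  have h2 := tendsto_nhds_unique h1 (tendsto_sum_coeff_polynomial Q)
  exact hP.mul_left_cancel (ha.trans h2.symm)

end Topology

namespace Data

variable {δ : Derivation ℂ A A} {k : ℕ}

/-- The value at `ε = 1` of each object of the chain with the formal parameter is the corresponding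
object of the chain without the parameter. -/
theorem val_mem_specialization {S : Data δ k}
    (h1 : ∀ i : Fin k, IsUnit ((S.formal.shift.gaugeChain i).Ω (some i) (some i)))
    (h2 : ∀ i : Fin k, IsUnit ((S.shift.gaugeChain i).Ω (some i) (some i))) (N : Obs) :
    ((S.formal.shift.gaugeChain k).val N, (S.shift.gaugeChain k).val N) ∈ specialization A := by
  let const : A →+* specialization A :=
    ((PowerSeries.C : A →+* PowerSeries A).prod (RingHom.id A)).codRestrict (specialization A)
      fun a => ⟨1, Polynomial.C a, by simp, by simp, by simp⟩
  let x : specialization A := ⟨(PowerSeries.X, 1), 1, Polynomial.X, by simp, by simp, by simp⟩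
  -- The chain is run once over the ring of rational functions paired with their values, with `x =
  -- (ε, 1)` in place of `ε`. Its two projections are the chain with the formal parameter and the
  -- chain without it.
  let T : Data (specializationDer δ) k := ((S.map const : Data (specializationDer δ) k).scale
    (scaleConst x)).shift
  let π₁ : specialization A →+* PowerSeries A :=
    (RingHom.fst (PowerSeries A) A).comp (specialization A).val.toRingHom
  let π₂ : specialization A →+* A :=
    (RingHom.snd (PowerSeries A) A).comp (specialization A).val.toRingHom
  have hπ₁ : ∀ p, π₁ (specializationDer δ p) = liftDer δ (π₁ p) := fun _ => rfl
  have hπ₂ : ∀ p, π₂ (specializationDer δ p) = δ (π₂ p) := fun _ => rfl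
  have hT₁ : (T.map π₁ : Data (liftDer δ) k) = S.formal.shift := by
    rw [formal_eq]
    ext1
    · rfl
    · rfl
    · funext b
      rcases b with _ | b <;> rfl
    · funext a b
      rcases a with _ | a <;> rcases b with _ | b <;> try rfl
      change π₁ (x * const _ - if a = b then 1 else 0) = _
      rw [_root_.map_sub, apply_ite π₁, _root_.map_one, _root_.map_zero]
      rfl
    · rfl
  have hT₂ : (T.map π₂ : Data δ k) = S.shift := by
    ext1
    · rfl
    · rfl
    · funext b
      rcases b with _ | b <;> exact one_mul _
    · funext a b
      rcases a with _ | a <;> rcases b with _ | b <;> try exact one_mul _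
      change π₂ (x * const _ - if a = b then 1 else 0) = _
      rw [_root_.map_sub, apply_ite π₂, _root_.map_one, _root_.map_zero]
      exact congrArg (· - _) (one_mul _)
    · rfl
  -- An element of this ring is invertible as soon as both components are. The components are SEPs
  -- of the two given chains, but the projections commute with the chain only up to steps already
  -- known to be defined; hence the strong induction.
  have hu : ∀ i : Fin k, IsUnit ((T.gaugeChain i).Ω (some i) (some i)) := by
    suffices h : ∀ (j : ℕ) (i : Fin k), i < j → IsUnit ((T.gaugeChain i).Ω (some i) (some i)) from
      fun i => h k i i.2
    intro j
    induction j with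
    | zero => exact fun i hi => absurd hi i.val.not_lt_zero
    | succ j ih =>
      intro i hi
      have hij : ∀ l : Fin k, l < (i : ℕ) → IsUnit ((T.gaugeChain l).Ω (some l) (some l)) :=
        fun l hl => ih l (by omega)
      refine isUnit_of_isUnit_fst_snd ?_ ?_
      · have h := h1 i
        rw [← hT₁, map_gaugeChain hπ₁ hij] at h
        exact h
      · have h := h2 i
        rw [← hT₂, map_gaugeChain hπ₂ hij] at h
        exact h
  have e1 := map_val hπ₁ (T.gaugeChain k) N
  have e2 := map_val hπ₂ (T.gaugeChain k) N
  rw [← map_gaugeChain hπ₁ fun i _ => hu i, hT₁] at e1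
  rw [← map_gaugeChain hπ₂ fun i _ => hu i, hT₂] at e2
  rw [e1, e2]
  exact ((T.gaugeChain k).val N).2

end Data

end KP

end

/-! ### The main theorem -/

theorem mainTheorem12 {A : Type*} [CommRing A] [Algebra ℂ A] [TopologicalSpace A]
    [IsTopologicalRing A] [T2Space A] (d : ℕ → Derivation ℂ A A)
    (hd : ∀ m n f, d m (d n f) = d n (d m f)) (k : ℕ) (S : KP.Data (d 0) k)
    (hS : KP.IsSolution d S) :
    -- with a formal parameter `ε`
    ((∀ i : Fin k, IsUnit (S.q (some i))) →
      S.formal.shift.DarbouxDefined ∧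
      KP.IsSolution (fun n => KP.liftDer (d n)) S.formal.shift.darboux ∧
      ∀ N : KP.Obs, S.formal.shift.darboux.val N = PowerSeries.mk (S.expTerm N)) ∧
    -- without the parameter
    (S.shift.DarbouxDefined →
      KP.IsSolution d S.shift.darboux ∧
      ∀ (N : KP.Obs) (s : A),
        Filter.Tendsto (fun n => ∑ m ∈ Finset.range n, S.expTerm N m) Filter.atTop (nhds s) →
          S.shift.darboux.val N = s) := by
  have hΩ := KP.Data.isUnit_formal_sep hS.isMonic hS.sep_x
  have hval := KP.Data.val_formal_gaugeChain hS.isMonic hS.sep_x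
  have hF := hS.formal.shift
  refine ⟨fun hq => ?_, fun hDef => ?_⟩
  · have hq' := fun i => KP.Data.isUnit_formal_eigenfunction hS.isMonic hS.sep_x (hq i)
    have hchain := KP.Data.chain_eq_gaugeChain hF.sep_x hΩ hq'
    have hdarboux : S.formal.shift.darboux = S.formal.shift.gaugeChain k := hchain k
    refine ⟨fun i => ?_, ?_, fun N => ?_⟩
    · rw [hchain]
      exact ⟨hq' i, hΩ i⟩
    · rw [hdarboux]
      refine KP.IsSolution.gaugeChain (d := fun n => KP.liftDer (d n)) (fun m n f => ?_) hF hΩ k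
      ext i
      simp only [KP.coeff_liftDer, hd m n]
    · rw [hdarboux, hval]
  · have hchain := hDef.chain_eq_gaugeChain hS.shift.sep_x
    have hdarboux : S.shift.darboux = S.shift.gaugeChain k := hchain k
    have hΩ' : ∀ i : Fin k, IsUnit ((S.shift.gaugeChain i).Ω (some i) (some i)) := fun i => by
      rw [← hchain]
      exact (hDef i).2
    rw [hdarboux]
    refine ⟨hS.shift.gaugeChain hd hΩ' k, fun N s hs => ?_⟩
    -- The sum of the exponential series is the sum of the Taylor coefficients in `ε`, and must be
    -- the value at `ε = 1`.
    refine KP.eq_of_mem_specialization (KP.Data.val_mem_specialization hΩ hΩ' N) ?_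
    rw [hval]
    simpa only [PowerSeries.coeff_mk] using hs
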